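/- Let $g_0(t)=2^{1/4}e^{-\pi t^2}$, $t\in\mathbb{R}$. For $\alpha,\beta>0$ let $\Lambda_{\alpha,\beta}=\alpha\mathbb{Z}\times\beta\mathbb{Z}$, and for $\lambda=(x,\omega)\in\mathbb{R}^2$ let $\pi(\lambda)g_0(t)=e^{2\pi i\omega t}g_0(t-x)$. Let $A(\alpha,\beta)\in[0,\infty]$ be the largest and $B(\alpha,\beta)\in[0,\infty]$ the smallest constant such that $$A(\alpha,\beta)\,\|f\|_2^2\ \le\ \sum_{\lambda\in\Lambda_{\alpha,\beta}}|\langle f,\pi(\lambda)g_0\rangle|^2\ \le\ B(\alpha,\beta)\,\|f\|_2^2\qquad\text{for all } f\in L^2(\mathbb{R})$$ (the optimal lower and upper frame bounds of the Gabor system $\{\pi(\lambda)g_0:\lambda\in\Lambda_{\alpha,\beta}\}$). Let $n\ge 1$ be an integer. Then among all separable lattices $\Lambda_{\alpha,\beta}$ with $\alpha,\beta>0$ and $(\alpha\beta)^{-1}=n$, the square lattice, $\alpha=\beta=n^{-1/2}$, maximizes $A$ and minimizes $B$: for all such $\alpha,\beta$, $$A(\alpha,\beta)\le A(n^{-1/2},n^{-1/2})\qquad\text{and}\qquad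 B(n^{-1/2},n^{-1/2})\le B(\alpha,\beta).$$ -/

import Mathlib

open scoped ENNReal ComplexConjugate
open MeasureTheory

noncomputable section

/-- The time-frequency shift `π(p) g = M_ω T_x g` of `g : ℝ → ℂ` by the point `p = (x, ω)` of the
time-frequency plane: `(π(p) g)(t) = e^{2πiωt} g(t - x)`. -/
def timeFreqShift (p : ℝ × ℝ) (g : ℝ → ℂ) : ℝ → ℂ :=
  fun t => Complex.exp (2 * Real.pi * Complex.I * p.2 * t) * g (t - p.1)

/-- The inner product `⟨f, h⟩ = ∫ f(t) conj(h(t)) dt` of `L²(ℝ)`. -/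
def innerL2 (f h : ℝ → ℂ) : ℂ :=
  ∫ t, f t * conj (h t)

/-- The frame sum `∑_{p ∈ Λ} |⟨f, π(p) g⟩|²` of the Gabor system of `g` over `Λ`, in `[0, ∞]`. -/
def gaborSum (g : ℝ → ℂ) (Λ : Set (ℝ × ℝ)) (f : ℝ → ℂ) : ℝ≥0∞ :=
  ∑' p : Λ, ‖innerL2 f (timeFreqShift p g)‖ₑ ^ 2

/-- `A` satisfies the lower frame inequality `A ‖f‖₂² ≤ ∑_{p ∈ Λ} |⟨f, π(p) g⟩|²`
for all `f ∈ L²(ℝ)`. -/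
def IsLowerFrameBound (g : ℝ → ℂ) (Λ : Set (ℝ × ℝ)) (A : ℝ≥0∞) : Prop :=
  ∀ f : ℝ → ℂ, MemLp f 2 volume → A * eLpNorm f 2 volume ^ 2 ≤ gaborSum g Λ f

/-- `B` satisfies the upper frame inequality `∑_{p ∈ Λ} |⟨f, π(p) g⟩|² ≤ B ‖f‖₂²`
for all `f ∈ L²(ℝ)`. -/
def IsUpperFrameBound (g : ℝ → ℂ) (Λ : Set (ℝ × ℝ)) (B : ℝ≥0∞) : Prop :=
  ∀ f : ℝ → ℂ, MemLp f 2 volume → gaborSum g Λ f ≤ B * eLpNorm f 2 volume ^ 2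

/-- The optimal (largest) lower frame bound of the Gabor system of `g` over `Λ`, in `[0, ∞]`. -/
def optimalLowerFrameBound (g : ℝ → ℂ) (Λ : Set (ℝ × ℝ)) : ℝ≥0∞ :=
  sSup {A | IsLowerFrameBound g Λ A}

/-- The optimal (smallest) upper frame bound of the Gabor system of `g` over `Λ`, in `[0, ∞]`. -/
def optimalUpperFrameBound (g : ℝ → ℂ) (Λ : Set (ℝ × ℝ)) : ℝ≥0∞ :=
  sInf {B | IsUpperFrameBound g Λ B}

/-- The separable lattice `αℤ × βℤ` in the time-frequency plane. -/
def separableLattice (α β : ℝ) : Set (ℝ × ℝ) :=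
  {p | ∃ k l : ℤ, p = (α * k, β * l)}

/-- The standard Gaussian window `g₀(t) = 2^{1/4} e^{-πt²}`. -/
def gaussianWindow : ℝ → ℂ :=
  fun t => (((2 : ℝ) ^ (1 / 4 : ℝ) * Real.exp (-Real.pi * t ^ 2) : ℝ) : ℂ)

end

/-! Write `s = 1/(2β²)`, `t = 1/(2α²)`, so that `s t = (n/2)²`. For integer redundancy, Janssen's
representation turns the frame sum into `n ∑ c(d,l) Re⟨f, π(d,l) f⟩`, where the `π(d,l)` are the
shifts of the adjoint lattice and `c(d,l) = (-1)^(ndl) e^{-πd²s} e^{-πl²t}` (`gaborSum_gaussian`).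
The adjoint shifts commute because `n` is an integer. Replacing `π(d,l)` by a sign character
`ς^(d+l)` gives a number `C_ς = ∑ ς^(d+l) c(d,l)`.

On every lattice, functions that are almost invariant under the adjoint lattice up to the character
`ς` show that `n C_ς` is approached by the frame quotient. Hence `A ≤ n C_{-1}` and `n C_1 ≤ B`
(`optimalLowerFrameBound_le`, `le_optimalUpperFrameBound`). The reverse inequalities are needed only
on the square lattice. There the gap between `‖f‖² C_ς` and the form is a weighted sum of squared
distances `‖f - ς^(d+l) π(d,l) f‖²`, and the four nearest lattice points, whose sign is favourable,
outweigh all others (`mul_sub_tsum_nonneg`). It remains to show that, along `s t = (n/2)²`, `C_{-1}`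
is largest and `C_1` smallest at `s = t`.

For even `n`, `C_1 = θ₃(s)θ₃(t)` and `C_{-1} = θ₄(s)θ₄(t)`; for odd `n` both lose `2θ₂(4s)θ₂(4t)`.
In the variable `u = log s`, `log θ₃` is convex and `log θ₄`, `log θ₂` are concave; Jacobi's
transformation reduces this to estimates for `s ≥ 1`. This settles everything except `C_{-1}` for
odd `n`, where both products grow towards the square lattice and compete (`oddSymbolMin_le`). For `n
= 1` the two cancel identically. For `n ≥ 3` the difference is concave in `u` near the square
lattice, and a direct comparison of leading exponentials works away from it. -/

/-! ### Exponential series and their logarithmic derivatives -/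

/-- The series `∑ εₖ cₖᵖ e^{-cₖ s}`. -/
noncomputable def expSeries (ε c : ℕ → ℝ) (p : ℕ) (s : ℝ) : ℝ :=
  ∑' k, ε k * (c k ^ p * Real.exp (-(c k * s)))

/-- Half of the exponential absorbs the power through `xᵖ/p! ≤ eˣ`; the other half is geometric
because `c k ≥ k`. -/
theorem summable_pow_mul_exp_neg {c : ℕ → ℝ} (hc : ∀ k : ℕ, (k : ℝ) ≤ c k) (p : ℕ) {s : ℝ}
    (hs : 0 < s) : Summable fun k => c k ^ p * Real.exp (-(c k * s)) := by
  have h0 : ∀ k, 0 ≤ c k := fun k => (Nat.cast_nonneg k).trans (hc k)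
  have hg : Summable fun k : ℕ => (p.factorial * (2 / s) ^ p) * Real.exp (-(s / 2)) ^ k := by
    refine (summable_geometric_of_lt_one (Real.exp_pos _).le ?_).mul_left _
    rw [Real.exp_lt_one_iff]; linarith
  refine Summable.of_nonneg_of_le (fun k => mul_nonneg (pow_nonneg (h0 k) p) (Real.exp_pos _).le)
    (fun k => ?_) hg
  have h1 : (c k * s / 2) ^ p / p.factorial ≤ Real.exp (c k * s / 2) :=
    Real.pow_div_factorial_le_exp _ (by have := h0 k; positivity) p
  have h2 : c k ^ p ≤ (p.factorial * (2 / s) ^ p) * Real.exp (c k * s / 2) := by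
    rw [div_le_iff₀ (by positivity)] at h1
    have h3 : c k ^ p = (c k * s / 2) ^ p * (2 / s) ^ p := by
      rw [← mul_pow]; congr 1; field_simp
    rw [h3]
    calc (c k * s / 2) ^ p * (2 / s) ^ p
        ≤ (Real.exp (c k * s / 2) * p.factorial) * (2 / s) ^ p := by gcongr
      _ = _ := by ring
  calc c k ^ p * Real.exp (-(c k * s))
      ≤ ((p.factorial * (2 / s) ^ p) * Real.exp (c k * s / 2)) * Real.exp (-(c k * s)) := by gcongr
    _ = (p.factorial * (2 / s) ^ p) * Real.exp (-(c k * s / 2)) := by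
        rw [mul_assoc, ← Real.exp_add]; congr 2; ring
    _ ≤ (p.factorial * (2 / s) ^ p) * Real.exp (-(s / 2)) ^ k := by
        rw [← Real.exp_nat_mul]
        gcongr
        have := mul_le_mul_of_nonneg_right (hc k) (half_pos hs).le
        linarith

theorem summable_mul_pow_mul_exp_neg {ε c : ℕ → ℝ} (hε : ∀ k, |ε k| ≤ 1) (hc : ∀ k : ℕ, (k : ℝ) ≤ c k)
    (p : ℕ) {s : ℝ} (hs : 0 < s) :
    Summable fun k => ε k * (c k ^ p * Real.exp (-(c k * s))) := by
  refine (summable_pow_mul_exp_neg hc p hs).of_norm_bounded (fun k => ?_)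
  have h0 : 0 ≤ c k := (Nat.cast_nonneg k).trans (hc k)
  rw [norm_mul, Real.norm_eq_abs, Real.norm_of_nonneg (by positivity)]
  exact mul_le_of_le_one_left (by positivity) (hε k)

/-- Termwise differentiation on `(s/2, ∞)`, where the derivatives are dominated by their size at
`s/2`. -/
theorem hasDerivAt_expSeries {ε c : ℕ → ℝ} (hε : ∀ k, |ε k| ≤ 1) (hc : ∀ k : ℕ, (k : ℝ) ≤ c k)
    (p : ℕ) {s : ℝ} (hs : 0 < s) :
    HasDerivAt (expSeries ε c p) (-expSeries ε c (p + 1) s) s := by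
  have h0 : ∀ k, 0 ≤ c k := fun k => (Nat.cast_nonneg k).trans (hc k)
  have key := hasDerivAt_tsum_of_isPreconnected (𝕜 := ℝ)
    (g := fun k z => ε k * (c k ^ p * Real.exp (-(c k * z))))
    (g' := fun k z => -(ε k * (c k ^ (p + 1) * Real.exp (-(c k * z)))))
    (summable_pow_mul_exp_neg hc (p + 1) (half_pos hs)) isOpen_Ioi isPreconnected_Ioi
    (fun k y _ => by
      have h1 : HasDerivAt (fun z : ℝ => -(c k * z)) (-(c k * 1)) y :=
        ((hasDerivAt_id y).const_mul (c k)).neg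
      have := ((h1.exp).const_mul (c k ^ p)).const_mul (ε k)
      exact this.congr_deriv (by ring))
    (fun k y hy => by
      have hck := h0 k
      rw [norm_neg, norm_mul, Real.norm_eq_abs, Real.norm_of_nonneg (by positivity)]
      refine (mul_le_of_le_one_left (by positivity) (hε k)).trans ?_
      gcongr
      exact (Set.mem_Ioi.1 hy).le)
    (Set.mem_Ioi.2 (half_lt_self hs)) (summable_mul_pow_mul_exp_neg hε hc p hs)
    (Set.mem_Ioi.2 (half_lt_self hs))
  rw [tsum_neg] at key
  exact key

/-- The first logarithmic derivative of `u ↦ a + b ∑ εₖ e^{-cₖ e^u}`. -/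
theorem hasDerivAt_log_expSeries_exp {ε c : ℕ → ℝ} (hε : ∀ k, |ε k| ≤ 1)
    (hc : ∀ k : ℕ, (k : ℝ) ≤ c k) {a b l m : ℝ}
    (hpos : ∀ s, 0 < s → 0 < a + b * expSeries ε c 0 s) (u : ℝ) :
    HasDerivAt (fun u => Real.log (a + b * expSeries ε c 0 (Real.exp u)) + l * Real.exp u + m * u)
      (-(b * (Real.exp u * expSeries ε c 1 (Real.exp u))) / (a + b * expSeries ε c 0 (Real.exp u))
        + l * Real.exp u + m) u := by
  have hd := (hasDerivAt_expSeries hε hc 0 (Real.exp_pos u)).comp u (Real.hasDerivAt_exp u)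
  have h1 := ((hd.const_mul b).const_add a).log (hpos _ (Real.exp_pos u)).ne'
  have h2 := (h1.add ((Real.hasDerivAt_exp u).const_mul l)).add ((hasDerivAt_id u).const_mul m)
  refine HasDerivAt.congr_deriv h2 ?_
  simp only [Function.comp, zero_add, mul_one]
  congr 3
  ring

/-- The free parameters let one computation serve `θ₃` and `θ₄` (`b = ±2`, `l = 0`) as well as `θ₂`
with its leading exponential factored out (`l = -π/4`); `m = 1/4` is the weight of the functional
equation. -/
theorem hasDerivAt_logDeriv_expSeries_exp {ε c : ℕ → ℝ} (hε : ∀ k, |ε k| ≤ 1)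
    (hc : ∀ k : ℕ, (k : ℝ) ≤ c k) {a b l m : ℝ}
    (hpos : ∀ s, 0 < s → 0 < a + b * expSeries ε c 0 s) (u : ℝ) :
    HasDerivAt (fun u => -(b * (Real.exp u * expSeries ε c 1 (Real.exp u))) /
        (a + b * expSeries ε c 0 (Real.exp u)) + l * Real.exp u + m)
      ((b * (Real.exp u ^ 2 * expSeries ε c 2 (Real.exp u)
            - Real.exp u * expSeries ε c 1 (Real.exp u))
          * (a + b * expSeries ε c 0 (Real.exp u))
          - (b * (Real.exp u * expSeries ε c 1 (Real.exp u))) ^ 2)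
        / (a + b * expSeries ε c 0 (Real.exp u)) ^ 2 + l * Real.exp u) u := by
  have hd0 := (hasDerivAt_expSeries hε hc 0 (Real.exp_pos u)).comp u (Real.hasDerivAt_exp u)
  have hd1 := (hasDerivAt_expSeries hε hc 1 (Real.exp_pos u)).comp u (Real.hasDerivAt_exp u)
  have hn := ((((Real.hasDerivAt_exp u).mul hd1).const_mul b).neg).div
    ((hd0.const_mul b).const_add a) (hpos _ (Real.exp_pos u)).ne'
  have h2 := (hn.add ((Real.hasDerivAt_exp u).const_mul l)).add_const m
  refine HasDerivAt.congr_deriv h2 ?_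
  simp only [Function.comp, zero_add, Pi.neg_apply, Pi.mul_apply, Nat.reduceAdd]
  congr 2
  ring

/-- A function whose second derivative and that of its reflection are nonnegative on `[0, ∞)` is
convex. -/
theorem convexOn_univ_of_reflection {f f₁ f₂ g g₁ g₂ : ℝ → ℝ}
    (hf : ∀ u, HasDerivAt f (f₁ u) u) (hf₁ : ∀ u, HasDerivAt f₁ (f₂ u) u)
    (hg : ∀ u, HasDerivAt g (g₁ u) u) (hg₁ : ∀ u, HasDerivAt g₁ (g₂ u) u)
    (hfg : ∀ u, f u = g (-u)) (hf₂ : ∀ u, 0 ≤ u → 0 ≤ f₂ u) (hg₂ : ∀ u, 0 ≤ u → 0 ≤ g₂ u) :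
    ConvexOn ℝ Set.univ f := by
  have e0 : f = fun u => g (-u) := funext hfg
  have e1 : f₁ = fun u => -g₁ (-u) := by
    funext u
    refine (hf u).unique ?_
    rw [e0]
    simpa using! (hg (-u)).comp u (hasDerivAt_neg u)
  have e2 : ∀ u, f₂ u = g₂ (-u) := by
    intro u
    refine (hf₁ u).unique ?_
    rw [e1]
    simpa using! ((hg₁ (-u)).comp u (hasDerivAt_neg u)).neg
  have d1 : deriv f = f₁ := funext fun u => (hf u).deriv
  have d2 : deriv f₁ = f₂ := funext fun u => (hf₁ u).deriv
  refine convexOn_univ_of_deriv2_nonneg (fun u => (hf u).differentiableAt) ?_ ?_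
  · rw [d1]; exact fun u => (hf₁ u).differentiableAt
  · intro u
    simp only [Function.iterate_succ, Function.iterate_zero, Function.comp, id, d1, d2]
    rcases le_total 0 u with h | h
    · exact hf₂ u h
    · rw [e2]; exact hg₂ _ (by linarith)

/-! ### Elementary tools for series -/

theorem tsum_le_of_le_geometric {f : ℕ → ℝ} {A ρ : ℝ} (hf : ∀ k, 0 ≤ f k) (hρ0 : 0 ≤ ρ)
    (hρ : ρ < 1) (h : ∀ k, f k ≤ A * ρ ^ k) : ∑' k, f k ≤ A / (1 - ρ) := by
  have hg : Summable fun k : ℕ => A * ρ ^ k := (summable_geometric_of_lt_one hρ0 hρ).mul_left A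
  calc ∑' k, f k ≤ ∑' k : ℕ, A * ρ ^ k := (Summable.of_nonneg_of_le hf h hg).tsum_le_tsum h hg
    _ = A / (1 - ρ) := by rw [tsum_mul_left, tsum_geometric_of_lt_one hρ0 hρ, div_eq_mul_inv]

/-- Cauchy–Schwarz, read off from the discriminant of the nonnegative quadratic `l ↦ ∑ (xₖ - l)²
wₖ`. -/
theorem sq_tsum_mul_le {w x : ℕ → ℝ} (hw : ∀ k, 0 ≤ w k) (h0 : Summable w)
    (h1 : Summable fun k => x k * w k) (h2 : Summable fun k => x k ^ 2 * w k) :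
    (∑' k, x k * w k) ^ 2 ≤ (∑' k, w k) * ∑' k, x k ^ 2 * w k := by
  have key : ∀ l : ℝ, 0 ≤ (∑' k, w k) * (l * l) + (-2 * ∑' k, x k * w k) * l
      + ∑' k, x k ^ 2 * w k := by
    intro l
    have hs := ((h0.hasSum.mul_right (l * l)).add ((h1.hasSum.mul_left (-2)).mul_right l)).add
      h2.hasSum
    refine hs.nonneg fun k => ?_
    have : w k * (l * l) + -2 * (x k * w k) * l + x k ^ 2 * w k = (x k - l) ^ 2 * w k := by ring
    rw [this]
    exact mul_nonneg (sq_nonneg _) (hw k)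
  have := discrim_le_zero key
  rw [discrim] at this
  nlinarith

theorem alternating_tsum_bounds {f : ℕ → ℝ} (hf : Antitone f) (hs : Summable f) :
    f 0 - f 1 ≤ ∑' k, (-1) ^ k * f k ∧ ∑' k, (-1) ^ k * f k ≤ f 0 := by
  have ht := hs.tendsto_alternating_series_tsum
  have h1 := hf.alternating_series_le_tendsto ht 1
  have h2 := hf.tendsto_le_alternating_series ht 0
  simp [Finset.sum_range_succ] at h1 h2
  exact ⟨by linarith, h2⟩

/-- The derivative changes sign for the last time at `(3 + √5)/2 < 3`. The threshold 3 suffices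
because all exponents `π(k+1)²s` with `s ≥ 1` exceed it. -/
theorem antitoneOn_sq_sub_mul_exp_neg :
    AntitoneOn (fun x : ℝ => (x ^ 2 - x) * Real.exp (-x)) (Set.Ici 3) := by
  have hd : ∀ x : ℝ, HasDerivAt (fun x : ℝ => (x ^ 2 - x) * Real.exp (-x))
      ((-x ^ 2 + 3 * x - 1) * Real.exp (-x)) x := by
    intro x
    have h1 := ((hasDerivAt_pow 2 x).sub (hasDerivAt_id x)).mul (hasDerivAt_neg x).exp
    refine HasDerivAt.congr_deriv h1 ?_
    simp
    ring
  refine antitoneOn_of_deriv_nonpos (convex_Ici 3) (fun x _ => (hd x).continuousAt.continuousWithinAt)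
    (fun x _ => (hd x).differentiableAt.differentiableWithinAt) fun x hx => ?_
  rw [(hd x).deriv]
  rw [interior_Ici] at hx
  have hx' : (3 : ℝ) < x := hx
  exact mul_nonpos_of_nonpos_of_nonneg (by nlinarith) (Real.exp_pos _).le

/-! ### Theta constants and Jacobi's transformation -/

/-- The exponents `π (k + 1)²`. -/
noncomputable def sqExponent (k : ℕ) : ℝ := Real.pi * ((k : ℝ) + 1) ^ 2

/-- The exponents `π (k + 1/2)²`. -/
noncomputable def halfSqExponent (k : ℕ) : ℝ := Real.pi * ((k : ℝ) + 1 / 2) ^ 2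

/-- The exponents `π (k + 1) (k + 2)`. -/
noncomputable def oblongExponent (k : ℕ) : ℝ := Real.pi * (((k : ℝ) + 1) * (k + 2))

/-- The theta constant `θ₃(s) = ∑_{k ∈ ℤ} e^{-πk²s}`. -/
noncomputable def theta3 (s : ℝ) : ℝ := 1 + 2 * expSeries (fun _ => 1) sqExponent 0 s

/-- The theta constant `θ₄(s) = ∑_{k ∈ ℤ} (-1)ᵏ e^{-πk²s}`. -/
noncomputable def theta4 (s : ℝ) : ℝ := 1 + -2 * expSeries (fun k => (-1) ^ k) sqExponent 0 s

/-- The theta constant `θ₂(s) = ∑_{k ∈ ℤ} e^{-π(k+1/2)²s}`. -/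
noncomputable def theta2 (s : ℝ) : ℝ := 2 * expSeries (fun _ => 1) halfSqExponent 0 s

theorem le_sqExponent (k : ℕ) : (k : ℝ) ≤ sqExponent k := by
  have := Real.pi_gt_three
  have hk : (0 : ℝ) ≤ k := Nat.cast_nonneg k
  unfold sqExponent
  nlinarith [mul_nonneg hk hk]

theorem le_halfSqExponent (k : ℕ) : (k : ℝ) ≤ halfSqExponent k := by
  have := Real.pi_gt_three
  have hk : (0 : ℝ) ≤ k := Nat.cast_nonneg k
  unfold halfSqExponent
  nlinarith [mul_nonneg hk hk]

theorem le_oblongExponent (k : ℕ) : (k : ℝ) ≤ oblongExponent k := by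
  have := Real.pi_gt_three
  have hk : (0 : ℝ) ≤ k := Nat.cast_nonneg k
  unfold oblongExponent
  nlinarith [mul_nonneg hk hk]

theorem abs_one_le : ∀ _ : ℕ, |(1 : ℝ)| ≤ 1 := by simp

theorem abs_neg_one_pow_le (k : ℕ) : |(-1 : ℝ) ^ k| ≤ 1 := by simp

theorem pow_mul_expSeries (ε c : ℕ → ℝ) (p : ℕ) (s : ℝ) :
    s ^ p * expSeries ε c p s = ∑' k, ε k * ((c k * s) ^ p * Real.exp (-(c k * s))) := by
  rw [expSeries, ← tsum_mul_left]
  congr 1; funext k; rw [mul_pow]; ring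

theorem summable_mul_pow_mul_exp_neg_mul {ε c : ℕ → ℝ} (hε : ∀ k, |ε k| ≤ 1)
    (hc : ∀ k : ℕ, (k : ℝ) ≤ c k) (p : ℕ) {s : ℝ} (hs : 0 < s) :
    Summable fun k => ε k * ((c k * s) ^ p * Real.exp (-(c k * s))) := by
  refine ((summable_mul_pow_mul_exp_neg hε hc p hs).mul_left (s ^ p)).congr fun k => ?_
  rw [mul_pow]; ring

/-- Since `(k + 3/2)² - 1/4 = (k+1)(k+2)`, removing the leading exponential leaves a series of the
form `1 + small`, and the logarithm of the removed factor is linear in `s`. -/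
theorem theta2_eq {s : ℝ} (hs : 0 < s) :
    theta2 s = 2 * Real.exp (-(Real.pi / 4 * s)) *
      (1 + 1 * expSeries (fun _ => 1) oblongExponent 0 s) := by
  have h := (summable_mul_pow_mul_exp_neg abs_one_le le_halfSqExponent 0 hs).tsum_eq_zero_add
  have h1 : ∀ k, (1 : ℝ) * (halfSqExponent (k + 1) ^ 0 * Real.exp (-(halfSqExponent (k + 1) * s)))
      = Real.exp (-(Real.pi / 4 * s)) *
        (1 * (oblongExponent k ^ 0 * Real.exp (-(oblongExponent k * s)))) := fun k => by
    simp only [pow_zero, one_mul, ← Real.exp_add, halfSqExponent, oblongExponent]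
    congr 1; push_cast; ring
  have h0 : halfSqExponent 0 * s = Real.pi / 4 * s := by
    rw [halfSqExponent]; push_cast; ring
  rw [theta2, expSeries, h, tsum_congr h1, tsum_mul_left, h0, expSeries]
  ring

/-- This and the two analogous identifications serve to import the functional equations, that is,
Poisson summation. -/
theorem theta3_eq_cosKernel {s : ℝ} (hs : 0 < s) : theta3 s = HurwitzZeta.cosKernel 0 s := by
  have h := (HurwitzZeta.hasSum_nat_cosKernel₀ 0 hs).tsum_eq
  rw [theta3, expSeries, ← tsum_mul_left]
  rw [QuotientAddGroup.mk_zero] at h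
  rw [← add_sub_cancel 1 (HurwitzZeta.cosKernel 0 s), ← h]
  congr 1
  refine tsum_congr fun k => ?_
  simp [sqExponent]

theorem theta4_eq_cosKernel {s : ℝ} (hs : 0 < s) :
    theta4 s = HurwitzZeta.cosKernel ((1 / 2 : ℝ) : UnitAddCircle) s := by
  have h := (HurwitzZeta.hasSum_nat_cosKernel₀ (1 / 2) hs).tsum_eq
  rw [theta4, expSeries, ← tsum_mul_left]
  rw [← add_sub_cancel 1 (HurwitzZeta.cosKernel _ s), ← h]
  congr 1
  refine tsum_congr fun k => ?_
  have hcos : Real.cos (2 * Real.pi * (1 / 2) * ((k : ℝ) + 1)) = -(-1) ^ k := by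
    rw [show 2 * Real.pi * (1 / 2) * ((k : ℝ) + 1) = ((k + 1 : ℕ) : ℝ) * Real.pi by push_cast; ring,
      Real.cos_nat_mul_pi, pow_succ]; ring
  rw [hcos, sqExponent, pow_zero, one_mul, neg_mul, neg_mul, neg_mul]
  ring

theorem hasSum_theta2 {s : ℝ} (hs : 0 < s) :
    HasSum (fun k : ℤ => Real.exp (-Real.pi * (k + 1 / 2) ^ 2 * s)) (theta2 s) := by
  have hs' := summable_mul_pow_mul_exp_neg abs_one_le le_halfSqExponent 0 hs
  have h := HasSum.of_nat_of_neg_add_one (f := fun k : ℤ => Real.exp (-Real.pi * (k + 1 / 2) ^ 2 * s))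
    (m := expSeries (fun _ => 1) halfSqExponent 0 s)
    (m' := expSeries (fun _ => 1) halfSqExponent 0 s) ?_ ?_
  · rw [← two_mul] at h
    exact h
  · convert! hs'.hasSum using 2 with k
    simp [halfSqExponent]
  · convert! hs'.hasSum using 2 with k
    rw [pow_zero, one_mul, one_mul, halfSqExponent]
    congr 1; push_cast; ring

theorem theta2_eq_evenKernel {s : ℝ} (hs : 0 < s) :
    theta2 s = HurwitzZeta.evenKernel ((1 / 2 : ℝ) : UnitAddCircle) s :=
  (hasSum_theta2 hs).unique (HurwitzZeta.hasSum_int_evenKernel (1 / 2) hs)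

theorem expSeries_one_pos {c : ℕ → ℝ} (hc : ∀ k : ℕ, (k : ℝ) ≤ c k) {s : ℝ} (hs : 0 < s) :
    0 < expSeries (fun _ => 1) c 0 s := by
  refine (summable_mul_pow_mul_exp_neg abs_one_le hc 0 hs).tsum_pos (fun k => ?_) 0 ?_
  · simp only [pow_zero, one_mul]; positivity
  · simp only [pow_zero, one_mul]; positivity

theorem theta2_pos {s : ℝ} (hs : 0 < s) : 0 < theta2 s :=
  mul_pos two_pos (expSeries_one_pos le_halfSqExponent hs)

theorem theta3_pos {s : ℝ} (hs : 0 < s) : 0 < theta3 s := by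
  have := expSeries_one_pos le_sqExponent hs
  unfold theta3; linarith

theorem theta3_functional_equation {s : ℝ} (hs : 0 < s) :
    theta3 s = 1 / s ^ (1 / 2 : ℝ) * theta3 (1 / s) := by
  rw [theta3_eq_cosKernel hs, theta3_eq_cosKernel (one_div_pos.2 hs),
    ← HurwitzZeta.evenKernel_functional_equation, HurwitzZeta.evenKernel_eq_cosKernel_of_zero]

theorem theta2_functional_equation {s : ℝ} (hs : 0 < s) :
    theta2 s = 1 / s ^ (1 / 2 : ℝ) * theta4 (1 / s) := by
  rw [theta2_eq_evenKernel hs, theta4_eq_cosKernel (one_div_pos.2 hs),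
    ← HurwitzZeta.evenKernel_functional_equation]

/-- Positivity is not visible from the alternating series for small `s`; it is inherited from `θ₂`
by the functional equation. -/
theorem theta4_pos {s : ℝ} (hs : 0 < s) : 0 < theta4 s := by
  have h := theta2_functional_equation (one_div_pos.2 hs)
  have h2 := theta2_pos (one_div_pos.2 hs)
  rw [one_div_one_div] at h
  rw [h] at h2
  exact pos_of_mul_pos_right h2 (by positivity)

/-! ### Second-derivative estimates for `s ≥ 1` -/

theorem three_le_sqExponent_mul (k : ℕ) {s : ℝ} (hs : 1 ≤ s) :
    3 * ((k : ℝ) + 1) ^ 2 ≤ sqExponent k * s := by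
  have hp := Real.pi_gt_three
  have h1 : 3 ≤ Real.pi * s := by nlinarith
  unfold sqExponent
  nlinarith [sq_nonneg ((k : ℝ) + 1)]

theorem exp_neg_three_lt : Real.exp (-3) < 0.05 := by
  rw [Real.exp_neg, inv_lt_comm₀ (Real.exp_pos _) (by norm_num)]
  have h := Real.exp_one_gt_d9
  have h3 : Real.exp 3 = Real.exp 1 ^ 3 := by rw [← Real.exp_nat_mul]; norm_num
  rw [h3]
  calc (0.05 : ℝ)⁻¹ < 2.7182818283 ^ 3 := by norm_num
    _ < Real.exp 1 ^ 3 := by gcongr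

theorem expSeries_sqExponent_le {s : ℝ} (hs : 1 ≤ s) :
    expSeries (fun _ => 1) sqExponent 0 s ≤ 0.1 := by
  have h := exp_neg_three_lt
  refine (tsum_le_of_le_geometric (A := Real.exp (-3)) (ρ := Real.exp (-3))
    (fun k => by simp only [pow_zero, one_mul]; positivity) (Real.exp_pos _).le (by linarith)
    fun k => ?_).trans ?_
  · rw [pow_zero, one_mul, one_mul, ← Real.exp_nat_mul, ← Real.exp_add, Real.exp_le_exp]
    have := three_le_sqExponent_mul k hs
    have hk : (0 : ℝ) ≤ k := Nat.cast_nonneg k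
    nlinarith
  · rw [div_le_iff₀ (by linarith)]; linarith

/-- With the moments `mₚ = ∑ xᵖe^{-x}` over `x = π(k+1)²s`, Cauchy–Schwarz gives `m₁² ≤ m₀m₂`, while
`m₁ ≤ m₂/3` and `m₀ ≤ 1/10`. So `2(m₂ - m₁) ≥ (4/3)m₂` already exceeds `4m₀m₂ ≥ 4m₁²`. -/
theorem theta3_log_convex_aux {s : ℝ} (hs : 1 ≤ s) :
    0 ≤ 2 * (s ^ 2 * expSeries (fun _ => 1) sqExponent 2 s
        - s * expSeries (fun _ => 1) sqExponent 1 s) * theta3 s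
      - (2 * (s * expSeries (fun _ => 1) sqExponent 1 s)) ^ 2 := by
  have hs0 : 0 < s := by linarith
  have hsum := fun p => summable_mul_pow_mul_exp_neg_mul abs_one_le le_sqExponent p hs0
  simp only [one_mul] at hsum
  have e0 := pow_mul_expSeries (fun _ => 1) sqExponent 0 s
  have e1 := pow_mul_expSeries (fun _ => 1) sqExponent 1 s
  have e2 := pow_mul_expSeries (fun _ => 1) sqExponent 2 s
  simp only [one_mul, pow_one, pow_zero] at e0 e1 e2
  have hm0 := expSeries_sqExponent_le hs
  have hm0' := expSeries_one_pos le_sqExponent hs0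
  have hs1 := hsum 1
  have hs00 := hsum 0
  simp only [pow_one, pow_zero, one_mul] at hs1 hs00
  have hcs := sq_tsum_mul_le (w := fun k => Real.exp (-(sqExponent k * s)))
    (x := fun k => sqExponent k * s) (fun k => (Real.exp_pos _).le) hs00 hs1 (hsum 2)
  have hx : ∀ k, 3 ≤ sqExponent k * s := fun k => by
    have := three_le_sqExponent_mul k hs
    have hk : (0 : ℝ) ≤ k := Nat.cast_nonneg k
    nlinarith
  have h12 : 3 * ∑' k, sqExponent k * s * Real.exp (-(sqExponent k * s))
      ≤ ∑' k, (sqExponent k * s) ^ 2 * Real.exp (-(sqExponent k * s)) := by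
    rw [← tsum_mul_left]
    refine (hs1.mul_left 3).tsum_le_tsum (fun k => ?_) (hsum 2)
    have := hx k
    have := Real.exp_pos (-(sqExponent k * s))
    rw [← mul_assoc]
    gcongr
    nlinarith
  have hm1 : 0 ≤ ∑' k, sqExponent k * s * Real.exp (-(sqExponent k * s)) :=
    tsum_nonneg fun k => mul_nonneg (by linarith [hx k]) (Real.exp_pos _).le
  rw [← e0, ← e1, ← e2] at hcs
  rw [← e1, ← e2] at h12
  rw [← e1] at hm1
  rw [theta3]
  set m0 := expSeries (fun _ => 1) sqExponent 0 s
  set m1 := s * expSeries (fun _ => 1) sqExponent 1 s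
  set m2 := s ^ 2 * expSeries (fun _ => 1) sqExponent 2 s
  nlinarith [mul_nonneg (show 0 ≤ m2 - m1 by linarith) hm0'.le, mul_le_mul_of_nonneg_right hm0
    (show 0 ≤ m2 by linarith)]

/-- The quantity is the alternating series with terms `(x² - x)e^{-x}`, which decrease because `x ≥
3`. -/
theorem theta4_second_bounds {s : ℝ} (hs : 1 ≤ s) :
    ((sqExponent 0 * s) ^ 2 - sqExponent 0 * s) * Real.exp (-(sqExponent 0 * s))
        - ((sqExponent 1 * s) ^ 2 - sqExponent 1 * s) * Real.exp (-(sqExponent 1 * s))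
      ≤ s ^ 2 * expSeries (fun k => (-1) ^ k) sqExponent 2 s
        - s * expSeries (fun k => (-1) ^ k) sqExponent 1 s ∧
    0 ≤ s ^ 2 * expSeries (fun k => (-1) ^ k) sqExponent 2 s
        - s * expSeries (fun k => (-1) ^ k) sqExponent 1 s := by
  have hs0 : 0 < s := by linarith
  have hsum := fun p => summable_mul_pow_mul_exp_neg_mul abs_neg_one_pow_le le_sqExponent p hs0
  have hsum1 := fun p => summable_mul_pow_mul_exp_neg_mul abs_one_le le_sqExponent p hs0
  simp only [one_mul] at hsum1
  have e1 := pow_mul_expSeries (fun k => (-1) ^ k) sqExponent 1 s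
  have e2 := pow_mul_expSeries (fun k => (-1) ^ k) sqExponent 2 s
  simp only [pow_one] at e1
  have hs1 := hsum 1
  have hs11 := hsum1 1
  simp only [pow_one] at hs1 hs11
  have hx : ∀ k, 3 ≤ sqExponent k * s := fun k => by
    have := three_le_sqExponent_mul k hs
    have hk : (0 : ℝ) ≤ k := Nat.cast_nonneg k
    nlinarith
  have hanti : Antitone fun k => ((sqExponent k * s) ^ 2 - sqExponent k * s)
      * Real.exp (-(sqExponent k * s)) := by
    intro j k hjk
    refine antitoneOn_sq_sub_mul_exp_neg (hx j) (hx k) ?_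
    have : (j : ℝ) ≤ k := by exact_mod_cast hjk
    have := Real.pi_pos
    unfold sqExponent
    gcongr
  have hsm : Summable fun k => ((sqExponent k * s) ^ 2 - sqExponent k * s)
      * Real.exp (-(sqExponent k * s)) :=
    ((hsum1 2).sub hs11).congr fun k => by ring
  have hb := (alternating_tsum_bounds hanti hsm).1
  rw [e1, e2, ← (hsum 2).tsum_sub hs1]
  have hcongr : ∀ k, (-1) ^ k * ((sqExponent k * s) ^ 2 * Real.exp (-(sqExponent k * s)))
      - (-1) ^ k * (sqExponent k * s * Real.exp (-(sqExponent k * s)))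
      = (-1) ^ k * (((sqExponent k * s) ^ 2 - sqExponent k * s)
      * Real.exp (-(sqExponent k * s))) := fun k => by ring
  rw [tsum_congr hcongr]
  have := hanti (Nat.zero_le 1)
  exact ⟨hb, by simp only at this hb; linarith⟩

theorem mul_exp_neg_le {y : ℝ} (hy : 6 ≤ y) : y * Real.exp (-y) ≤ 1 / 9 := by
  have h := Real.pow_div_factorial_le_exp y (by linarith) 4
  rw [Real.exp_neg, ← div_eq_mul_inv, div_le_iff₀ (Real.exp_pos _)]
  have h3 : (216 : ℝ) ≤ y ^ 3 := by nlinarith [pow_le_pow_left₀ (by norm_num) hy 3]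
  have h4 : y ^ 4 = y * y ^ 3 := by ring
  norm_num [Nat.factorial] at h
  nlinarith

/-- With `y = 2πs` the exponents are `y` times triangular numbers `Δₖ`, where `Δₖ² ≤ 9ᵏ` and `Δₖ ≥ 1
+ 2k`. The series is thus geometric with ratio `9e^{-2y}` and first term `y²e^{-y} ≤ y/9`, leaving
room below `y/8 = πs/4`. -/
theorem oblong_second_le {s : ℝ} (hs : 1 ≤ s) :
    s ^ 2 * expSeries (fun _ => 1) oblongExponent 2 s ≤ Real.pi / 4 * s := by
  have hp := Real.pi_gt_three
  have e2 := pow_mul_expSeries (fun _ => 1) oblongExponent 2 s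
  simp only [one_mul] at e2
  set y := 2 * Real.pi * s with hy
  have hy6 : 6 ≤ y := by nlinarith
  have h3 := exp_neg_three_lt
  have hexp : Real.exp (-(2 * y)) ≤ 0.05 ^ 2 := by
    calc Real.exp (-(2 * y)) ≤ Real.exp (2 * (-3)) := by
          apply Real.exp_le_exp.2; linarith
      _ = Real.exp (-3) ^ 2 := by rw [← Real.exp_nat_mul]; norm_num
      _ ≤ 0.05 ^ 2 := by gcongr
  have hb : ∑' k, (oblongExponent k * s) ^ 2 * Real.exp (-(oblongExponent k * s))
      ≤ (y ^ 2 * Real.exp (-y)) / (1 - 9 * Real.exp (-(2 * y))) := by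
    refine tsum_le_of_le_geometric (fun k => by positivity) (by positivity)
      (by norm_num at hexp ⊢; linarith) fun k => ?_
    have hk : (0 : ℝ) ≤ k := Nat.cast_nonneg k
    have hx : oblongExponent k * s = y * (((k : ℝ) + 1) * (k + 2) / 2) := by
      rw [hy, oblongExponent]; ring
    have h9 : (((k : ℝ) + 1) * (k + 2) / 2) ^ 2 ≤ 9 ^ k := by
      induction k with
      | zero => norm_num
      | succ k ih =>
        have hk' : (0 : ℝ) ≤ k := Nat.cast_nonneg k
        have ih := ih hk' (by rw [hy, oblongExponent]; ring)
        push_cast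
        have : ((k : ℝ) + 1 + 1) * (k + 1 + 2) / 2 ≤ 3 * (((k : ℝ) + 1) * (k + 2) / 2) := by
          nlinarith
        calc (((k : ℝ) + 1 + 1) * (k + 1 + 2) / 2) ^ 2
            ≤ (3 * (((k : ℝ) + 1) * (k + 2) / 2)) ^ 2 := by gcongr
          _ = 9 * (((k : ℝ) + 1) * (k + 2) / 2) ^ 2 := by ring
          _ ≤ 9 * 9 ^ k := by gcongr
          _ = 9 ^ (k + 1) := by ring
    have hquad : 1 + 2 * (k : ℝ) ≤ ((k : ℝ) + 1) * (k + 2) / 2 := by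
      rcases Nat.eq_zero_or_pos k with rfl | h
      · norm_num
      · have : (1 : ℝ) ≤ k := by exact_mod_cast h
        nlinarith
    rw [hx, mul_pow y, mul_pow (9 : ℝ), ← Real.exp_nat_mul]
    calc y ^ 2 * (((k : ℝ) + 1) * (k + 2) / 2) ^ 2 * Real.exp (-(y * (((k : ℝ) + 1) * (k + 2) / 2)))
        ≤ y ^ 2 * 9 ^ k * Real.exp (-y + k * -(2 * y)) := by
          gcongr
          nlinarith
      _ = _ := by rw [Real.exp_add]; ring
  rw [e2]
  refine hb.trans ?_
  have hye := mul_exp_neg_le hy6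
  rw [div_le_iff₀ (by norm_num at hexp ⊢; linarith)]
  have hye' : y ^ 2 * Real.exp (-y) ≤ y * (1 / 9) := by
    rw [sq, mul_assoc]; gcongr
  have hs4 : Real.pi / 4 * s = y / 8 := by rw [hy]; ring
  rw [hs4]
  norm_num at hexp
  nlinarith

/-! ### Logarithmic convexity and the product inequalities -/

theorem one_le_exp_of_nonneg {u : ℝ} (hu : 0 ≤ u) : 1 ≤ Real.exp u := by
  simpa using Real.exp_le_exp.2 hu

theorem exp_neg_rpow_half (u : ℝ) : Real.exp (-u) ^ (1 / 2 : ℝ) = Real.exp (-(u / 2)) := by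
  rw [← Real.exp_mul]; congr 1; ring

/-- The term `u/4` makes the function even under `u ↦ -u`, by the functional equation, so only `s =
eᵘ ≥ 1` has to be examined. -/
theorem convexOn_log_theta3 :
    ConvexOn ℝ Set.univ fun u => Real.log (theta3 (Real.exp u)) + 1 / 4 * u := by
  have hpos : ∀ s, 0 < s → 0 < 1 + 2 * expSeries (fun _ => 1) sqExponent 0 s :=
    fun s hs => theta3_pos hs
  have h1 := hasDerivAt_log_expSeries_exp (l := 0) (m := 1 / 4) abs_one_le le_sqExponent hpos
  have h2 := hasDerivAt_logDeriv_expSeries_exp (l := 0) (m := 1 / 4) abs_one_le le_sqExponent hpos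
  have hsec : ∀ u : ℝ, 0 ≤ u →
      0 ≤ (2 * (Real.exp u ^ 2 * expSeries (fun _ => 1) sqExponent 2 (Real.exp u)
            - Real.exp u * expSeries (fun _ => 1) sqExponent 1 (Real.exp u))
          * (1 + 2 * expSeries (fun _ => 1) sqExponent 0 (Real.exp u))
          - (2 * (Real.exp u * expSeries (fun _ => 1) sqExponent 1 (Real.exp u))) ^ 2)
        / (1 + 2 * expSeries (fun _ => 1) sqExponent 0 (Real.exp u)) ^ 2 + 0 * Real.exp u := by
    intro u hu
    rw [zero_mul, add_zero]
    exact div_nonneg (theta3_log_convex_aux (one_le_exp_of_nonneg hu)) (sq_nonneg _)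
  have hrefl : ∀ u : ℝ, Real.log (1 + 2 * expSeries (fun _ => 1) sqExponent 0 (Real.exp u))
      + 0 * Real.exp u + 1 / 4 * u
      = Real.log (1 + 2 * expSeries (fun _ => 1) sqExponent 0 (Real.exp (-u)))
      + 0 * Real.exp (-u) + 1 / 4 * (-u) := by
    intro u
    have hf := theta3_functional_equation (Real.exp_pos (-u))
    rw [one_div (Real.exp (-u)), ← Real.exp_neg, neg_neg, exp_neg_rpow_half, one_div,
      ← Real.exp_neg, neg_neg] at hf
    change Real.log (theta3 (Real.exp u)) + _ + _ = Real.log (theta3 (Real.exp (-u))) + _ + _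
    rw [hf, Real.log_mul (Real.exp_pos _).ne' (theta3_pos (Real.exp_pos _)).ne', Real.log_exp]
    ring
  have := convexOn_univ_of_reflection h1 h2 h1 h2 hrefl hsec hsec
  simpa only [theta3, zero_mul, add_zero] using this

/-- Here the reflection `u ↦ -u` exchanges `θ₄` and `θ₂`: the half-line `u ≥ 0` is treated with the
series of `θ₄`, the other one with that of `θ₂`. -/
theorem concaveOn_log_theta4 :
    ConcaveOn ℝ Set.univ fun u => Real.log (theta4 (Real.exp u)) + 1 / 4 * u := by
  have hpos4 : ∀ s, 0 < s → 0 < 1 + -2 * expSeries (fun k => (-1) ^ k) sqExponent 0 s :=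
    fun s hs => theta4_pos hs
  have hpos2 : ∀ s, 0 < s → 0 < 1 + 1 * expSeries (fun _ => 1) oblongExponent 0 s :=
    fun s hs => by have := expSeries_one_pos le_oblongExponent hs; linarith
  have h1 := hasDerivAt_log_expSeries_exp (l := 0) (m := 1 / 4) abs_neg_one_pow_le le_sqExponent
    hpos4
  have h2 := hasDerivAt_logDeriv_expSeries_exp (l := 0) (m := 1 / 4) abs_neg_one_pow_le
    le_sqExponent hpos4
  have k1 := hasDerivAt_log_expSeries_exp (l := -(Real.pi / 4)) (m := 1 / 4) abs_one_le
    le_oblongExponent hpos2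
  have k2 := hasDerivAt_logDeriv_expSeries_exp (l := -(Real.pi / 4)) (m := 1 / 4) abs_one_le
    le_oblongExponent hpos2
  rw [← neg_convexOn_iff]
  -- The constant `log 2` and the slope `-π/4` come from the prefactor `2e^{-πs/4}` of `θ₂`.
  have := convexOn_univ_of_reflection (fun u => (h1 u).neg) (fun u => (h2 u).neg)
    (fun u => ((k1 u).add_const (Real.log 2)).neg) (fun u => (k2 u).neg) ?_ ?_ ?_
  · convert! this using 1
    funext u
    simp [theta4]
  · intro u
    have hf := theta2_functional_equation (Real.exp_pos (-u))
    rw [one_div (Real.exp (-u)), ← Real.exp_neg, neg_neg, exp_neg_rpow_half, one_div,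
      ← Real.exp_neg, neg_neg, theta2_eq (Real.exp_pos _)] at hf
    have hl := congrArg Real.log hf
    rw [Real.log_mul (by positivity) (hpos2 _ (Real.exp_pos _)).ne',
      Real.log_mul (by positivity) (by positivity), Real.log_exp,
      Real.log_mul (Real.exp_pos _).ne' (theta4_pos (Real.exp_pos _)).ne', Real.log_exp,
      theta4] at hl
    simp only [Pi.neg_apply]
    linarith
  · intro u hu
    have hb := (theta4_second_bounds (one_le_exp_of_nonneg hu)).2
    have hp := hpos4 _ (Real.exp_pos u)
    rw [zero_mul, add_zero, neg_nonneg]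
    refine div_nonpos_of_nonpos_of_nonneg ?_ (sq_nonneg _)
    nlinarith [sq_nonneg (-2 * (Real.exp u * expSeries (fun k => (-1) ^ k) sqExponent 1
      (Real.exp u))), mul_nonneg hb hp.le]
  · intro u hu
    have hb := oblong_second_le (one_le_exp_of_nonneg hu)
    have hv := expSeries_one_pos le_oblongExponent (Real.exp_pos u)
    have hm1 : 0 ≤ Real.exp u * expSeries (fun _ => 1) oblongExponent 1 (Real.exp u) := by
      refine mul_nonneg (Real.exp_pos u).le (tsum_nonneg fun k => ?_)
      have : 0 ≤ oblongExponent k := (Nat.cast_nonneg k).trans (le_oblongExponent k)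
      positivity
    set v := expSeries (fun _ => 1) oblongExponent 0 (Real.exp u)
    set m1 := Real.exp u * expSeries (fun _ => 1) oblongExponent 1 (Real.exp u)
    set m2 := Real.exp u ^ 2 * expSeries (fun _ => 1) oblongExponent 2 (Real.exp u)
    have hx : 0 ≤ Real.pi / 4 * Real.exp u := by positivity
    -- The convexity contributed by the series `1 + v` must not exceed the concavity of the linear
    -- term `-(π/4)eᵘ`; it is bounded by `m₂` alone.
    have : (1 * (m2 - m1) * (1 + 1 * v) - (1 * m1) ^ 2) / (1 + 1 * v) ^ 2
        ≤ Real.pi / 4 * Real.exp u := by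
      rw [div_le_iff₀ (by positivity)]
      nlinarith [mul_nonneg hm1 hv.le, mul_nonneg hx hv.le, mul_nonneg (mul_nonneg hx hv.le) hv.le,
        mul_le_mul_of_nonneg_right hb hv.le]
    linarith

/-- Midpoint convexity in the logarithmic scale. -/
theorem theta3_sq_le {r s t : ℝ} (hr : 0 < r) (hs : 0 < s) (ht : 0 < t) (h : s * t = r ^ 2) :
    theta3 r ^ 2 ≤ theta3 s * theta3 t := by
  have hc := convexOn_log_theta3.2 (Set.mem_univ (Real.log s)) (Set.mem_univ (Real.log t))
    (by norm_num : (0 : ℝ) ≤ 1 / 2) (by norm_num : (0 : ℝ) ≤ 1 / 2) (by norm_num)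
  have hl : Real.log s + Real.log t = 2 * Real.log r := by
    rw [← Real.log_mul hs.ne' ht.ne', h, Real.log_pow]; norm_num
  have hm : 1 / 2 * Real.log s + 1 / 2 * Real.log t = Real.log r := by linarith
  simp only [smul_eq_mul, hm, Real.exp_log hr, Real.exp_log hs, Real.exp_log ht] at hc
  rw [← Real.log_le_log_iff (pow_pos (theta3_pos hr) 2) (mul_pos (theta3_pos hs) (theta3_pos ht)),
    Real.log_pow, Real.log_mul (theta3_pos hs).ne' (theta3_pos ht).ne']
  push_cast
  linarith

/-- Along `s t = const`, the product `θ₄(s) θ₄(t)` decreases as `s` and `t` spread out. -/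
theorem theta4_mul_le {s t s' t' : ℝ} (ht : 0 < t) (htt : t ≤ t') (hts : t' ≤ s')
    (h : s * t = s' * t') : theta4 s * theta4 t ≤ theta4 s' * theta4 t' := by
  have ht' : 0 < t' := by linarith
  have hs' : 0 < s' := by linarith
  have hs : 0 < s := pos_of_mul_pos_left (h ▸ mul_pos hs' ht') ht.le
  have hl : Real.log s + Real.log t = Real.log s' + Real.log t' := by
    rw [← Real.log_mul hs.ne' ht.ne', h, Real.log_mul hs'.ne' ht'.ne']
  have l1 := Real.log_le_log ht htt
  have l2 := Real.log_le_log ht' hts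
  rw [← Real.log_le_log_iff (mul_pos (theta4_pos hs) (theta4_pos ht))
    (mul_pos (theta4_pos hs') (theta4_pos ht')),
    Real.log_mul (theta4_pos hs).ne' (theta4_pos ht).ne',
    Real.log_mul (theta4_pos hs').ne' (theta4_pos ht').ne']
  rcases l1.eq_or_lt with he | hlt
  · have h1 := Real.log_injOn_pos ht ht' he
    have h2 : s = s' := by
      subst h1; exact mul_right_cancel₀ ht.ne' h
    rw [h1, h2]
  · have hd : 0 < Real.log s - Real.log t := by linarith
    -- `a` is the barycentric weight of `log s'` between `log t` and `log s`. The constraint gives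
    -- `log t'` the complementary weight, so adding the two concavity inequalities yields the claim.
    set a := (Real.log s' - Real.log t) / (Real.log s - Real.log t) with ha
    have ha0 : 0 ≤ a := div_nonneg (by linarith) hd.le
    have ha1 : 0 ≤ 1 - a := by
      rw [sub_nonneg, div_le_one hd]; linarith
    have had : a * (Real.log s - Real.log t) = Real.log s' - Real.log t :=
      div_mul_cancel₀ _ hd.ne'
    have c1 := concaveOn_log_theta4.2 (Set.mem_univ (Real.log s)) (Set.mem_univ (Real.log t))
      ha0 ha1 (by ring)
    have c2 := concaveOn_log_theta4.2 (Set.mem_univ (Real.log s)) (Set.mem_univ (Real.log t))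
      ha1 ha0 (by ring)
    have m1 : a * Real.log s + (1 - a) * Real.log t = Real.log s' := by linarith
    have m2 : (1 - a) * Real.log s + a * Real.log t = Real.log t' := by linarith
    simp only [smul_eq_mul, m1, m2, Real.exp_log hs', Real.exp_log hs, Real.exp_log ht,
      Real.exp_log ht'] at c1 c2
    linarith

theorem theta4_mul_le_sq {r s t : ℝ} (hr : 0 < r) (hs : 0 < s) (ht : 0 < t) (h : s * t = r ^ 2) :
    theta4 s * theta4 t ≤ theta4 r ^ 2 := by
  rw [sq]
  rcases le_total t r with htr | htr
  · exact theta4_mul_le ht htr le_rfl (by rw [h, sq])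
  · have hsr : s ≤ r := by
      by_contra hcon
      push Not at hcon
      nlinarith
    rw [mul_comm]
    exact theta4_mul_le hs hsr le_rfl (by rw [mul_comm, h, sq])

/-- Inversion `s ↦ 1/s` preserves the shape of the constraint, and the factors `s^{-1/2}` multiply
to a constant along it. -/
theorem theta2_mul_le_sq {r s t : ℝ} (hr : 0 < r) (hs : 0 < s) (ht : 0 < t) (h : s * t = r ^ 2) :
    theta2 s * theta2 t ≤ theta2 r ^ 2 := by
  have h4 := theta4_mul_le_sq (one_div_pos.2 hr) (one_div_pos.2 hs) (one_div_pos.2 ht)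
    (by rw [div_mul_div_comm, h, one_div_pow, one_mul])
  rw [theta2_functional_equation hs, theta2_functional_equation ht, theta2_functional_equation hr]
  have e : 1 / s ^ (1 / 2 : ℝ) * (1 / t ^ (1 / 2 : ℝ)) = (1 / r ^ (1 / 2 : ℝ)) ^ 2 := by
    rw [div_mul_div_comm, one_mul, ← Real.mul_rpow hs.le ht.le, h, one_div_pow, sq, sq,
      Real.mul_rpow hr.le hr.le]
  calc _ = (1 / s ^ (1 / 2 : ℝ) * (1 / t ^ (1 / 2 : ℝ))) * (theta4 (1 / s) * theta4 (1 / t)) := by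
        ring
    _ ≤ (1 / s ^ (1 / 2 : ℝ) * (1 / t ^ (1 / 2 : ℝ))) * theta4 (1 / r) ^ 2 := by gcongr
    _ = _ := by rw [e]; ring

/-! ### Odd redundancy: the symbol at the character `-1` -/

theorem hasDerivAt_expSeries_mul_exp {ε c : ℕ → ℝ} (hε : ∀ k, |ε k| ≤ 1)
    (hc : ∀ k : ℕ, (k : ℝ) ≤ c k) (a b : ℝ) {r : ℝ} (hr : 0 < r) (u : ℝ) :
    HasDerivAt (fun u => a + b * expSeries ε c 0 (r * Real.exp u))
      (-(b * (r * Real.exp u * expSeries ε c 1 (r * Real.exp u)))) u := by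
  have h1 := (Real.hasDerivAt_exp u).const_mul r
  have h2 := (hasDerivAt_expSeries hε hc 0 (mul_pos hr (Real.exp_pos u))).comp u h1
  refine HasDerivAt.congr_deriv ((h2.const_mul b).const_add a) ?_
  rw [zero_add]; ring

theorem hasDerivAt_mul_expSeries_mul_exp {ε c : ℕ → ℝ} (hε : ∀ k, |ε k| ≤ 1)
    (hc : ∀ k : ℕ, (k : ℝ) ≤ c k) (b : ℝ) {r : ℝ} (hr : 0 < r) (u : ℝ) :
    HasDerivAt (fun u => -(b * (r * Real.exp u * expSeries ε c 1 (r * Real.exp u))))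
      (b * ((r * Real.exp u) ^ 2 * expSeries ε c 2 (r * Real.exp u)
        - r * Real.exp u * expSeries ε c 1 (r * Real.exp u))) u := by
  have h1 := (Real.hasDerivAt_exp u).const_mul r
  have h2 := (hasDerivAt_expSeries hε hc 1 (mul_pos hr (Real.exp_pos u))).comp u h1
  refine HasDerivAt.congr_deriv (((h1.mul h2).const_mul b).neg) ?_
  simp only [Function.comp, Nat.reduceAdd]
  ring

theorem mul_exp_neg_le_of_three_le {y : ℝ} (hy : 3 ≤ y) : y * Real.exp (-y) ≤ 0.15 := by
  have h := Real.add_one_le_exp (y - 3)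
  have h3 := exp_neg_three_lt
  calc y * Real.exp (-y) ≤ (3 * Real.exp (y - 3)) * Real.exp (-y) := by gcongr; linarith
    _ = 3 * Real.exp (-3) := by rw [mul_assoc, ← Real.exp_add]; congr 2; ring
    _ ≤ 0.15 := by linarith

theorem antitoneOn_mul_exp_neg : AntitoneOn (fun x : ℝ => x * Real.exp (-x)) (Set.Ici 1) := by
  intro x hx y hy hxy
  have hx' : (1 : ℝ) ≤ x := hx
  have h := Real.add_one_le_exp (y - x)
  have h2 : y ≤ x * Real.exp (y - x) := by nlinarith
  calc y * Real.exp (-y) ≤ (x * Real.exp (y - x)) * Real.exp (-y) := by gcongr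
    _ = x * Real.exp (-x) := by rw [mul_assoc, ← Real.exp_add]; congr 2; ring

theorem sqExponent_mul_mono {s : ℝ} (hs : 0 < s) : Monotone fun k => sqExponent k * s := by
  intro j k hjk
  have : (j : ℝ) ≤ k := by exact_mod_cast hjk
  have := Real.pi_pos
  simp only [sqExponent]
  gcongr

theorem three_le_sqExponent_mul' (k : ℕ) {s : ℝ} (hs : 1 ≤ s) : 3 ≤ sqExponent k * s := by
  have := three_le_sqExponent_mul k hs
  have hk : (0 : ℝ) ≤ k := Nat.cast_nonneg k
  nlinarith

theorem theta4_bounds {s : ℝ} (hs : 1 ≤ s) :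
    1 - 2 * Real.exp (-(Real.pi * s)) ≤ theta4 s ∧
    theta4 s ≤ 1 - 2 * Real.exp (-(Real.pi * s)) + 2 * Real.exp (-(4 * (Real.pi * s))) := by
  have hs0 : 0 < s := by linarith
  have hsum := summable_mul_pow_mul_exp_neg_mul abs_one_le le_sqExponent 0 hs0
  have hanti : Antitone fun k => Real.exp (-(sqExponent k * s)) := fun j k hjk =>
    Real.exp_le_exp.2 (neg_le_neg (sqExponent_mul_mono hs0 hjk))
  have hb := alternating_tsum_bounds hanti (by simpa using hsum)
  have e0 : sqExponent 0 * s = Real.pi * s := by simp [sqExponent]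
  have e1 : sqExponent 1 * s = 4 * (Real.pi * s) := by rw [sqExponent]; push_cast; ring
  rw [e0, e1] at hb
  simp only [theta4, expSeries, pow_zero, one_mul]
  constructor <;> linarith [hb.1, hb.2]

theorem theta4_le_one {s : ℝ} (hs : 1 ≤ s) : theta4 s ≤ 1 := by
  have h := (theta4_bounds hs).2
  have : Real.exp (-(4 * (Real.pi * s))) ≤ Real.exp (-(Real.pi * s)) := by
    apply Real.exp_le_exp.2
    nlinarith [Real.pi_pos]
  linarith

theorem theta4_first_nonneg {s : ℝ} (hs : 1 ≤ s) :
    0 ≤ s * expSeries (fun k => (-1) ^ k) sqExponent 1 s := by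
  have hs0 : 0 < s := by linarith
  have hsum := summable_mul_pow_mul_exp_neg_mul abs_one_le le_sqExponent 1 hs0
  have e1 := pow_mul_expSeries (fun k => (-1) ^ k) sqExponent 1 s
  simp only [pow_one, one_mul] at e1 hsum
  have hanti : Antitone fun k => sqExponent k * s * Real.exp (-(sqExponent k * s)) :=
    fun j k hjk => antitoneOn_mul_exp_neg
      (show (1 : ℝ) ≤ _ by linarith [three_le_sqExponent_mul' j hs])
      (show (1 : ℝ) ≤ _ by linarith [three_le_sqExponent_mul' k hs]) (sqExponent_mul_mono hs0 hjk)
  have hb := (alternating_tsum_bounds hanti hsum).1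
  have := hanti (Nat.zero_le 1)
  simp only at this
  rw [e1]
  linarith

/-- In the alternating bound the second term has exponent `4x` and is at most `24·0.05³` times the
first. -/
theorem theta4_second_lower {s : ℝ} (hs : 1 ≤ s) :
    0.95 * (((Real.pi * s) ^ 2 - Real.pi * s) * Real.exp (-(Real.pi * s))) ≤
      s ^ 2 * expSeries (fun k => (-1) ^ k) sqExponent 2 s
        - s * expSeries (fun k => (-1) ^ k) sqExponent 1 s := by
  have hb := (theta4_second_bounds hs).1
  have e0 : sqExponent 0 * s = Real.pi * s := by simp [sqExponent]
  have e1 : sqExponent 1 * s = 4 * (Real.pi * s) := by rw [sqExponent]; push_cast; ring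
  have hx : 3 ≤ Real.pi * s := by have := Real.pi_gt_three; nlinarith
  rw [e0, e1] at hb
  refine le_trans ?_ hb
  generalize Real.pi * s = x at *
  have h3 := exp_neg_three_lt
  have h9 : Real.exp (-(4 * x)) ≤ 0.05 ^ 3 * Real.exp (-x) := by
    calc Real.exp (-(4 * x)) ≤ Real.exp (-3) ^ 3 * Real.exp (-x) := by
          rw [← Real.exp_nat_mul, ← Real.exp_add, Real.exp_le_exp]; push_cast; linarith
      _ ≤ _ := by gcongr
  have : ((4 * x) ^ 2 - 4 * x) * Real.exp (-(4 * x))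
      ≤ (24 * (x ^ 2 - x)) * (0.05 ^ 3 * Real.exp (-x)) := by
    gcongr
    · nlinarith
    · nlinarith
  have hpos : 0 ≤ (x ^ 2 - x) * Real.exp (-x) := mul_nonneg (by nlinarith) (Real.exp_pos _).le
  nlinarith

theorem halfSqExponent_four_mul (k : ℕ) (s : ℝ) :
    halfSqExponent k * (4 * s) = Real.pi * s * (2 * k + 1) ^ 2 := by
  rw [halfSqExponent]; ring

/-- Uses `(2k+1)² ≥ 1 + 2k` and `πs ≥ 3`; the ratio `0.0025 = 0.05²` majorizes `e^{-6}`. -/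
theorem exp_halfSqExponent_le (k : ℕ) {s : ℝ} (hs : 1 ≤ s) :
    Real.exp (-(halfSqExponent k * (4 * s))) ≤ Real.exp (-(Real.pi * s)) * 0.0025 ^ k := by
  have hx : 3 ≤ Real.pi * s := by have := Real.pi_gt_three; nlinarith
  have hk : (0 : ℝ) ≤ k := Nat.cast_nonneg k
  have h3 := exp_neg_three_lt
  rw [halfSqExponent_four_mul]
  calc Real.exp (-(Real.pi * s * (2 * k + 1) ^ 2))
      ≤ Real.exp (-(Real.pi * s) + (k * (2 * (-3)))) := by
        apply Real.exp_le_exp.2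
        nlinarith [mul_nonneg hk hk, mul_nonneg hk (sub_nonneg.2 hx),
          mul_nonneg (mul_nonneg hk hk) (sub_nonneg.2 hx)]
    _ = Real.exp (-(Real.pi * s)) * (Real.exp (-3) ^ 2) ^ k := by
        rw [Real.exp_add, Real.exp_nat_mul, ← Real.exp_nat_mul _ 2]; norm_num
    _ ≤ Real.exp (-(Real.pi * s)) * (0.05 ^ 2) ^ k := by gcongr
    _ = _ := by norm_num

theorem theta2_four_mul_le {s : ℝ} (hs : 1 ≤ s) :
    theta2 (4 * s) ≤ 2.1 * Real.exp (-(Real.pi * s)) := by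
  have h := tsum_le_of_le_geometric (f := fun k => Real.exp (-(halfSqExponent k * (4 * s))))
    (fun k => (Real.exp_pos _).le) (by norm_num) (by norm_num)
    (fun k => exp_halfSqExponent_le k hs)
  have hp := Real.exp_pos (-(Real.pi * s))
  rw [le_div_iff₀ (by norm_num)] at h
  simp only [theta2, expSeries, pow_zero, one_mul]
  linarith

theorem theta2_first_le {s : ℝ} (hs : 1 ≤ s) :
    4 * s * expSeries (fun _ => 1) halfSqExponent 1 (4 * s)
      ≤ 1.05 * (Real.pi * s * Real.exp (-(Real.pi * s))) := by
  have e1 := pow_mul_expSeries (fun _ => 1) halfSqExponent 1 (4 * s)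
  simp only [pow_one, one_mul] at e1
  have hx : 3 ≤ Real.pi * s := by have := Real.pi_gt_three; nlinarith
  have hp := Real.exp_pos (-(Real.pi * s))
  have h := tsum_le_of_le_geometric (A := Real.pi * s * Real.exp (-(Real.pi * s))) (ρ := 0.0225)
    (f := fun k => halfSqExponent k * (4 * s) * Real.exp (-(halfSqExponent k * (4 * s))))
    (fun k => by rw [halfSqExponent_four_mul]; positivity) (by norm_num) (by norm_num)
    (fun k => by
      have h9 : (2 * (k : ℝ) + 1) ^ 2 ≤ 9 ^ k := by
        have h3 : (2 * (k : ℝ) + 1) ≤ 3 ^ k := by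
          have := one_add_mul_le_pow (show (-2 : ℝ) ≤ 2 by norm_num) k
          norm_num at this; linarith
        calc (2 * (k : ℝ) + 1) ^ 2 ≤ (3 ^ k) ^ 2 := by gcongr
          _ = 9 ^ k := by rw [← pow_mul, mul_comm k 2, pow_mul]; norm_num
      have := exp_halfSqExponent_le k hs
      calc halfSqExponent k * (4 * s) * Real.exp (-(halfSqExponent k * (4 * s)))
          ≤ (Real.pi * s * 9 ^ k) * (Real.exp (-(Real.pi * s)) * 0.0025 ^ k) := by
            refine mul_le_mul ?_ this (Real.exp_pos _).le (by positivity)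
            rw [halfSqExponent_four_mul]; gcongr
        _ = Real.pi * s * Real.exp (-(Real.pi * s)) * (9 * 0.0025) ^ k := by rw [mul_pow]; ring
        _ = _ := by norm_num)
  have hxe := mul_pos (show 0 < Real.pi * s by linarith) hp
  rw [le_div_iff₀ (by norm_num)] at h
  rw [e1]
  linarith

theorem theta2_second_nonneg {s : ℝ} (hs : 1 ≤ s) :
    0 ≤ (4 * s) ^ 2 * expSeries (fun _ => 1) halfSqExponent 2 (4 * s)
      - 4 * s * expSeries (fun _ => 1) halfSqExponent 1 (4 * s) ∧
    0 ≤ 4 * s * expSeries (fun _ => 1) halfSqExponent 1 (4 * s) := by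
  have hs0 : 0 < 4 * s := by linarith
  have hsum := fun p => summable_mul_pow_mul_exp_neg_mul abs_one_le le_halfSqExponent p hs0
  have e1 := pow_mul_expSeries (fun _ => 1) halfSqExponent 1 (4 * s)
  have e2 := pow_mul_expSeries (fun _ => 1) halfSqExponent 2 (4 * s)
  have hs1 := hsum 1
  simp only [pow_one, one_mul] at e1 e2 hs1 hsum
  have hx : ∀ k, 1 ≤ halfSqExponent k * (4 * s) := fun k => by
    have hx : 3 ≤ Real.pi * s := by have := Real.pi_gt_three; nlinarith
    have hk : (0 : ℝ) ≤ k := Nat.cast_nonneg k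
    rw [halfSqExponent_four_mul]
    nlinarith [mul_nonneg hk hk]
  constructor
  · rw [e1, e2, ← (hsum 2).tsum_sub hs1]
    refine tsum_nonneg fun k => ?_
    rw [← sub_mul]
    exact mul_nonneg (by nlinarith [hx k]) (Real.exp_pos _).le
  · rw [e1]
    exact tsum_nonneg fun k => mul_nonneg (by linarith [hx k]) (Real.exp_pos _).le

/-- The value at `(1/2, 1/2)` of the symbol of the frame operator for odd redundancy, up to a
factor. -/
noncomputable def oddSymbolMin (s t : ℝ) : ℝ :=
  theta4 s * theta4 t - 2 * (theta2 (4 * s) * theta2 (4 * t))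

theorem oddSymbolMin_comm (s t : ℝ) : oddSymbolMin s t = oddSymbolMin t s := by
  unfold oddSymbolMin; ring

/-- The mixed product of first derivatives of `θ₂` is the only term of the wrong sign in the second
derivative. With `x = πs`, `y = πt` it is of size `16·xe^{-x}·ye^{-y}` with `ye^{-y} ≤ 0.15`, and is
absorbed by the term with `θ₄''`, of size `2(x² - x)e^{-x}`. -/
theorem oddSymbolMin_second_nonpos {s t : ℝ} (hs : 1 ≤ s) (ht : 1 ≤ t) :
    -2 * (s ^ 2 * expSeries (fun k => (-1) ^ k) sqExponent 2 s
        - s * expSeries (fun k => (-1) ^ k) sqExponent 1 s) * theta4 t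
      + 4 * (2 * (4 * s * expSeries (fun _ => 1) halfSqExponent 1 (4 * s)) *
        (2 * (4 * t * expSeries (fun _ => 1) halfSqExponent 1 (4 * t)))) ≤ 0 := by
  have h1 := theta4_second_lower hs
  have h2 := theta2_first_le hs
  have h3 := theta2_first_le ht
  have hn1 := (theta2_second_nonneg hs).2
  have hn2 := (theta2_second_nonneg ht).2
  have hx : 3 ≤ Real.pi * s := by have := Real.pi_gt_three; nlinarith
  have hy : 3 ≤ Real.pi * t := by have := Real.pi_gt_three; nlinarith
  have hye := mul_exp_neg_le_of_three_le hy
  have h4 : 0.9 ≤ theta4 t := by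
    have hb := (theta4_bounds ht).1
    have : Real.exp (-(Real.pi * t)) ≤ Real.exp (-3) := Real.exp_le_exp.2 (by linarith)
    linarith [exp_neg_three_lt]
  have hpx := Real.exp_pos (-(Real.pi * s))
  have hxe : 0 < Real.pi * s * Real.exp (-(Real.pi * s)) := mul_pos (by linarith) hpx
  have h5 : 1.9 * (Real.pi * s * Real.exp (-(Real.pi * s)))
      ≤ s ^ 2 * expSeries (fun k => (-1) ^ k) sqExponent 2 s
        - s * expSeries (fun k => (-1) ^ k) sqExponent 1 s := by
    refine le_trans ?_ h1
    have : 2 * (Real.pi * s) ≤ (Real.pi * s) ^ 2 - Real.pi * s := by nlinarith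
    nlinarith [mul_le_mul_of_nonneg_right this hpx.le]
  have h6 : 4 * s * expSeries (fun _ => 1) halfSqExponent 1 (4 * s) *
        (4 * t * expSeries (fun _ => 1) halfSqExponent 1 (4 * t))
      ≤ (1.05 * (Real.pi * s * Real.exp (-(Real.pi * s)))) * (1.05 * 0.15) :=
    mul_le_mul h2 (h3.trans (by gcongr)) hn2 (by linarith)
  have h7 : 1.9 * (Real.pi * s * Real.exp (-(Real.pi * s))) * 0.9
      ≤ (s ^ 2 * expSeries (fun k => (-1) ^ k) sqExponent 2 s
        - s * expSeries (fun k => (-1) ^ k) sqExponent 1 s) * theta4 t :=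
    mul_le_mul h5 h4 (by norm_num) (by linarith)
  linarith

/-- Put `s = re^y`, `t = re^{-y}`. The function `u ↦ oddSymbolMin (re^u) (re^{-u})` is even and
concave on `[-y, y]`, so its value at the midpoint 0 dominates. The hypothesis `1 ≤ t` keeps both
arguments at least 1 on the whole interval. -/
theorem oddSymbolMin_le_of_one_le {r s t : ℝ} (ht : 1 ≤ t) (hts : t ≤ s) (hr : 0 < r)
    (h : s * t = r ^ 2) : oddSymbolMin s t ≤ oddSymbolMin r r := by
  have ht0 : 0 < t := by linarith
  have hs0 : 0 < s := by linarith
  set y := Real.log (s / r) with hy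
  have hey : Real.exp y = s / r := Real.exp_log (by positivity)
  have hey' : Real.exp (-y) = t / r := by
    rw [Real.exp_neg, hey, inv_div, div_eq_div_iff hs0.ne' hr.ne']; linarith
  have hrs : r * Real.exp y = s := by rw [hey]; field_simp
  have hrt : r * Real.exp (-y) = t := by rw [hey']; field_simp
  have hA1 := hasDerivAt_expSeries_mul_exp abs_neg_one_pow_le le_sqExponent 1 (-2) hr
  have hA2 := hasDerivAt_mul_expSeries_mul_exp abs_neg_one_pow_le le_sqExponent (-2) hr
  have h4r : 0 < 4 * r := by linarith
  have hO1 := hasDerivAt_expSeries_mul_exp abs_one_le le_halfSqExponent 0 2 h4r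
  have hO2 := hasDerivAt_mul_expSeries_mul_exp abs_one_le le_halfSqExponent 2 h4r
  have hrefl : ∀ {g : ℝ → ℝ} {g' u : ℝ}, HasDerivAt g g' (-u) →
      HasDerivAt (fun u => g (-u)) (-g') u := fun {g g' u} hg => by
    simpa using! hg.comp u (hasDerivAt_neg u)
  set A : ℝ → ℝ := fun u => 1 + -2 * expSeries (fun k => (-1) ^ k) sqExponent 0 (r * Real.exp u)
  set A₁ : ℝ → ℝ := fun u => -(-2 * (r * Real.exp u *
    expSeries (fun k => (-1) ^ k) sqExponent 1 (r * Real.exp u)))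
  set A₂ : ℝ → ℝ := fun u => -2 * ((r * Real.exp u) ^ 2 *
    expSeries (fun k => (-1) ^ k) sqExponent 2 (r * Real.exp u)
    - r * Real.exp u * expSeries (fun k => (-1) ^ k) sqExponent 1 (r * Real.exp u))
  set O : ℝ → ℝ := fun u => 0 + 2 * expSeries (fun _ => 1) halfSqExponent 0 (4 * r * Real.exp u)
  set O₁ : ℝ → ℝ := fun u => -(2 * (4 * r * Real.exp u *
    expSeries (fun _ => 1) halfSqExponent 1 (4 * r * Real.exp u)))
  set O₂ : ℝ → ℝ := fun u => 2 * ((4 * r * Real.exp u) ^ 2 *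
    expSeries (fun _ => 1) halfSqExponent 2 (4 * r * Real.exp u)
    - 4 * r * Real.exp u * expSeries (fun _ => 1) halfSqExponent 1 (4 * r * Real.exp u))
  set f : ℝ → ℝ := fun u => A u * A (-u) - 2 * (O u * O (-u)) with hf
  set f₁ : ℝ → ℝ := fun u => (A₁ u * A (-u) + A u * -A₁ (-u))
    - 2 * (O₁ u * O (-u) + O u * -O₁ (-u))
  have hf1 : ∀ u, HasDerivAt f (f₁ u) u := fun u =>
    ((hA1 u).mul (hrefl (hA1 (-u)))).sub (((hO1 u).mul (hrefl (hO1 (-u)))).const_mul 2)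
  have hf2 : ∀ u, HasDerivAt f₁ (((A₂ u * A (-u) + A₁ u * -A₁ (-u))
        + (A₁ u * -A₁ (-u) + A u * -(-A₂ (-u))))
      - 2 * ((O₂ u * O (-u) + O₁ u * -O₁ (-u)) + (O₁ u * -O₁ (-u) + O u * -(-O₂ (-u))))) u :=
    fun u => (((hA2 u).mul (hrefl (hA1 (-u)))).add ((hA1 u).mul (hrefl (hA2 (-u))).neg)).sub
      ((((hO2 u).mul (hrefl (hO1 (-u)))).add ((hO1 u).mul (hrefl (hO2 (-u))).neg)).const_mul 2)
  have hd1 : deriv f = f₁ := funext fun u => (hf1 u).deriv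
  have hy0 : 0 ≤ y := Real.log_nonneg (by
    rw [one_le_div hr]
    by_contra hcon
    push Not at hcon
    nlinarith)
  have hconc : ConcaveOn ℝ (Set.Icc (-y) y) f := by
    refine concaveOn_of_deriv2_nonpos' (convex_Icc _ _)
      (fun u _ => (hf1 u).differentiableAt.differentiableWithinAt) ?_ fun u hu => ?_
    · rw [hd1]; exact fun u _ => (hf2 u).differentiableAt.differentiableWithinAt
    simp only [Function.iterate_succ, Function.iterate_zero, Function.comp, id, hd1]
    rw [(hf2 u).deriv]
    have key : ∀ v, -y ≤ v → 1 ≤ r * Real.exp v := fun v hv => by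
      calc (1 : ℝ) ≤ r * Real.exp (-y) := by rw [hrt]; exact ht
        _ ≤ r * Real.exp v := by gcongr
    have hu1 := key u hu.1
    have hu2 := key (-u) (by linarith [hu.2])
    -- One `θ₄''` term pays for the full cross term of `θ₂`; everything else in the second
    -- derivative is separately nonpositive.
    have e1 := oddSymbolMin_second_nonpos hu1 hu2
    have a1 := theta4_first_nonneg hu1
    have a2 := theta4_first_nonneg hu2
    have a3 := (theta4_second_bounds hu2).2
    have a4 := theta4_pos (show 0 < r * Real.exp u by linarith)
    have o1 := (theta2_second_nonneg hu1).1
    have o2 := (theta2_second_nonneg hu2).1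
    have o3 := theta2_pos (show 0 < 4 * (r * Real.exp u) by linarith)
    have o4 := theta2_pos (show 0 < 4 * (r * Real.exp (-u)) by linarith)
    have eA : ∀ v, A v = theta4 (r * Real.exp v) := fun v => rfl
    have eO : ∀ v, O v = theta2 (4 * (r * Real.exp v)) := fun v => by
      rw [← mul_assoc]; simp only [O, theta2, zero_add]
    rw [eA, eA, eO, eO]
    simp only [A₁, A₂, O₁, O₂, mul_assoc 4 r]
    have p1 := mul_nonneg a1 a2
    have p2 := mul_nonneg a3 a4.le
    have p3 := mul_nonneg o1 o4.le
    have p4 := mul_nonneg o2 o3.le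
    linarith
  have hc := hconc.2 (Set.right_mem_Icc.2 (by linarith)) (Set.left_mem_Icc.2 (by linarith))
    (by norm_num : (0 : ℝ) ≤ 1 / 2) (by norm_num : (0 : ℝ) ≤ 1 / 2) (by norm_num)
  have e0 : (1 / 2 : ℝ) • y + (1 / 2 : ℝ) • -y = 0 := by simp
  have eA : ∀ v, A v = theta4 (r * Real.exp v) := fun v => rfl
  have eO : ∀ v, O v = theta2 (4 * (r * Real.exp v)) := fun v => by
    rw [← mul_assoc]; simp only [O, theta2, zero_add]
  rw [e0] at hc
  simp only [hf, eA, eO, neg_neg, hrs, hrt, neg_zero, Real.exp_zero, mul_one, smul_eq_mul] at hc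
  unfold oddSymbolMin
  linarith

/-- Drop the `θ₂` product on the left and move `t` up to `t₀ = r - 1/4`. With `q = e^{-πr}` the left
side is then at most about `1 - 2e^{π/4}q`, the right side about `(1 - 2q)² ≈ 1 - 4q`. The gap 1/4
works because `e^{π/4} > 2`, and `r ≥ 3/2` makes the terms of higher order in `q` negligible. -/
theorem oddSymbolMin_le_of_le {r s t : ℝ} (hr : 3 / 2 ≤ r) (ht : 0 < t) (htr : t ≤ r - 1 / 4)
    (h : s * t = r ^ 2) : oddSymbolMin s t ≤ oddSymbolMin r r := by
  have hr0 : 0 < r := by linarith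
  have hs : 0 < s := pos_of_mul_pos_left (h ▸ pow_pos hr0 2) ht.le
  set t₀ := r - 1 / 4 with ht₀
  have ht0 : 1 ≤ t₀ := by linarith
  have hs0 : t₀ ≤ r ^ 2 / t₀ := by
    rw [le_div_iff₀ (by linarith)]; nlinarith
  have h1 : theta4 s * theta4 t ≤ theta4 (r ^ 2 / t₀) * theta4 t₀ :=
    theta4_mul_le ht htr hs0 (by rw [h, div_mul_cancel₀ _ (by linarith)])
  have h2 : theta4 (r ^ 2 / t₀) * theta4 t₀ ≤ theta4 t₀ :=
    mul_le_of_le_one_left (theta4_pos (by linarith)).le (theta4_le_one (by linarith))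
  have h3 := (theta4_bounds ht0).2
  have h4 := (theta4_bounds (show 1 ≤ r by linarith)).1
  have h5 := theta2_four_mul_le (show 1 ≤ r by linarith)
  have h6 := theta2_pos (show 0 < 4 * r by linarith)
  have h7 := mul_pos (theta2_pos (show 0 < 4 * s by linarith))
    (theta2_pos (show 0 < 4 * t by linarith))
  have hpi := Real.pi_gt_d2
  have hpi' := Real.pi_lt_d2
  set q := Real.exp (-(Real.pi * r)) with hq
  have hq0 : 0 < q := Real.exp_pos _
  have hq1 : q ≤ 0.0125 := by
    have h3 := exp_neg_three_lt
    calc q ≤ Real.exp (-3 + -1.5) := Real.exp_le_exp.2 (by nlinarith)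
      _ = Real.exp (-3) * Real.exp (-1.5) := Real.exp_add _ _
      _ ≤ 0.05 * 0.25 := by
        gcongr
        rw [Real.exp_neg, inv_le_comm₀ (Real.exp_pos _) (by norm_num)]
        have := Real.quadratic_le_exp_of_nonneg (show (0 : ℝ) ≤ 1.5 by norm_num)
        have h2 := Real.exp_one_gt_d9
        have h5 := Real.add_one_le_exp (0.5 : ℝ)
        rw [show (1.5 : ℝ) = 1 + 0.5 by norm_num, Real.exp_add]
        nlinarith
      _ = 0.0125 := by norm_num
  have e1 : Real.exp (-(Real.pi * t₀)) = q * Real.exp (Real.pi / 4) := by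
    rw [hq, ← Real.exp_add]; congr 1; rw [ht₀]; ring
  have e2 : Real.exp (-(4 * (Real.pi * t₀))) = q ^ 4 * Real.exp Real.pi := by
    rw [hq, ← Real.exp_nat_mul, ← Real.exp_add]; congr 1; rw [ht₀]; push_cast; ring
  have e3 : 2.09 ≤ Real.exp (Real.pi / 4) := by
    have := Real.quadratic_le_exp_of_nonneg (show (0 : ℝ) ≤ Real.pi / 4 by positivity)
    nlinarith
  have e4 : Real.exp Real.pi ≤ 80 := by
    have h2 := Real.exp_one_lt_d9
    calc Real.exp Real.pi ≤ Real.exp 4 := Real.exp_le_exp.2 (by linarith)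
      _ = Real.exp 1 ^ 4 := by rw [← Real.exp_nat_mul]; norm_num
      _ ≤ 2.7182818286 ^ 4 := by gcongr
      _ ≤ 80 := by norm_num
  rw [e1, e2] at h3
  have hq4 : q ^ 4 ≤ q * 0.0125 ^ 3 := by
    calc q ^ 4 = q * q ^ 3 := by ring
      _ ≤ q * 0.0125 ^ 3 := by gcongr
  have h8 : q ^ 4 * Real.exp Real.pi ≤ (q * 0.0125 ^ 3) * 80 := by gcongr
  have h9 : theta2 (4 * r) * theta2 (4 * r) ≤ (2.1 * q) * (2.1 * q) := by gcongr
  have h10 : (1 - 2 * q) * (1 - 2 * q) ≤ theta4 r * theta4 r := by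
    exact mul_self_le_mul_self (by linarith) h4
  unfold oddSymbolMin
  nlinarith

/-- For `s t = 1/4` one has `1/(4s) = t`, so Jacobi's transformation turns the `θ₂` product into
exactly half the `θ₄` product. This is the critical density `n = 1`, where the lower frame bound
vanishes. -/
theorem oddSymbolMin_eq_zero {s t : ℝ} (hs : 0 < s) (ht : 0 < t) (h : s * t = (1 / 2) ^ 2) :
    oddSymbolMin s t = 0 := by
  have e1 : 1 / (4 * s) = t := by
    rw [div_eq_iff (by positivity)]; linarith
  have e2 : 1 / (4 * t) = s := by
    rw [div_eq_iff (by positivity)]; linarith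
  have e3 : (4 * s) ^ (1 / 2 : ℝ) * (4 * t) ^ (1 / 2 : ℝ) = 2 := by
    rw [← Real.mul_rpow (by positivity) (by positivity),
      show 4 * s * (4 * t) = 2 ^ (2 : ℝ) by norm_num; linarith, ← Real.rpow_mul (by norm_num)]
    norm_num
  have e4 : 1 / (4 * s) ^ (1 / 2 : ℝ) * (1 / (4 * t) ^ (1 / 2 : ℝ)) = 1 / 2 := by
    rw [div_mul_div_comm, e3, one_mul]
  rw [oddSymbolMin, theta2_functional_equation (show 0 < 4 * s by linarith),
    theta2_functional_equation (show 0 < 4 * t by linarith), e1, e2]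
  linear_combination (-2 * theta4 t * theta4 s) * e4

theorem oddSymbolMin_le {n : ℕ} (hn : Odd n) {s t : ℝ} (hs : 0 < s) (ht : 0 < t)
    (h : s * t = (n / 2 : ℝ) ^ 2) : oddSymbolMin s t ≤ oddSymbolMin (n / 2) (n / 2) := by
  obtain ⟨m, rfl⟩ := hn
  rcases Nat.eq_zero_or_pos m with rfl | hm
  · norm_num at h ⊢
    rw [oddSymbolMin_eq_zero hs ht (by linarith), oddSymbolMin_eq_zero (by norm_num) (by norm_num)
      (by norm_num)]
  · have hr : 3 / 2 ≤ ((2 * m + 1 : ℕ) : ℝ) / 2 := by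
      have : (1 : ℝ) ≤ m := by exact_mod_cast hm
      push_cast; linarith
    wlog hts : t ≤ s generalizing s t
    · rw [oddSymbolMin_comm]
      exact this ht hs (by rw [mul_comm]; exact h) (le_of_not_ge hts)
    -- Both regimes are available since `r - 1/4 ≥ 5/4`, so `t ≥ r - 1/4` implies `t ≥ 1`.
    rcases le_total t (((2 * m + 1 : ℕ) : ℝ) / 2 - 1 / 4) with h1 | h1
    · exact oddSymbolMin_le_of_le hr ht h1 h
    · exact oddSymbolMin_le_of_one_le (by linarith) hts (by linarith) h

/-! ### Periodization and Parseval's identity -/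

theorem setLIntegral_Ioc_add_mul (Φ : ℝ → ℝ≥0∞) (T : ℝ) (j : ℤ) :
    ∫⁻ x in Set.Ioc 0 T, Φ (x + j * T) = ∫⁻ x in Set.Ioc (j • T) ((j + 1) • T), Φ x := by
  rw [← (measurePreserving_add_right volume ((j : ℝ) * T)).setLIntegral_comp_preimage_emb
    (measurableEmbedding_addRight _) Φ (Set.Ioc (j • T) ((j + 1) • T))]
  congr 2
  ext x
  simp only [Set.mem_Ioc, Set.mem_preimage, zsmul_eq_mul]
  push_cast
  constructor <;> rintro ⟨h1, h2⟩ <;> constructor <;> linarith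

theorem setIntegral_Ioc_add_mul (φ : ℝ → ℂ) (T : ℝ) (j : ℤ) :
    ∫ x in Set.Ioc 0 T, φ (x + j * T) = ∫ x in Set.Ioc (j • T) ((j + 1) • T), φ x := by
  rw [← (measurePreserving_add_right volume ((j : ℝ) * T)).setIntegral_preimage_emb
    (measurableEmbedding_addRight _) φ (Set.Ioc (j • T) ((j + 1) • T))]
  congr 2
  ext x
  simp only [Set.mem_Ioc, Set.mem_preimage, zsmul_eq_mul]
  push_cast
  constructor <;> rintro ⟨h1, h2⟩ <;> constructor <;> linarith

theorem pairwise_disjoint_Ioc_zsmul_add_one (T : ℝ) :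
    Pairwise (Function.onFun Disjoint fun j : ℤ => Set.Ioc (j • T) ((j + 1) • T)) := by
  simpa only [zero_add] using Set.pairwise_disjoint_Ioc_add_zsmul (0 : ℝ) T

theorem tsum_setLIntegral_Ioc_add_mul {T : ℝ} (hT : 0 < T) (Φ : ℝ → ℝ≥0∞) :
    ∑' j : ℤ, ∫⁻ x in Set.Ioc 0 T, Φ (x + j * T) = ∫⁻ x, Φ x := by
  simp_rw [setLIntegral_Ioc_add_mul]
  rw [← lintegral_iUnion (fun _ => measurableSet_Ioc) (pairwise_disjoint_Ioc_zsmul_add_one T),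
    iUnion_Ioc_zsmul hT, Measure.restrict_univ]

theorem setLIntegral_Ioc_tsum {T : ℝ} (hT : 0 < T) {Φ : ℝ → ℝ≥0∞} (hΦ : Measurable Φ) :
    ∫⁻ x in Set.Ioc 0 T, ∑' j : ℤ, Φ (x + j * T) = ∫⁻ x, Φ x := by
  have hj : ∀ j : ℤ, Measurable fun x => Φ (x + j * T) := fun j =>
    hΦ.comp (measurable_id.add_const _)
  rw [lintegral_tsum fun j => (hj j).aemeasurable, tsum_setLIntegral_Ioc_add_mul hT]

/-- Unfolding of an integral over the line to a period. -/
theorem setIntegral_Ioc_tsum {T : ℝ} (hT : 0 < T) {φ : ℝ → ℂ} (hm : Measurable φ)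
    (hφ : Integrable φ) :
    ∫ x in Set.Ioc 0 T, ∑' j : ℤ, φ (x + j * T) = ∫ x, φ x := by
  have hfin : ∑' j : ℤ, ∫⁻ x in Set.Ioc 0 T, ‖φ (x + j * T)‖ₑ ≠ ∞ := by
    rw [tsum_setLIntegral_Ioc_add_mul hT fun x => ‖φ x‖ₑ]
    exact hφ.2.ne
  have hj : ∀ j : ℤ, Measurable fun x => φ (x + j * T) := fun j =>
    hm.comp (measurable_id.add_const _)
  rw [integral_tsum (fun j => (hj j).aestronglyMeasurable) hfin]
  simp_rw [setIntegral_Ioc_add_mul]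
  have := hasSum_integral_iUnion (μ := volume) (f := φ) (s := fun j : ℤ => Set.Ioc (j • T) ((j + 1) • T))
    (fun _ => measurableSet_Ioc) (pairwise_disjoint_Ioc_zsmul_add_one T) hφ.integrableOn
  rw [this.tsum_eq, iUnion_Ioc_zsmul hT, Measure.restrict_univ]

/-- Parseval's identity for the samples of a Fourier transform, in terms of the
autocorrelation. -/
theorem hasSum_sq_norm_fourier_samples {T : ℝ} (hT : 0 < T) {h : ℝ → ℂ} (hm : Measurable h)
    (hi : Integrable h) (hauto : ∑' d : ℤ, ∫⁻ x, ‖h x‖ₑ * ‖h (x + d * T)‖ₑ ≠ ∞) :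
    HasSum (fun l : ℤ => ‖∫ x, h x * Complex.exp (-(2 * Real.pi * Complex.I * l * x / T))‖ ^ 2)
      (T * (∑' d : ℤ, ∫ x, h x * conj (h (x + d * T))).re) := by
  set P : ℝ → ℂ := fun x => ∑' j : ℤ, h (x + j * T) with hP
  have hmj : ∀ j : ℤ, Measurable fun x => h (x + j * T) := fun j =>
    hm.comp (measurable_id.add_const _)
  have hPm : Measurable P := Measurable.tsum hmj
  have hPper : ∀ (x : ℝ) (j : ℤ), P (x + j * T) = P x := by
    intro x j
    rw [hP]
    simp only
    rw [← (Equiv.addLeft j).tsum_eq fun i : ℤ => h (x + i * T)]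
    refine tsum_congr fun i => ?_
    simp only [Equiv.coe_addLeft]
    congr 1; push_cast; ring
  have hPle : ∀ x, ‖P x‖ₑ ≤ ∑' j : ℤ, ‖h (x + j * T)‖ₑ := fun x => enorm_tsum_le_tsum_enorm
  -- the function whose periodization is `|P|²`
  set φ : ℝ → ℂ := fun x => h x * conj (P x) with hφ
  have hφm : Measurable φ := hm.mul (Complex.continuous_conj.measurable.comp hPm)
  have hdom : ∫⁻ x, ‖h x‖ₑ * ∑' d : ℤ, ‖h (x + d * T)‖ₑ
      = ∑' d : ℤ, ∫⁻ x, ‖h x‖ₑ * ‖h (x + d * T)‖ₑ := by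
    have hd : ∀ d : ℤ, Measurable fun x => ‖h x‖ₑ * ‖h (x + d * T)‖ₑ := fun d =>
      hm.enorm.mul (hmj d).enorm
    rw [← lintegral_tsum fun d => (hd d).aemeasurable]
    simp_rw [ENNReal.tsum_mul_left]
  have hφi : Integrable φ := by
    refine ⟨hφm.aestronglyMeasurable, lt_of_le_of_lt ?_ hauto.lt_top⟩
    rw [← hdom]
    refine lintegral_mono fun x => ?_
    rw [hφ]
    simp only [enorm_mul, RCLike.enorm_conj]
    gcongr
    exact hPle x
  have hφper : ∀ x, ∑' j : ℤ, φ (x + j * T) = P x * conj (P x) := by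
    intro x
    simp only [hφ, hPper, tsum_mul_right]
    rfl
  have hsq : ∫ x in Set.Ioc 0 T, P x * conj (P x) = ∫ x, φ x := by
    simp_rw [← hφper]
    exact setIntegral_Ioc_tsum hT hφm hφi
  have hφd : ∫ x, φ x = ∑' d : ℤ, ∫ x, h x * conj (h (x + d * T)) := by
    have hd : ∀ d : ℤ, Measurable fun x => h x * conj (h (x + d * T)) := fun d =>
      hm.mul (Complex.continuous_conj.measurable.comp (hmj d))
    rw [← integral_tsum (fun d => (hd d).aestronglyMeasurable)]
    · refine integral_congr_ae (Filter.Eventually.of_forall fun x => ?_)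
      simp only [hφ, hP, tsum_mul_left]
      rw [Complex.conj_tsum]
    · simpa [enorm_mul, RCLike.enorm_conj] using hauto
  -- `|P|²` is at most the square of the periodization of `|h|`, whose integral over a period
  -- unfolds to the finite sum in `hauto`.
  have hPL2 : MemLp P 2 (volume.restrict (Set.Ioc 0 T)) := by
    refine ⟨hPm.aestronglyMeasurable, ?_⟩
    rw [eLpNorm_lt_top_iff_lintegral_rpow_enorm_lt_top (by norm_num) (by norm_num)]
    refine lt_of_le_of_lt ?_ hauto.lt_top
    have hd : Measurable fun x => ‖h x‖ₑ * ∑' d : ℤ, ‖h (x + d * T)‖ₑ :=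
      hm.enorm.mul (Measurable.tsum fun d => (hmj d).enorm)
    rw [← hdom, ← setLIntegral_Ioc_tsum hT hd]
    refine lintegral_mono fun x => ?_
    simp only [ENNReal.toReal_ofNat, ENNReal.rpow_ofNat]
    have hper : ∀ j : ℤ, ∑' d : ℤ, ‖h (x + j * T + d * T)‖ₑ = ∑' d : ℤ, ‖h (x + d * T)‖ₑ := by
      intro j
      rw [← (Equiv.addLeft j).tsum_eq fun i : ℤ => ‖h (x + i * T)‖ₑ]
      refine tsum_congr fun i => ?_
      simp only [Equiv.coe_addLeft]
      congr 2; push_cast; ring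
    simp only [hper, ENNReal.tsum_mul_right]
    rw [sq]
    gcongr <;> exact hPle x
  have hpars := hasSum_sq_fourierCoeffOn hT hPL2
  -- The Fourier coefficients of the periodization are the samples of the Fourier transform of `h`.
  have hcoef : ∀ l : ℤ, fourierCoeffOn hT P l
      = (1 / T : ℝ) • ∫ x, h x * Complex.exp (-(2 * Real.pi * Complex.I * l * x / T)) := by
    intro l
    rw [fourierCoeffOn_eq_integral, sub_zero, intervalIntegral.integral_of_le hT.le]
    congr 1
    have he : Measurable fun x : ℝ => Complex.exp (-(2 * Real.pi * Complex.I * l * x / T)) := by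
      fun_prop
    have hhe : Measurable fun x : ℝ =>
        h x * Complex.exp (-(2 * Real.pi * Complex.I * l * x / T)) := hm.mul he
    rw [← setIntegral_Ioc_tsum hT hhe]
    · refine integral_congr_ae (Filter.Eventually.of_forall fun x => ?_)
      simp only [fourier_coe_apply, smul_eq_mul, hP, ← tsum_mul_left]
      refine tsum_congr fun j => ?_
      rw [mul_comm]
      congr 1
      have hT' : (T : ℂ) ≠ 0 := by exact_mod_cast hT.ne'
      rw [Complex.exp_eq_exp_iff_exists_int]
      refine ⟨l * j, ?_⟩
      push_cast
      field_simp
      ring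
    · refine hi.mul_bdd (c := 1) he.aestronglyMeasurable (Filter.Eventually.of_forall fun x => ?_)
      have : -(2 * Real.pi * Complex.I * l * x / T) = ((-(2 * Real.pi * l * x / T) : ℝ) : ℂ) * Complex.I := by
        push_cast; ring
      rw [this, Complex.norm_exp_ofReal_mul_I]
  have hre : ∫ x in (0 : ℝ)..T, ‖P x‖ ^ 2
      = (∑' d : ℤ, ∫ x, h x * conj (h (x + d * T))).re := by
    rw [← hφd, ← hsq, intervalIntegral.integral_of_le hT.le]
    have : ∀ x, P x * conj (P x) = ((‖P x‖ ^ 2 : ℝ) : ℂ) := fun x => by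
      rw [Complex.mul_conj']; push_cast; rfl
    simp_rw [this]
    rw [integral_complex_ofReal, Complex.ofReal_re]
  have := hpars.mul_left (T ^ 2)
  simp_rw [hcoef] at this
  rw [hre, sub_zero] at this
  convert! this using 1
  · funext l
    rw [norm_smul, mul_pow]
    simp only [one_div, norm_inv, Real.norm_eq_abs, abs_of_pos hT]
    field_simp
  · rw [smul_eq_mul]; field_simp

/-! ### Janssen's representation for the Gaussian -/

/-- The real-valued Gaussian window. -/
noncomputable def realGaussian (x : ℝ) : ℝ := (2 : ℝ) ^ (1 / 4 : ℝ) * Real.exp (-Real.pi * x ^ 2)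

theorem gaussianWindow_eq (x : ℝ) : gaussianWindow x = (realGaussian x : ℂ) := rfl

theorem realGaussian_pos (x : ℝ) : 0 < realGaussian x := by unfold realGaussian; positivity

theorem measurable_realGaussian : Measurable realGaussian := by
  unfold realGaussian; fun_prop

/-- The parallelogram law separates the difference of the two points from their midpoint. -/
theorem realGaussian_mul (x y : ℝ) : realGaussian x * realGaussian y =
    (2 : ℝ) ^ (1 / 2 : ℝ) * (Real.exp (-Real.pi * (x - y) ^ 2 / 2) *
      Real.exp (-2 * Real.pi * ((x + y) / 2) ^ 2)) := by
  have h2 : (2 : ℝ) ^ (1 / 4 : ℝ) * (2 : ℝ) ^ (1 / 4 : ℝ) = (2 : ℝ) ^ (1 / 2 : ℝ) := by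
    rw [← Real.rpow_add two_pos]; norm_num
  rw [realGaussian, realGaussian, ← h2, ← Real.exp_add, mul_mul_mul_comm, ← Real.exp_add]
  congr 2; ring

theorem memLp_realGaussian : MemLp (fun x => (realGaussian x : ℂ)) 2 volume := by
  have hm : Measurable fun x => (realGaussian x : ℂ) :=
    Complex.measurable_ofReal.comp measurable_realGaussian
  rw [memLp_two_iff_integrable_sq_norm hm.aestronglyMeasurable]
  have h := (integrable_exp_neg_mul_sq (b := 2 * Real.pi) (by positivity)).const_mul
    ((2 : ℝ) ^ (1 / 2 : ℝ))
  refine h.congr (Filter.Eventually.of_forall fun x => ?_)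
  simp only [Complex.norm_real, Real.norm_of_nonneg (realGaussian_pos x).le]
  rw [sq (realGaussian x), realGaussian_mul, sub_self]
  ring_nf
  simp

/-- Poisson summation over `αℤ` in the midpoint variable `x + c/2`, in the form of the functional
equation of the Hurwitz kernel. -/
theorem hasSum_realGaussian_mul {α : ℝ} (hα : 0 < α) (x c : ℝ) :
    HasSum (fun k : ℤ => realGaussian (x - α * k) * realGaussian (x + c - α * k))
      (1 / α * Real.exp (-Real.pi * c ^ 2 / 2) *
        HurwitzZeta.cosKernel ((-(x + c / 2) / α : ℝ) : UnitAddCircle) (1 / (2 * α ^ 2))) := by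
  have h := HurwitzZeta.hasSum_int_evenKernel (-(x + c / 2) / α) (t := 2 * α ^ 2) (by positivity)
  rw [HurwitzZeta.evenKernel_functional_equation] at h
  have h2 := h.mul_left ((2 : ℝ) ^ (1 / 2 : ℝ) * Real.exp (-Real.pi * c ^ 2 / 2))
  convert! h2 using 1
  · funext k
    rw [realGaussian_mul, ← mul_assoc]
    congr 1
    · congr 2; ring
    · congr 1; field_simp; ring
  · have e : (2 * α ^ 2) ^ (1 / 2 : ℝ) = (2 : ℝ) ^ (1 / 2 : ℝ) * α := by
      rw [Real.mul_rpow (by norm_num) (by positivity), ← Real.sqrt_eq_rpow (α ^ 2),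
        Real.sqrt_sq hα.le]
    rw [e]
    have : (2 : ℝ) ^ (1 / 2 : ℝ) ≠ 0 := by positivity
    field_simp

theorem cosKernel_le_cosKernel_zero (a : ℝ) {t : ℝ} (ht : 0 < t) :
    HurwitzZeta.cosKernel (a : UnitAddCircle) t ≤ HurwitzZeta.cosKernel 0 t := by
  have h := HurwitzZeta.hasSum_int_cosKernel a ht
  have h0 := HurwitzZeta.hasSum_int_cosKernel 0 ht
  rw [QuotientAddGroup.mk_zero] at h0
  have hre := Complex.hasSum_re h
  have hre0 := Complex.hasSum_re h0
  refine hasSum_le (fun n => ?_) hre hre0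
  rw [Complex.re_mul_ofReal, Complex.re_mul_ofReal]
  refine mul_le_mul_of_nonneg_right ?_ (Real.exp_pos _).le
  have : (2 * Real.pi * Complex.I * a * n : ℂ) = ((2 * Real.pi * a * n : ℝ) : ℂ) * Complex.I := by
    push_cast; ring
  rw [this, Complex.exp_ofReal_mul_I_re]
  simpa using Real.cos_le_one _

theorem summable_exp_neg_int_sq {t : ℝ} (ht : 0 < t) :
    Summable fun n : ℤ => Real.exp (-Real.pi * (n : ℝ) ^ 2 * t) := by
  have := (HurwitzZeta.hasSum_int_evenKernel 0 ht).summable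
  simpa using this

/-- The autocorrelation `∫ f(x) conj (e^{2πilx/α} f(x + dT)) dx`. -/
noncomputable def crossCorr (f : ℝ → ℂ) (T α : ℝ) (p : ℤ × ℤ) : ℂ :=
  ∫ x, f x * conj (Complex.exp (2 * Real.pi * Complex.I * p.2 * x / α) * f (x + p.1 * T))

/-- The coefficients of the frame operator of the Gaussian in Janssen's representation, for integer
redundancy `n`. -/
noncomputable def janssenCoeff (n : ℕ) (s t : ℝ) (p : ℤ × ℤ) : ℝ :=
  (-1) ^ ((n : ℤ) * p.1 * p.2) *
    (Real.exp (-Real.pi * (p.1 : ℝ) ^ 2 * s) * Real.exp (-Real.pi * (p.2 : ℝ) ^ 2 * t))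

theorem abs_janssenCoeff (n : ℕ) (s t : ℝ) (p : ℤ × ℤ) : |janssenCoeff n s t p| =
    Real.exp (-Real.pi * (p.1 : ℝ) ^ 2 * s) * Real.exp (-Real.pi * (p.2 : ℝ) ^ 2 * t) := by
  rw [janssenCoeff, abs_mul, abs_neg_one_zpow, one_mul, abs_of_pos (by positivity)]

theorem summable_janssenCoeff (n : ℕ) {s t : ℝ} (hs : 0 < s) (ht : 0 < t) :
    Summable (janssenCoeff n s t) := by
  refine Summable.of_norm ?_
  simp_rw [Real.norm_eq_abs, abs_janssenCoeff]
  exact (summable_exp_neg_int_sq hs).mul_of_nonneg (summable_exp_neg_int_sq ht)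
    (fun _ => (Real.exp_pos _).le) (fun _ => (Real.exp_pos _).le)

/-- The place where integrality of the redundancy enters: `dT/2 = ndα/2`, so at frequency `l/α` the
midpoint contributes only a sign. -/
theorem exp_phase_eq {n : ℕ} {α T : ℝ} (hα : 0 < α) (hT : T = n * α) (d l : ℤ) (x : ℝ) :
    Complex.exp (2 * Real.pi * Complex.I * (-(x + d * T / 2) / α : ℝ) * l)
      = (-1) ^ ((n : ℤ) * d * l) * conj (Complex.exp (2 * Real.pi * Complex.I * l * x / α)) := by
  have hα' : (α : ℂ) ≠ 0 := by exact_mod_cast hα.ne'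
  have e1 : ((-1 : ℂ)) ^ ((n : ℤ) * d * l)
      = Complex.exp (((n : ℤ) * d * l : ℤ) * (-(Real.pi * Complex.I))) := by
    rw [Complex.exp_int_mul, Complex.exp_neg, Complex.exp_pi_mul_I]
    norm_num
  rw [e1, ← Complex.exp_conj, ← Complex.exp_add]
  congr 1
  simp only [map_div₀, map_mul, Complex.conj_I, Complex.conj_ofReal, map_intCast, map_ofNat]
  rw [hT]
  push_cast
  field_simp
  ring

theorem lintegral_enorm_mul_comp_add_le {f : ℝ → ℂ} (hm : Measurable f) (c : ℝ) :
    ∫⁻ x, ‖f x‖ₑ * ‖f (x + c)‖ₑ ≤ 2 * ∫⁻ x, ‖f x‖ₑ ^ 2 := by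
  have h1 : ∫⁻ x, ‖f (x + c)‖ₑ ^ 2 = ∫⁻ x, ‖f x‖ₑ ^ 2 :=
    lintegral_add_right_eq_self (fun x => ‖f x‖ₑ ^ 2) c
  calc ∫⁻ x, ‖f x‖ₑ * ‖f (x + c)‖ₑ ≤ ∫⁻ x, (‖f x‖ₑ ^ 2 + ‖f (x + c)‖ₑ ^ 2) := by
        refine lintegral_mono fun x => ?_
        rcases le_total ‖f x‖ₑ ‖f (x + c)‖ₑ with h | h
        · exact le_add_left (by rw [sq]; gcongr)
        · exact le_add_right (by rw [sq]; gcongr)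
    _ = 2 * ∫⁻ x, ‖f x‖ₑ ^ 2 := by
        rw [lintegral_add_left (hm.enorm.pow_const 2), h1, two_mul]

theorem MemLp.lintegral_enorm_sq_ne_top {f : ℝ → ℂ} (hf : MemLp f 2 volume) :
    ∫⁻ x, ‖f x‖ₑ ^ 2 ≠ ∞ := by
  have h := hf.2
  rw [eLpNorm_lt_top_iff_lintegral_rpow_enorm_lt_top (by norm_num) (by norm_num)] at h
  simpa using h.ne

/-- The absolute convergence behind the later interchanges of the sums over `k` and `d` with the
integral: the sum over `k` of the products of Gaussians is bounded uniformly in `x` by a multiple of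
`e^{-π(dT)²/2}`, which is summable in `d`. -/
theorem tsum_lintegral_gaussian_ne_top {α T : ℝ} (hα : 0 < α) (hT : 0 < T) {f : ℝ → ℂ}
    (hm : Measurable f) (hf : MemLp f 2 volume) :
    ∑' k : ℤ, ∑' d : ℤ, ∫⁻ x, ‖f x * realGaussian (x - α * k)‖ₑ *
      ‖f (x + d * T) * realGaussian (x + d * T - α * k)‖ₑ ≠ ∞ := by
  rw [ENNReal.tsum_comm]
  have hmf : ∀ d : ℤ, Measurable fun x => f (x + d * T) := fun d =>
    hm.comp (measurable_id.add_const _)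
  have hg : ∀ c : ℝ, Measurable fun x => (realGaussian (x + c) : ℂ) := fun c =>
    Complex.measurable_ofReal.comp (measurable_realGaussian.comp (measurable_id.add_const _))
  have hmeas : ∀ d k : ℤ, Measurable fun x => ‖f x * realGaussian (x - α * k)‖ₑ *
      ‖f (x + d * T) * realGaussian (x + d * T - α * k)‖ₑ := by
    intro d k
    have h1 := (hm.mul (hg (-(α * k)))).enorm
    have h2 := ((hmf d).mul (hg (d * T - α * k))).enorm
    simp only [← sub_eq_add_neg, ← add_sub_assoc] at h1 h2
    exact h1.mul h2
  set W := HurwitzZeta.cosKernel 0 (1 / (2 * α ^ 2))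
  have key : ∀ d : ℤ, ∑' k : ℤ, ∫⁻ x, ‖f x * realGaussian (x - α * k)‖ₑ *
      ‖f (x + d * T) * realGaussian (x + d * T - α * k)‖ₑ
      ≤ (2 * ∫⁻ x, ‖f x‖ₑ ^ 2) *
        ENNReal.ofReal (1 / α * Real.exp (-Real.pi * (d * T) ^ 2 / 2) * W) := by
    intro d
    rw [← lintegral_tsum fun k => (hmeas d k).aemeasurable]
    calc _ ≤ ∫⁻ x, (‖f x‖ₑ * ‖f (x + d * T)‖ₑ) *
          ENNReal.ofReal (1 / α * Real.exp (-Real.pi * (d * T) ^ 2 / 2) * W) := by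
          refine lintegral_mono fun x => ?_
          have hs := hasSum_realGaussian_mul hα x (d * T)
          have : ∀ k : ℤ, ‖f x * realGaussian (x - α * k)‖ₑ *
              ‖f (x + d * T) * realGaussian (x + d * T - α * k)‖ₑ
              = (‖f x‖ₑ * ‖f (x + d * T)‖ₑ) *
                ENNReal.ofReal (realGaussian (x - α * k) * realGaussian (x + d * T - α * k)) := by
            intro k
            rw [enorm_mul, enorm_mul, ENNReal.ofReal_mul (realGaussian_pos _).le,
              mul_mul_mul_comm]
            congr 2 <;>
            · rw [← ofReal_norm, Complex.norm_real,
                Real.norm_of_nonneg (realGaussian_pos _).le]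
          simp only [this, ENNReal.tsum_mul_left]
          gcongr
          rw [← ENNReal.ofReal_tsum_of_nonneg
            (fun k => (mul_pos (realGaussian_pos _) (realGaussian_pos _)).le) hs.summable,
            hs.tsum_eq]
          gcongr
          exact cosKernel_le_cosKernel_zero _ (by positivity)
      _ = (∫⁻ x, ‖f x‖ₑ * ‖f (x + d * T)‖ₑ) *
          ENNReal.ofReal (1 / α * Real.exp (-Real.pi * (d * T) ^ 2 / 2) * W) :=
          lintegral_mul_const _ (hm.enorm.mul (hmf d).enorm)
      _ ≤ _ := by gcongr; exact lintegral_enorm_mul_comp_add_le hm _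
  refine ne_top_of_le_ne_top ?_ (ENNReal.tsum_le_tsum key)
  rw [ENNReal.tsum_mul_left]
  refine ENNReal.mul_ne_top (ENNReal.mul_ne_top (by norm_num) (MemLp.lintegral_enorm_sq_ne_top hf)) ?_
  have hsum : Summable fun d : ℤ => 1 / α * Real.exp (-Real.pi * (d * T) ^ 2 / 2) * W := by
    have := ((summable_exp_neg_int_sq (show 0 < T ^ 2 / 2 by positivity)).mul_left (1 / α)).mul_right W
    refine this.congr fun d => ?_
    congr 3; ring
  exact hsum.tsum_ofReal_ne_top

theorem norm_phase (x : ℝ) (l : ℤ) (α : ℝ) :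
    ‖Complex.exp (2 * Real.pi * Complex.I * l * x / α)‖ = 1 := by
  have : (2 * Real.pi * Complex.I * l * x / α : ℂ) = ((2 * Real.pi * l * x / α : ℝ) : ℂ) * Complex.I := by
    push_cast; ring
  rw [this, Complex.norm_exp_ofReal_mul_I]

theorem integrable_norm_mul_comp_add {f : ℝ → ℂ} (hf : MemLp f 2 volume) (c : ℝ) :
    Integrable fun x => ‖f x‖ * ‖f (x + c)‖ := by
  have h : MemLp (fun x => f (x + c)) 2 volume :=
    hf.comp_measurePreserving (measurePreserving_add_right volume c)
  exact hf.norm.integrable_mul h.norm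

theorem norm_crossCorr_le {f : ℝ → ℂ} (hf : MemLp f 2 volume) (T α : ℝ) (p : ℤ × ℤ) :
    ‖crossCorr f T α p‖ ≤ ∫ x, ‖f x‖ ^ 2 := by
  have hsq := (memLp_two_iff_integrable_sq_norm hf.1).1 hf
  calc ‖crossCorr f T α p‖ ≤ ∫ x, ‖f x‖ * ‖f (x + p.1 * T)‖ := by
        refine (norm_integral_le_integral_norm _).trans (le_of_eq ?_)
        refine integral_congr_ae (Filter.Eventually.of_forall fun x => ?_)
        simp [norm_phase]
    _ ≤ ∫ x, (‖f x‖ ^ 2 + ‖f (x + p.1 * T)‖ ^ 2) / 2 := by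
        refine integral_mono (integrable_norm_mul_comp_add hf _)
          ((hsq.add (hsq.comp_add_right _)).div_const 2) fun x => ?_
        simp only
        linarith [two_mul_le_add_sq ‖f x‖ ‖f (x + p.1 * T)‖]
    _ = ∫ x, ‖f x‖ ^ 2 := by
        rw [integral_div, integral_add hsq (hsq.comp_add_right _),
          integral_add_right_eq_self (fun x => ‖f x‖ ^ 2)]
        ring

theorem summable_janssenCoeff_mul_crossCorr (n : ℕ) {s t : ℝ} (hs : 0 < s) (ht : 0 < t) {f : ℝ → ℂ}
    (hf : MemLp f 2 volume) (T α : ℝ) :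
    Summable fun p => (janssenCoeff n s t p : ℂ) * crossCorr f T α p := by
  refine ((summable_janssenCoeff n hs ht).abs.mul_right (∫ x, ‖f x‖ ^ 2)).of_norm_bounded fun p => ?_
  rw [norm_mul, Complex.norm_real, Real.norm_eq_abs]
  gcongr
  exact norm_crossCorr_le hf T α p

/-- Summation over the translates of the Gaussian. -/
theorem tsum_integral_gaussian {n : ℕ} {α T : ℝ} (hα : 0 < α) (hT : T = n * α) {f : ℝ → ℂ}
    (hm : Measurable f) (hf : MemLp f 2 volume) (d : ℤ)
    (hfin : ∑' k : ℤ, ∫⁻ x, ‖f x * realGaussian (x - α * k)‖ₑ *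
      ‖f (x + d * T) * realGaussian (x + d * T - α * k)‖ₑ ≠ ∞) :
    ∑' k : ℤ, ∫ x, f x * realGaussian (x - α * k) *
      conj (f (x + d * T) * realGaussian (x + d * T - α * k))
    = 1 / α * ∑' l : ℤ, (janssenCoeff n (T ^ 2 / 2) (1 / (2 * α ^ 2)) (d, l) : ℂ) *
        crossCorr f T α (d, l) := by
  have hmf : Measurable fun x => f (x + d * T) := hm.comp (measurable_id.add_const _)
  have hg : ∀ c : ℝ, Measurable fun x => (realGaussian (x + c) : ℂ) := fun c =>
    Complex.measurable_ofReal.comp (measurable_realGaussian.comp (measurable_id.add_const _))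
  have ht : 0 < 1 / (2 * α ^ 2) := by positivity
  have hmeas : ∀ k : ℤ, Measurable fun x => f x * realGaussian (x - α * k) *
      conj (f (x + d * T) * realGaussian (x + d * T - α * k)) := by
    intro k
    have h1 := hm.mul (hg (-(α * k)))
    have h2 := Complex.continuous_conj.measurable.comp (hmf.mul (hg (d * T - α * k)))
    simp only [← sub_eq_add_neg, ← add_sub_assoc] at h1 h2
    exact h1.mul h2
  have hmeas2 : ∀ l : ℤ, Measurable fun x : ℝ => (janssenCoeff n (T ^ 2 / 2) (1 / (2 * α ^ 2)) (d, l) : ℂ) *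
      (f x * conj (Complex.exp (2 * Real.pi * Complex.I * l * x / α) * f (x + d * T))) := by
    intro l
    refine (hm.mul (Complex.continuous_conj.measurable.comp (Measurable.mul ?_ hmf))).const_mul _
    fun_prop
  rw [← integral_tsum (fun k => (hmeas k).aestronglyMeasurable)
    (by simpa only [enorm_mul, RCLike.enorm_conj] using hfin)]
  simp_rw [crossCorr, ← integral_const_mul]
  rw [← integral_tsum (fun l => (hmeas2 l).aestronglyMeasurable), ← integral_const_mul]
  · refine integral_congr_ae (Filter.Eventually.of_forall fun x => ?_)
    simp only
    have h1 := Complex.hasSum_ofReal.2 (hasSum_realGaussian_mul hα x (d * T))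
    have h2 := HurwitzZeta.hasSum_int_cosKernel (-(x + d * T / 2) / α) ht
    have h3 : ∀ k : ℤ, f x * realGaussian (x - α * k) *
        conj (f (x + d * T) * realGaussian (x + d * T - α * k))
        = f x * conj (f (x + d * T)) *
          ((realGaussian (x - α * k) * realGaussian (x + d * T - α * k) : ℝ) : ℂ) := by
      intro k
      rw [map_mul, Complex.conj_ofReal]; push_cast; ring
    have h4 : ∀ l : ℤ, (janssenCoeff n (T ^ 2 / 2) (1 / (2 * α ^ 2)) (d, l) : ℂ) *
        (f x * conj (Complex.exp (2 * Real.pi * Complex.I * l * x / α) * f (x + d * T)))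
        = f x * conj (f (x + d * T)) * (Real.exp (-Real.pi * (d * T) ^ 2 / 2) : ℝ) *
          (Complex.exp (2 * Real.pi * Complex.I * (-(x + d * T / 2) / α : ℝ) * l) *
            Real.exp (-Real.pi * (l : ℝ) ^ 2 * (1 / (2 * α ^ 2)))) := by
      intro l
      rw [exp_phase_eq hα hT d l x, janssenCoeff]
      have : -Real.pi * (d : ℝ) ^ 2 * (T ^ 2 / 2) = -Real.pi * (d * T) ^ 2 / 2 := by ring
      simp only [this, map_mul]
      push_cast
      ring
    simp only [h3, h4, tsum_mul_left]
    rw [h1.tsum_eq, h2.tsum_eq]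
    push_cast
    ring
  · simp only [enorm_mul, RCLike.enorm_conj]
    have e : ∀ l : ℤ, ∫⁻ x : ℝ, ‖(janssenCoeff n (T ^ 2 / 2) (1 / (2 * α ^ 2)) (d, l) : ℂ)‖ₑ *
        (‖f x‖ₑ * (‖Complex.exp (2 * Real.pi * Complex.I * l * x / α)‖ₑ * ‖f (x + d * T)‖ₑ))
        ≤ ENNReal.ofReal (Real.exp (-Real.pi * (l : ℝ) ^ 2 * (1 / (2 * α ^ 2)))) *
          (2 * ∫⁻ x, ‖f x‖ₑ ^ 2) := by
      intro l
      have h1 : ∀ x : ℝ, ‖Complex.exp (2 * Real.pi * Complex.I * l * x / α)‖ₑ = 1 := fun x => by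
        rw [← ofReal_norm, norm_phase, ENNReal.ofReal_one]
      simp only [h1, one_mul]
      have hmm : Measurable fun x => ‖f x‖ₑ * ‖f (x + d * T)‖ₑ := hm.enorm.mul hmf.enorm
      rw [lintegral_const_mul _ hmm]
      gcongr
      · rw [← ofReal_norm, Complex.norm_real, Real.norm_eq_abs, abs_janssenCoeff]
        refine ENNReal.ofReal_le_ofReal (mul_le_of_le_one_left (Real.exp_pos _).le ?_)
        rw [Real.exp_le_one_iff]
        nlinarith [Real.pi_pos, mul_nonneg Real.pi_pos.le (mul_nonneg (sq_nonneg (d : ℝ)) (sq_nonneg T))]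
      · exact lintegral_enorm_mul_comp_add_le hm _
    refine ne_top_of_le_ne_top ?_ (ENNReal.tsum_le_tsum e)
    rw [ENNReal.tsum_mul_right]
    exact ENNReal.mul_ne_top (summable_exp_neg_int_sq ht).tsum_ofReal_ne_top
      (ENNReal.mul_ne_top (by norm_num) (MemLp.lintegral_enorm_sq_ne_top hf))

theorem gaborSum_separableLattice {α β : ℝ} (hα : 0 < α) (hβ : 0 < β) (g f : ℝ → ℂ) :
    gaborSum g (separableLattice α β) f
      = ∑' k : ℤ, ∑' l : ℤ, ‖innerL2 f (timeFreqShift (α * k, β * l) g)‖ₑ ^ 2 := by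
  have hinj : Function.Injective fun p : ℤ × ℤ => ((α * p.1, β * p.2) : ℝ × ℝ) := by
    rintro ⟨k, l⟩ ⟨k', l'⟩ h
    simp only [Prod.mk.injEq, mul_eq_mul_left_iff, hα.ne', hβ.ne', or_false, Int.cast_inj] at h
    exact Prod.ext h.1 h.2
  have hr : separableLattice α β = Set.range fun p : ℤ × ℤ => ((α * p.1, β * p.2) : ℝ × ℝ) := by
    ext p
    simp only [separableLattice, Set.mem_ofPred_eq, Set.mem_range, Prod.exists, eq_comm]
  rw [gaborSum, hr, tsum_range (fun p => ‖innerL2 f (timeFreqShift p g)‖ₑ ^ 2) hinj,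
    ENNReal.tsum_prod']

/-- Janssen's representation of the frame sum of the Gaussian for integer redundancy, for
measurable functions. -/
theorem gaborSum_gaussian_of_measurable {n : ℕ} {α β : ℝ} (hα : 0 < α) (hβ : 0 < β)
    (hαβ : (α * β)⁻¹ = n) {f : ℝ → ℂ} (hm : Measurable f) (hf : MemLp f 2 volume) :
    gaborSum gaussianWindow (separableLattice α β) f = ENNReal.ofReal (n *
      ∑' p, janssenCoeff n (1 / (2 * β ^ 2)) (1 / (2 * α ^ 2)) p * (crossCorr f (1 / β) α p).re) := by
  set T := 1 / β with hTdef
  have hT : 0 < T := by positivity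
  have hTn : T = n * α := by rw [← hαβ, hTdef]; field_simp
  have hfin := tsum_lintegral_gaussian_ne_top hα hT hm hf
  have hmg : ∀ k : ℤ, Measurable fun x => f x * realGaussian (x - α * k) := fun k =>
    hm.mul (Complex.measurable_ofReal.comp (measurable_realGaussian.comp (measurable_id.sub_const _)))
  have hig : ∀ k : ℤ, Integrable fun x => f x * realGaussian (x - α * k) := fun k =>
    hf.integrable_mul (memLp_realGaussian.comp_measurePreserving
      (measurePreserving_sub_right volume (α * k)))
  -- For a fixed time shift the sum over modulations is Parseval's identity for `f` times the
  -- translated window.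
  have hk : ∀ k : ℤ, ∑' l : ℤ, ‖innerL2 f (timeFreqShift (α * k, β * l) gaussianWindow)‖ₑ ^ 2
      = ENNReal.ofReal (T * (∑' d : ℤ, ∫ x, f x * realGaussian (x - α * k) *
      conj (f (x + d * T) * realGaussian (x + d * T - α * k))).re) ∧
      0 ≤ T * (∑' d : ℤ, ∫ x, f x * realGaussian (x - α * k) *
      conj (f (x + d * T) * realGaussian (x + d * T - α * k))).re := by
    intro k
    have hs := hasSum_sq_norm_fourier_samples hT (hmg k) (hig k)
      (ENNReal.ne_top_of_tsum_ne_top hfin k)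
    refine ⟨?_, hs.nonneg fun l => sq_nonneg _⟩
    rw [← hs.tsum_eq, ENNReal.ofReal_tsum_of_nonneg (fun l => sq_nonneg _) hs.summable]
    refine tsum_congr fun l => ?_
    rw [ENNReal.ofReal_pow (norm_nonneg _), ofReal_norm]
    congr 2
    refine integral_congr_ae (Filter.Eventually.of_forall fun x => ?_)
    simp only [timeFreqShift, gaussianWindow_eq, map_mul, Complex.conj_ofReal, ← Complex.exp_conj,
      map_ofNat, Complex.conj_I]
    have : (T : ℂ) = 1 / β := by rw [hTdef]; push_cast; rfl
    have hβ' : (β : ℂ) ≠ 0 := by exact_mod_cast hβ.ne'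
    rw [this, mul_comm (Complex.exp _), ← mul_assoc]
    congr 2
    push_cast
    field_simp
  have hA : Summable fun q : ℤ × ℤ => ∫ x, f x * realGaussian (x - α * q.1) *
      conj (f (x + q.2 * T) * realGaussian (x + q.2 * T - α * q.1)) := by
    refine Summable.of_norm ?_
    have hfin' : ∑' q : ℤ × ℤ, ∫⁻ x, ‖f x * realGaussian (x - α * q.1)‖ₑ *
      ‖f (x + q.2 * T) * realGaussian (x + q.2 * T - α * q.1)‖ₑ ≠ ∞ := by
      rwa [ENNReal.tsum_prod']
    refine Summable.of_nonneg_of_le (fun _ => norm_nonneg _) (fun q => ?_)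
      (ENNReal.summable_toReal hfin')
    rw [← toReal_enorm]
    refine ENNReal.toReal_mono (ENNReal.ne_top_of_tsum_ne_top hfin' q) ?_
    refine (enorm_integral_le_lintegral_enorm _).trans (le_of_eq ?_)
    simp only [enorm_mul, RCLike.enorm_conj]
  rw [gaborSum_separableLattice hα hβ]
  simp_rw [fun k => (hk k).1]
  have hsk : Summable fun k : ℤ => T * (∑' d : ℤ, ∫ x, f x * realGaussian (x - α * k) *
      conj (f (x + d * T) * realGaussian (x + d * T - α * k))).re :=
    (Complex.hasSum_re hA.prod.hasSum).summable.mul_left T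
  rw [← ENNReal.ofReal_tsum_of_nonneg (fun k => (hk k).2) hsk, tsum_mul_left,
    ← Complex.re_tsum hA.prod, ← Summable.tsum_comm (f := fun k d : ℤ =>
      ∫ x, f x * realGaussian (x - α * k) *
        conj (f (x + d * T) * realGaussian (x + d * T - α * k))) hA]
  have hfin2 : ∀ d : ℤ, ∑' k : ℤ, ∫⁻ x, ‖f x * realGaussian (x - α * k)‖ₑ *
      ‖f (x + d * T) * realGaussian (x + d * T - α * k)‖ₑ ≠ ∞ := by
    rw [ENNReal.tsum_comm] at hfin
    exact ENNReal.ne_top_of_tsum_ne_top hfin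
  simp_rw [fun d => tsum_integral_gaussian hα hTn hm hf d (hfin2 d)]
  have hsum := summable_janssenCoeff_mul_crossCorr n (show 0 < T ^ 2 / 2 by positivity)
    (show 0 < 1 / (2 * α ^ 2) by positivity) hf T α
  rw [tsum_mul_left, ← hsum.tsum_prod]
  have hs2 : T ^ 2 / 2 = 1 / (2 * β ^ 2) := by rw [hTdef]; field_simp
  rw [hs2] at hsum ⊢
  have hre : (∑' p, (janssenCoeff n (1 / (2 * β ^ 2)) (1 / (2 * α ^ 2)) p : ℂ) * crossCorr f T α p).re
      = ∑' p, janssenCoeff n (1 / (2 * β ^ 2)) (1 / (2 * α ^ 2)) p * (crossCorr f T α p).re := by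
    rw [Complex.re_tsum hsum]
    exact tsum_congr fun p => Complex.re_ofReal_mul _ _
  -- The factor `T` from Parseval and `1/α` from Poisson summation combine to `T/α = n`.
  have hcast : (1 / α : ℂ) = ((1 / α : ℝ) : ℂ) := by push_cast; rfl
  rw [hcast, Complex.re_ofReal_mul, hre, ← mul_assoc, hTn]
  congr 2
  field_simp

/-! ### Theta constants as sums over `ℤ` -/

theorem hasSum_int_of_even {f : ℤ → ℝ} (hf : ∀ k, f (-k) = f k) {m : ℝ}
    (h : HasSum (fun k : ℕ => f (k + 1)) m) : HasSum f (f 0 + 2 * m) := by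
  have h2 : HasSum (fun k : ℕ => f (-(k + 1))) m := by simpa only [hf] using h
  have := h.of_add_one_of_neg_add_one h2
  rwa [show m + f 0 + m = f 0 + 2 * m by ring] at this

theorem hasSum_theta3 {s : ℝ} (hs : 0 < s) :
    HasSum (fun k : ℤ => Real.exp (-Real.pi * (k : ℝ) ^ 2 * s)) (theta3 s) := by
  have h := (summable_mul_pow_mul_exp_neg abs_one_le le_sqExponent 0 hs).hasSum
  have := hasSum_int_of_even (f := fun k : ℤ => Real.exp (-Real.pi * (k : ℝ) ^ 2 * s))
    (fun k => by push_cast; rw [neg_sq]) (m := expSeries (fun _ => 1) sqExponent 0 s)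
    (by
      convert! h using 2 with k
      simp [sqExponent])
  simpa [theta3] using this

theorem hasSum_theta4 {s : ℝ} (hs : 0 < s) :
    HasSum (fun k : ℤ => (-1 : ℝ) ^ k * Real.exp (-Real.pi * (k : ℝ) ^ 2 * s)) (theta4 s) := by
  have h := (summable_mul_pow_mul_exp_neg abs_neg_one_pow_le le_sqExponent 0 hs).hasSum.neg
  have := hasSum_int_of_even
    (f := fun k : ℤ => (-1 : ℝ) ^ k * Real.exp (-Real.pi * (k : ℝ) ^ 2 * s))
    (fun k => by push_cast; rw [neg_sq, zpow_neg, ← inv_zpow]; norm_num)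
    (m := -expSeries (fun k => (-1) ^ k) sqExponent 0 s)
    (by
      convert! h using 2 with k
      have : ((-1 : ℝ)) ^ ((k : ℤ) + 1) = -(-1) ^ k := by
        rw [zpow_add_one₀ (by norm_num), zpow_natCast]; ring
      rw [this]
      simp [sqExponent])
  simpa [theta4] using this

theorem hasSum_sq_mul_exp {s : ℝ} (hs : 0 < s) :
    HasSum (fun k : ℤ => (k : ℝ) ^ 2 * Real.exp (-Real.pi * (k : ℝ) ^ 2 * s))
      (2 * (Real.pi⁻¹ * expSeries (fun _ => 1) sqExponent 1 s)) := by
  have h := (summable_mul_pow_mul_exp_neg abs_one_le le_sqExponent 1 hs).hasSum.mul_left Real.pi⁻¹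
  have := hasSum_int_of_even
    (f := fun k : ℤ => (k : ℝ) ^ 2 * Real.exp (-Real.pi * (k : ℝ) ^ 2 * s))
    (fun k => by push_cast; rw [neg_sq]) (m := Real.pi⁻¹ * expSeries (fun _ => 1) sqExponent 1 s)
    (by
      convert! h using 2 with k
      have := Real.pi_pos.ne'
      rw [sqExponent, pow_one, one_mul, ← mul_assoc, ← mul_assoc, inv_mul_cancel₀ this]
      push_cast
      congr 2
      · ring
      · ring)
  simpa using this

/-- Only odd indices survive in the difference, and `(2j+1)² = 4(j + 1/2)²`. -/
theorem theta3_sub_theta4 {s : ℝ} (hs : 0 < s) : theta3 s - theta4 s = 2 * theta2 (4 * s) := by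
  have h1 := (summable_mul_pow_mul_exp_neg abs_one_le le_sqExponent 0 hs).hasSum
  have h2 := (summable_mul_pow_mul_exp_neg abs_neg_one_pow_le le_sqExponent 0 hs).hasSum
  have h3 := (summable_mul_pow_mul_exp_neg abs_one_le le_halfSqExponent 0
    (show 0 < 4 * s by linarith)).hasSum.mul_left 2
  have h4 : HasSum (fun k : ℕ => (1 * (sqExponent k ^ 0 * Real.exp (-(sqExponent k * s)))
      + (-1) ^ k * (sqExponent k ^ 0 * Real.exp (-(sqExponent k * s)))))
      (2 * expSeries (fun _ => 1) halfSqExponent 0 (4 * s) + 0) := by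
    refine HasSum.even_add_odd ?_ ?_
    · convert! h3 using 2 with k
      rw [halfSqExponent_four_mul, sqExponent]
      push_cast
      rw [pow_mul]
      norm_num
      ring_nf
    · have h0 : HasSum (fun _ : ℕ => (0 : ℝ)) 0 := hasSum_zero
      convert! h0 using 2 with k
      rw [pow_succ, pow_mul]
      norm_num
  have h5 := (h1.add h2).unique h4
  change expSeries (fun _ => 1) sqExponent 0 s + expSeries (fun k => (-1) ^ k) sqExponent 0 s
    = _ at h5
  rw [theta3, theta4, theta2]
  linarith

/-! ### Shift defects -/

/-- The `L²`-distance of `f` from its time-frequency shift with sign `ς ^ (p₁ + p₂)`. -/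
noncomputable def shiftDefect (f : ℝ → ℂ) (ς T α : ℝ) (p : ℤ × ℤ) : ℝ :=
  ∫ x, ‖f x - ((ς ^ (p.1 + p.2) : ℝ) : ℂ) *
    (Complex.exp (2 * Real.pi * Complex.I * p.2 * x / α) * f (x + p.1 * T))‖ ^ 2

theorem shiftDefect_nonneg (f : ℝ → ℂ) (ς T α : ℝ) (p : ℤ × ℤ) : 0 ≤ shiftDefect f ς T α p :=
  integral_nonneg fun _ => sq_nonneg _

theorem memLp_shift {f : ℝ → ℂ} (hf : MemLp f 2 volume) (c : ℂ) (T α : ℝ) (p : ℤ × ℤ) :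
    MemLp (fun x : ℝ => c * (Complex.exp (2 * Real.pi * Complex.I * p.2 * x / α) * f (x + p.1 * T)))
      2 volume := by
  have h : MemLp (fun x => f (x + p.1 * T)) 2 volume :=
    hf.comp_measurePreserving (measurePreserving_add_right volume _)
  refine MemLp.const_mul (h.of_le ?_ (Filter.Eventually.of_forall fun x => ?_)) c
  · refine AEStronglyMeasurable.mul ?_ h.1
    exact Measurable.aestronglyMeasurable (by fun_prop)
  · rw [norm_mul, norm_phase, one_mul]

theorem integrable_shiftDefect {f : ℝ → ℂ} (hf : MemLp f 2 volume) (c : ℂ) (T α : ℝ) (p : ℤ × ℤ) :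
    Integrable fun x : ℝ => ‖f x - c *
      (Complex.exp (2 * Real.pi * Complex.I * p.2 * x / α) * f (x + p.1 * T))‖ ^ 2 :=
  have h := hf.sub (memLp_shift hf c T α p)
  (memLp_two_iff_integrable_sq_norm h.1).1 h

theorem abs_zpow_of_abs_eq_one {ς : ℝ} (hς : |ς| = 1) (k : ℤ) : |ς ^ k| = 1 := by
  rw [abs_zpow, hς, one_zpow]

/-- Expansion of the squared distance, the shift being an isometry. It expresses the deviation of
each correlation from its value at a character by a nonnegative quantity. -/
theorem zpow_mul_re_crossCorr {f : ℝ → ℂ} (hf : MemLp f 2 volume) {ς : ℝ} (hς : |ς| = 1) (T α : ℝ)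
    (p : ℤ × ℤ) : ς ^ (p.1 + p.2) * (crossCorr f T α p).re
      = (∫ x, ‖f x‖ ^ 2) - shiftDefect f ς T α p / 2 := by
  have hsq := (memLp_two_iff_integrable_sq_norm hf.1).1 hf
  set e := ς ^ (p.1 + p.2) with he
  have hsq' : Integrable fun x => ‖f (x + p.1 * T)‖ ^ 2 := hsq.comp_add_right _
  have hJ : Integrable fun x : ℝ =>
      f x * conj (Complex.exp (2 * Real.pi * Complex.I * p.2 * x / α) * f (x + p.1 * T)) := by
    have h2 := memLp_shift hf 1 T α p
    simp only [one_mul] at h2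
    have h3 : MemLp (fun x : ℝ =>
        conj (Complex.exp (2 * Real.pi * Complex.I * p.2 * x / α) * f (x + p.1 * T))) 2 volume := h2.star
    exact hf.integrable_mul h3
  have hpt : ∀ x : ℝ, ‖f x - (e : ℂ) *
      (Complex.exp (2 * Real.pi * Complex.I * p.2 * x / α) * f (x + p.1 * T))‖ ^ 2
      = (‖f x‖ ^ 2 + ‖f (x + p.1 * T)‖ ^ 2) - 2 * (e * (f x *
        conj (Complex.exp (2 * Real.pi * Complex.I * p.2 * x / α) * f (x + p.1 * T))).re) := by
    intro x
    have h1 := Complex.normSq_sub (f x) ((e : ℂ) *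
      (Complex.exp (2 * Real.pi * Complex.I * p.2 * x / α) * f (x + p.1 * T)))
    simp only [← Complex.sq_norm] at h1
    rw [h1, norm_mul, norm_mul, norm_phase, Complex.norm_real, Real.norm_eq_abs, he,
      abs_zpow_of_abs_eq_one hς, one_mul, one_mul, ← he, map_mul, Complex.conj_ofReal,
      mul_left_comm (f x), Complex.re_ofReal_mul]
  rw [shiftDefect]
  simp_rw [← he, hpt]
  have i1 : Integrable fun x => ‖f x‖ ^ 2 + ‖f (x + p.1 * T)‖ ^ 2 := hsq.add hsq'
  have i2 : Integrable fun x : ℝ => 2 * (e * (f x *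
      conj (Complex.exp (2 * Real.pi * Complex.I * p.2 * x / α) * f (x + p.1 * T))).re) :=
    (hJ.re.const_mul e).const_mul 2
  rw [integral_sub i1 i2, integral_add hsq hsq',
    integral_add_right_eq_self (fun x => ‖f x‖ ^ 2), integral_const_mul, integral_const_mul, crossCorr]
  have : ∫ x, (f x * conj (Complex.exp (2 * Real.pi * Complex.I * p.2 * x / α) *
      f (x + p.1 * T))).re = (∫ x, f x * conj (Complex.exp (2 * Real.pi * Complex.I * p.2 * x / α) *
      f (x + p.1 * T))).re := integral_re hJ
  rw [this]
  ring

theorem shiftDefect_neg {f : ℝ → ℂ} {ς : ℝ} (hς : |ς| = 1) (T α : ℝ)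
    (d : ℤ) : shiftDefect f ς T α (-d, 0) = shiftDefect f ς T α (d, 0) := by
  have hς0 : ς ≠ 0 := by rintro rfl; simp at hς
  rw [shiftDefect, ← integral_add_right_eq_self _ (d * T), shiftDefect]
  refine integral_congr_ae (Filter.Eventually.of_forall fun x => ?_)
  simp only [Int.cast_zero, mul_zero, zero_mul, zero_div, Complex.exp_zero, one_mul, add_zero]
  have h1 : x + d * T + ((-d : ℤ) : ℝ) * T = x := by push_cast; ring
  have h2 : f (x + d * T) - ((ς ^ (-d) : ℝ) : ℂ) * f x
      = -(((ς ^ (-d) : ℝ) : ℂ) * (f x - ((ς ^ d : ℝ) : ℂ) * f (x + d * T))) := by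
    have : ((ς ^ (-d) : ℝ) : ℂ) * ((ς ^ d : ℝ) : ℂ) = 1 := by
      rw [← Complex.ofReal_mul, ← zpow_add₀ hς0]; simp
    linear_combination (-f (x + d * T)) * this
  rw [h1, h2, norm_neg, norm_mul, Complex.norm_real, Real.norm_eq_abs, abs_zpow_of_abs_eq_one hς,
    one_mul]

/-- The `d`-step difference telescopes into `d` translates of the one-step difference;
Cauchy–Schwarz then produces the factor `d²`. -/
theorem shiftDefect_nat_le {f : ℝ → ℂ} (hf : MemLp f 2 volume) {ς : ℝ} (hς : |ς| = 1) (T α : ℝ)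
    (d : ℕ) : shiftDefect f ς T α (d, 0) ≤ (d : ℝ) ^ 2 * shiftDefect f ς T α (1, 0) := by
  set F : ℝ → ℝ := fun x => ‖f x - (ς : ℂ) * f (x + T)‖ ^ 2 with hF
  have e1 : shiftDefect f ς T α (1, 0) = ∫ x, F x := by simp [shiftDefect, hF]
  have hFi : Integrable F := by
    have := integrable_shiftDefect hf ς T α (1, 0)
    simpa [hF] using this
  have hpt : ∀ x : ℝ, ‖f x - ((ς ^ d : ℝ) : ℂ) * f (x + d * T)‖ ^ 2
      ≤ d * ∑ i ∈ Finset.range d, F (x + i * T) := by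
    intro x
    have htel := Finset.sum_range_sub' (fun i : ℕ => ((ς ^ i : ℝ) : ℂ) * f (x + i * T)) d
    simp only [pow_zero, Complex.ofReal_one, one_mul, Nat.cast_zero, zero_mul, add_zero] at htel
    rw [← htel]
    calc _ ≤ (∑ i ∈ Finset.range d, ‖f (x + i * T) - (ς : ℂ) * f (x + i * T + T)‖) ^ 2 := by
          gcongr
          refine (norm_sum_le _ _).trans (le_of_eq (Finset.sum_congr rfl fun i _ => ?_))
          have : ((ς ^ i : ℝ) : ℂ) * f (x + i * T) - ((ς ^ (i + 1) : ℝ) : ℂ) * f (x + (i + 1 : ℕ) * T)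
              = ((ς ^ i : ℝ) : ℂ) * (f (x + i * T) - (ς : ℂ) * f (x + i * T + T)) := by
            rw [show x + ((i + 1 : ℕ) : ℝ) * T = x + i * T + T by push_cast; ring]
            push_cast; ring
          rw [this, norm_mul, Complex.norm_real, Real.norm_eq_abs, abs_pow, hς, one_pow, one_mul]
      _ ≤ _ := by
          have := sq_sum_le_card_mul_sum_sq (s := Finset.range d)
            (f := fun i : ℕ => ‖f (x + i * T) - (ς : ℂ) * f (x + i * T + T)‖)
          rwa [Finset.card_range] at this
  have hL : shiftDefect f ς T α (d, 0) = ∫ x, ‖f x - ((ς ^ d : ℝ) : ℂ) * f (x + d * T)‖ ^ 2 := by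
    simp [shiftDefect]
  have hLi : Integrable fun x => ‖f x - ((ς ^ d : ℝ) : ℂ) * f (x + d * T)‖ ^ 2 := by
    have := integrable_shiftDefect hf ((ς ^ d : ℝ) : ℂ) T α (d, 0)
    simpa using this
  rw [hL, e1]
  calc _ ≤ ∫ x, d * ∑ i ∈ Finset.range d, F (x + i * T) :=
        integral_mono hLi ((integrable_finsetSum _ fun i _ => hFi.comp_add_right _).const_mul _) hpt
    _ = (d : ℝ) ^ 2 * ∫ x, F x := by
        rw [integral_const_mul, integral_finsetSum _ fun i _ => hFi.comp_add_right _]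
        simp only [integral_add_right_eq_self, Finset.sum_const, Finset.card_range, nsmul_eq_mul]
        ring

theorem shiftDefect_left_le {f : ℝ → ℂ} (hf : MemLp f 2 volume) {ς : ℝ} (hς : |ς| = 1) (T α : ℝ)
    (d : ℤ) : shiftDefect f ς T α (d, 0) ≤ (d : ℝ) ^ 2 * shiftDefect f ς T α (1, 0) := by
  obtain ⟨m, rfl | rfl⟩ := d.eq_nat_or_neg
  · exact_mod_cast shiftDefect_nat_le hf hς T α m
  · rw [shiftDefect_neg hς]
    push_cast
    rw [neg_sq]
    exact shiftDefect_nat_le hf hς T α m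

theorem norm_one_sub_zpow_le {z : ℂ} (hz : ‖z‖ = 1) (l : ℤ) :
    ‖1 - z ^ l‖ ≤ |(l : ℝ)| * ‖1 - z‖ := by
  have hnat : ∀ m : ℕ, ‖1 - z ^ m‖ ≤ m * ‖1 - z‖ := by
    intro m
    induction m with
    | zero => simp
    | succ m ih =>
      have : 1 - z ^ (m + 1) = (1 - z ^ m) + z ^ m * (1 - z) := by ring
      rw [this]
      refine (norm_add_le _ _).trans ?_
      rw [norm_mul, norm_pow, hz, one_pow, one_mul]
      push_cast
      linarith
  have hz0 : z ≠ 0 := by rintro rfl; simp at hz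
  obtain ⟨m, rfl | rfl⟩ := l.eq_nat_or_neg
  · simpa using hnat m
  · have h : 1 - z ^ (-(m : ℤ)) = -(z ^ (-(m : ℤ)) * (1 - z ^ m)) := by
      rw [zpow_neg, zpow_natCast]
      field_simp
      ring
    rw [h, norm_neg, norm_mul, norm_zpow, hz, one_zpow, one_mul]
    simpa using hnat m

/-- Modulations act pointwise, by a unimodular number `z`, and `|1 - zˡ| ≤ |l||1 - z|`. -/
theorem shiftDefect_right_le {f : ℝ → ℂ} (hf : MemLp f 2 volume) {ς : ℝ} (hς : |ς| = 1) (T α : ℝ)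
    (l : ℤ) : shiftDefect f ς T α (0, l) ≤ (l : ℝ) ^ 2 * shiftDefect f ς T α (0, 1) := by
  rw [shiftDefect, shiftDefect, ← integral_const_mul]
  refine integral_mono (integrable_shiftDefect hf _ T α (0, l))
    ((integrable_shiftDefect hf _ T α (0, 1)).const_mul _) fun x => ?_
  simp only [zero_add, Int.cast_zero, zero_mul, add_zero, zpow_one, Int.cast_one, mul_one]
  set z : ℂ := ς * Complex.exp (2 * Real.pi * Complex.I * x / α) with hz
  have hz1 : ‖z‖ = 1 := by
    have := norm_phase x 1 α
    simp only [Int.cast_one, mul_one] at this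
    rw [hz, norm_mul, this, Complex.norm_real, Real.norm_eq_abs, hς, one_mul]
  have e1 : f x - ((ς ^ l : ℝ) : ℂ) * (Complex.exp (2 * Real.pi * Complex.I * l * x / α) * f x)
      = (1 - z ^ l) * f x := by
    rw [hz, mul_zpow, ← Complex.exp_int_mul]
    push_cast
    rw [show (2 * Real.pi * Complex.I * l * x / α : ℂ) = l * (2 * Real.pi * Complex.I * x / α) by ring]
    ring
  have e2 : f x - (ς : ℂ) * (Complex.exp (2 * Real.pi * Complex.I * x / α) * f x)
      = (1 - z) * f x := by rw [hz]; ring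
  rw [e1, e2, norm_mul, norm_mul, mul_pow, mul_pow, ← mul_assoc]
  gcongr
  rw [← sq_abs (l : ℝ), ← mul_pow]
  gcongr
  exact norm_one_sub_zpow_le hz1 l

theorem shiftDefect_le {f : ℝ → ℂ} (hf : MemLp f 2 volume) {ς : ℝ} (hς : |ς| = 1) (T α : ℝ)
    (p : ℤ × ℤ) : shiftDefect f ς T α p ≤
      2 * ((p.1 : ℝ) ^ 2 * shiftDefect f ς T α (1, 0) + (p.2 : ℝ) ^ 2 * shiftDefect f ς T α (0, 1)) := by
  have hς0 : ς ≠ 0 := by rintro rfl; simp at hς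
  obtain ⟨d, l⟩ := p
  have h1 := shiftDefect_left_le hf hς T α d
  have h2 := shiftDefect_right_le hf hς T α l
  suffices h : shiftDefect f ς T α (d, l)
      ≤ 2 * (shiftDefect f ς T α (d, 0) + shiftDefect f ς T α (0, l)) by
    simp only; linarith
  have i1 := integrable_shiftDefect hf ((ς ^ (d + 0) : ℝ) : ℂ) T α (d, 0)
  have i2 := integrable_shiftDefect hf ((ς ^ (0 + l) : ℝ) : ℂ) T α (0, l)
  rw [shiftDefect, shiftDefect, shiftDefect, ← integral_add i1 i2, ← integral_const_mul]
  refine integral_mono (integrable_shiftDefect hf _ T α (d, l)) ((i1.add i2).const_mul 2)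
    fun x => ?_
  simp only [zero_add, add_zero, Int.cast_zero, mul_zero, zero_mul, zero_div,
    Complex.exp_zero, one_mul]
  have e : f x - ((ς ^ (d + l) : ℝ) : ℂ) *
      (Complex.exp (2 * Real.pi * Complex.I * l * x / α) * f (x + d * T))
      = ((ς ^ l : ℝ) : ℂ) * Complex.exp (2 * Real.pi * Complex.I * l * x / α) *
        (f x - ((ς ^ d : ℝ) : ℂ) * f (x + d * T))
      + (f x - ((ς ^ l : ℝ) : ℂ) * (Complex.exp (2 * Real.pi * Complex.I * l * x / α) * f x)) := by
    rw [zpow_add₀ hς0]; push_cast; ring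
  rw [e]
  set a := f x - ((ς ^ d : ℝ) : ℂ) * f (x + d * T)
  set b := f x - ((ς ^ l : ℝ) : ℂ) * (Complex.exp (2 * Real.pi * Complex.I * l * x / α) * f x)
  have hn := norm_add_le (((ς ^ l : ℝ) : ℂ) * Complex.exp (2 * Real.pi * Complex.I * l * x / α) * a) b
  rw [norm_mul, norm_mul, norm_phase, Complex.norm_real, Real.norm_eq_abs,
    abs_zpow_of_abs_eq_one hς, one_mul, one_mul] at hn
  calc _ ≤ (‖a‖ + ‖b‖) ^ 2 := by gcongr
    _ ≤ _ := by nlinarith [sq_nonneg (‖a‖ - ‖b‖)]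

theorem shiftDefect_zero_neg_one {f : ℝ → ℂ} {ς : ℝ} (hς : |ς| = 1) (T α : ℝ) :
    shiftDefect f ς T α (0, -1) = shiftDefect f ς T α (0, 1) := by
  rw [shiftDefect, shiftDefect]
  refine integral_congr_ae (Filter.Eventually.of_forall fun x => ?_)
  simp only [zero_add, Int.cast_zero, zero_mul, add_zero, zpow_one, Int.cast_one, mul_one]
  set z : ℂ := ς * Complex.exp (2 * Real.pi * Complex.I * x / α) with hz
  have hz1 : ‖z‖ = 1 := by
    have := norm_phase x 1 α
    simp only [Int.cast_one, mul_one] at this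
    rw [hz, norm_mul, this, Complex.norm_real, Real.norm_eq_abs, hς, one_mul]
  have hz0 : z ≠ 0 := by intro h; simp [h] at hz1
  have e1 : f x - ((ς ^ (-1 : ℤ) : ℝ) : ℂ) *
      (Complex.exp (2 * Real.pi * Complex.I * (-1 : ℤ) * x / α) * f x) = -(z⁻¹ * (f x - z * f x)) := by
    have h1 : ((ς ^ (-1 : ℤ) : ℝ) : ℂ) * Complex.exp (2 * Real.pi * Complex.I * (-1 : ℤ) * x / α)
        = z⁻¹ := by
      rw [hz, mul_inv, ← Complex.exp_neg, zpow_neg_one, Complex.ofReal_inv]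
      congr 2
      push_cast
      ring
    rw [← mul_assoc, h1]
    field_simp
    ring
  rw [e1, ← mul_assoc (ς : ℂ), ← hz, norm_neg, norm_mul, norm_inv, hz1, inv_one, one_mul]

/-! ### The symbol at the two characters -/

theorem hasSum_prod_mul {f g : ℤ → ℝ} {a b : ℝ} (hf : HasSum f a) (hg : HasSum g b) :
    HasSum (fun p : ℤ × ℤ => f p.1 * g p.2) (a * b) :=
  hf.mul hg (summable_mul_of_summable_norm hf.summable.norm hg.summable.norm)

/-- The samples at the integers of a Gaussian. -/
noncomputable def gaussSample (s : ℝ) (k : ℤ) : ℝ := Real.exp (-Real.pi * (k : ℝ) ^ 2 * s)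

theorem gaussSample_pos (s : ℝ) (k : ℤ) : 0 < gaussSample s k := Real.exp_pos _

theorem janssenCoeff_eq (n : ℕ) (s t : ℝ) (p : ℤ × ℤ) : janssenCoeff n s t p =
    (-1) ^ ((n : ℤ) * p.1 * p.2) * (gaussSample s p.1 * gaussSample t p.2) := rfl

theorem hasSum_indicator_odd {s : ℝ} (hs : 0 < s) :
    HasSum (fun k : ℤ => if Odd k then gaussSample s k else 0) (theta2 (4 * s)) := by
  have h := ((hasSum_theta3 hs).sub (hasSum_theta4 hs)).mul_left (1 / 2)
  rw [theta3_sub_theta4 hs] at h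
  convert! h using 1
  · funext k
    split_ifs with hk
    · rw [hk.neg_one_zpow, gaussSample]; ring
    · rw [(Int.not_odd_iff_even.1 hk).neg_one_zpow]; ring
  · ring

theorem zpow_mul_indicator_odd {ς : ℝ} (hς : |ς| = 1) (x : ℝ) (k : ℤ) :
    ς ^ k * (if Odd k then x else 0) = ς * (if Odd k then x else 0) := by
  split_ifs with hk
  · rcases (abs_eq zero_le_one).1 hς with rfl | rfl
    · simp
    · rw [hk.neg_one_zpow]
  · simp

theorem zpow_mul_self_of_abs_eq_one {ς : ℝ} (hς : |ς| = 1) (k : ℤ) : ς ^ k * ς ^ k = 1 := by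
  rw [← abs_mul_abs_self, abs_zpow_of_abs_eq_one hς, one_mul]

theorem hasSum_zpow_mul_janssenCoeff_of_even {n : ℕ} (hn : Even n) {ς s t a b : ℝ} (hς : |ς| = 1)
    (ha : HasSum (fun k : ℤ => ς ^ k * gaussSample s k) a)
    (hb : HasSum (fun k : ℤ => ς ^ k * gaussSample t k) b) :
    HasSum (fun p : ℤ × ℤ => ς ^ (p.1 + p.2) * janssenCoeff n s t p) (a * b) := by
  have hς0 : ς ≠ 0 := by rintro rfl; simp at hς
  convert! hasSum_prod_mul ha hb using 1
  funext p
  have : Even ((n : ℤ) * p.1 * p.2) := ((Int.even_coe_nat n).2 hn).mul_right _ |>.mul_right _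
  rw [janssenCoeff_eq, this.neg_one_zpow, zpow_add₀ hς0]
  ring

/-- The sign is `-1` exactly when both indices are odd, so twice the odd-odd part is removed from
the full product. There `ς^(d+l) = 1`, hence the correction does not depend on `ς`. -/
theorem hasSum_zpow_mul_janssenCoeff_of_odd {n : ℕ} (hn : Odd n) {ς s t a b : ℝ} (hς : |ς| = 1)
    (hs : 0 < s) (ht : 0 < t)
    (ha : HasSum (fun k : ℤ => ς ^ k * gaussSample s k) a)
    (hb : HasSum (fun k : ℤ => ς ^ k * gaussSample t k) b) :
    HasSum (fun p : ℤ × ℤ => ς ^ (p.1 + p.2) * janssenCoeff n s t p)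
      (a * b - 2 * (theta2 (4 * s) * theta2 (4 * t))) := by
  have hς0 : ς ≠ 0 := by rintro rfl; simp at hς
  have h1 : ς * ς = 1 := by simpa using zpow_mul_self_of_abs_eq_one hς 1
  convert! (hasSum_prod_mul ha hb).sub
    ((hasSum_prod_mul (hasSum_indicator_odd hs) (hasSum_indicator_odd ht)).mul_left 2) using 1
  funext p
  have h2 : (if Odd p.1 then gaussSample s p.1 else 0) * (if Odd p.2 then gaussSample t p.2 else 0)
      = (ς ^ p.1 * if Odd p.1 then gaussSample s p.1 else 0) *
        (ς ^ p.2 * if Odd p.2 then gaussSample t p.2 else 0) := by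
    rw [zpow_mul_indicator_odd hς, zpow_mul_indicator_odd hς, mul_mul_mul_comm, h1, one_mul]
  rw [h2, janssenCoeff_eq, zpow_add₀ hς0]
  have hn' : Odd (n : ℤ) := (Int.odd_coe_nat n).2 hn
  by_cases hd : Odd p.1 <;> by_cases hl : Odd p.2
  · rw [((hn'.mul hd).mul hl).neg_one_zpow, if_pos hd, if_pos hl]; ring
  · rw [((Int.not_odd_iff_even.1 hl).mul_left _).neg_one_zpow, if_neg hl]; ring
  · rw [(((Int.not_odd_iff_even.1 hd).mul_left _).mul_right _).neg_one_zpow, if_neg hd]; ring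
  · rw [((Int.not_odd_iff_even.1 hl).mul_left _).neg_one_zpow, if_neg hl]; ring

/-- The deviation of Janssen's form from its symbol at a lattice character is a weighted sum of
shift defects. -/
theorem hasSum_mul_shiftDefect {n : ℕ} {ς s t C T α : ℝ} {f : ℝ → ℂ} (hς : |ς| = 1) (hs : 0 < s)
    (ht : 0 < t) (hf : MemLp f 2 volume)
    (hC : HasSum (fun p : ℤ × ℤ => ς ^ (p.1 + p.2) * janssenCoeff n s t p) C) :
    HasSum (fun p : ℤ × ℤ => ς ^ (p.1 + p.2) * janssenCoeff n s t p * (shiftDefect f ς T α p / 2))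
      ((∫ x, ‖f x‖ ^ 2) * C - ∑' p, janssenCoeff n s t p * (crossCorr f T α p).re) := by
  have hsum : Summable fun p => janssenCoeff n s t p * (crossCorr f T α p).re := by
    have := Complex.hasSum_re (summable_janssenCoeff_mul_crossCorr n hs ht hf T α).hasSum
    exact this.summable.congr fun p => Complex.re_ofReal_mul _ _
  convert! (hC.mul_left (∫ x, ‖f x‖ ^ 2)).sub hsum.hasSum using 1
  funext p
  have h1 := zpow_mul_re_crossCorr hf hς T α p
  have h2 := zpow_mul_self_of_abs_eq_one hς (p.1 + p.2)
  linear_combination (janssenCoeff n s t p * ς ^ (p.1 + p.2)) * h1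
    - janssenCoeff n s t p * (crossCorr f T α p).re * h2

/-- The second moment of the integer samples of a Gaussian. -/
noncomputable def gaussMoment (s : ℝ) : ℝ :=
  2 * (Real.pi⁻¹ * expSeries (fun _ => 1) sqExponent 1 s)

theorem hasSum_sq_mul_gaussSample {s : ℝ} (hs : 0 < s) :
    HasSum (fun k : ℤ => (k : ℝ) ^ 2 * gaussSample s k) (gaussMoment s) := hasSum_sq_mul_exp hs

theorem hasSum_gaussSample {s : ℝ} (hs : 0 < s) : HasSum (gaussSample s) (theta3 s) :=
  hasSum_theta3 hs

/-- The defects of the two generators control the whole deviation, with Gaussian second moments as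
constants. Test functions with tiny generator defects therefore nearly attain the symbol. -/
theorem abs_mul_sub_tsum_le {n : ℕ} {ς s t C T α : ℝ} {f : ℝ → ℂ} (hς : |ς| = 1) (hs : 0 < s)
    (ht : 0 < t) (hf : MemLp f 2 volume)
    (hC : HasSum (fun p : ℤ × ℤ => ς ^ (p.1 + p.2) * janssenCoeff n s t p) C) :
    |(∫ x, ‖f x‖ ^ 2) * C - ∑' p, janssenCoeff n s t p * (crossCorr f T α p).re|
      ≤ gaussMoment s * theta3 t * shiftDefect f ς T α (1, 0)
        + theta3 s * gaussMoment t * shiftDefect f ς T α (0, 1) := by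
  have h := hasSum_mul_shiftDefect (T := T) (α := α) hς hs ht hf hC
  have hb := ((hasSum_prod_mul (hasSum_sq_mul_gaussSample hs) (hasSum_gaussSample ht)).mul_right
    (shiftDefect f ς T α (1, 0))).add ((hasSum_prod_mul (hasSum_gaussSample hs)
    (hasSum_sq_mul_gaussSample ht)).mul_right (shiftDefect f ς T α (0, 1)))
  rw [← h.tsum_eq, ← hb.tsum_eq, ← Real.norm_eq_abs]
  refine tsum_of_norm_bounded hb.summable.hasSum fun p => ?_
  have hD := shiftDefect_le hf hς T α p
  have hD0 := shiftDefect_nonneg f ς T α p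
  rw [norm_mul, norm_mul, Real.norm_eq_abs, Real.norm_eq_abs, abs_zpow_of_abs_eq_one hς, one_mul,
    abs_janssenCoeff, Real.norm_of_nonneg (by linarith)]
  change gaussSample s p.1 * gaussSample t p.2 * _ ≤ _
  have hw : 0 ≤ gaussSample s p.1 * gaussSample t p.2 :=
    (mul_pos (gaussSample_pos _ _) (gaussSample_pos _ _)).le
  nlinarith [mul_le_mul_of_nonneg_left hD hw]

/-! ### Extremality of the characters on the square lattice -/

theorem exp_half_pi_gt : 4.6 < Real.exp (Real.pi / 2) := by
  have h1 := Real.exp_one_gt_d9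
  have h2 := Real.quadratic_le_exp_of_nonneg (x := 0.57) (by norm_num)
  have h3 : Real.exp 1 * Real.exp 0.57 ≤ Real.exp (Real.pi / 2) := by
    rw [← Real.exp_add]
    exact Real.exp_le_exp.2 (by linarith [Real.pi_gt_d2])
  nlinarith

theorem gaussSample_one_lt {s : ℝ} (hs : 1 / 2 ≤ s) : gaussSample s 1 < 0.22 := by
  have h : gaussSample s 1 ≤ (Real.exp (Real.pi / 2))⁻¹ := by
    rw [← Real.exp_neg, gaussSample, Real.exp_le_exp]
    push_cast
    nlinarith [Real.pi_pos]
  refine h.trans_lt ((inv_lt_comm₀ (Real.exp_pos _) (by norm_num)).2 ?_)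
  exact lt_trans (by norm_num) exp_half_pi_gt

/-- Geometric domination from `(k+1)² ≥ 1 + 3k`. -/
theorem exp_neg_sqExponent_mul_le {s : ℝ} (hs : 0 < s) (k : ℕ) :
    Real.exp (-(sqExponent k * s)) ≤ gaussSample s 1 * (gaussSample s 1 ^ 3) ^ k := by
  rw [gaussSample, ← pow_mul, ← Real.exp_nat_mul, ← Real.exp_add, Real.exp_le_exp, sqExponent]
  have hk : (k : ℝ) ≤ (k : ℝ) ^ 2 := by exact_mod_cast Nat.le_self_pow two_ne_zero k
  push_cast
  nlinarith [mul_le_mul_of_nonneg_left hk (mul_pos Real.pi_pos hs).le]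

theorem theta3_le_of_half_le {s : ℝ} (hs : 1 / 2 ≤ s) :
    theta3 s ≤ 1 + 2 * (gaussSample s 1 / (1 - gaussSample s 1 ^ 3)) := by
  have hs0 : 0 < s := by linarith
  have hq := gaussSample_one_lt hs
  have hq0 := gaussSample_pos s 1
  rw [theta3, expSeries]
  gcongr
  refine tsum_le_of_le_geometric (fun k => by positivity) (by positivity) ?_ fun k => ?_
  · exact pow_lt_one₀ hq0.le (by linarith) (by norm_num)
  · simpa using exp_neg_sqExponent_mul_le hs0 k

theorem gaussMoment_le_of_half_le {s : ℝ} (hs : 1 / 2 ≤ s) :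
    gaussMoment s ≤ 2 * (gaussSample s 1 / (1 - 4 * gaussSample s 1 ^ 3)) := by
  have hs0 : 0 < s := by linarith
  have hq := gaussSample_one_lt hs
  have hq0 := gaussSample_pos s 1
  have hq3 : gaussSample s 1 ^ 3 < 0.22 ^ 3 := by gcongr
  rw [gaussMoment, expSeries, ← tsum_mul_left]
  gcongr
  refine tsum_le_of_le_geometric (fun k => ?_) (by positivity) (by linarith) fun k => ?_
  · have : 0 ≤ sqExponent k := by unfold sqExponent; positivity
    positivity
  have e : Real.pi⁻¹ * (1 * (sqExponent k ^ 1 * Real.exp (-(sqExponent k * s))))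
      = ((k : ℝ) + 1) ^ 2 * Real.exp (-(sqExponent k * s)) := by
    rw [show sqExponent k ^ 1 = Real.pi * ((k : ℝ) + 1) ^ 2 by rw [pow_one, sqExponent]]
    have := Real.pi_pos.ne'
    field_simp
  have hk : ((k : ℝ) + 1) ^ 2 ≤ 4 ^ k := by
    have : (k + 1 : ℕ) ≤ 2 ^ k := Nat.lt_two_pow_self
    calc ((k : ℝ) + 1) ^ 2 ≤ (2 ^ k) ^ 2 := by gcongr; exact_mod_cast this
      _ = 4 ^ k := by rw [← pow_mul, mul_comm, pow_mul]; norm_num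
  rw [e, mul_pow]
  calc _ ≤ 4 ^ k * (gaussSample s 1 * (gaussSample s 1 ^ 3) ^ k) := by
        gcongr
        exact exp_neg_sqExponent_mul_le hs0 k
    _ = _ := by ring

/-- To leading order in `q = gaussSample s 1` this reads `2q(1 + 2q) ≤ 3q`, that is `q ≤ 1/4`. At `s
= 1/2`, the case `n = 1`, `q = e^{-π/2} ≈ 0.208`, so numerical care is needed. -/
theorem gaussMoment_mul_theta3_le {s : ℝ} (hs : 1 / 2 ≤ s) :
    gaussMoment s * theta3 s ≤ gaussMoment s / 2 + 2 * gaussSample s 1 := by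
  have hs0 : 0 < s := by linarith
  have hq := gaussSample_one_lt hs
  have hq0 := gaussSample_pos s 1
  have h1 := theta3_le_of_half_le hs
  have h2 := gaussMoment_le_of_half_le hs
  have h0 : 0 ≤ gaussMoment s := (hasSum_sq_mul_gaussSample hs0).nonneg fun k =>
    mul_nonneg (sq_nonneg _) (gaussSample_pos _ _).le
  set q := gaussSample s 1
  have hq3 : q ^ 3 < 0.011 := by
    calc q ^ 3 < 0.22 ^ 3 := by gcongr
      _ < 0.011 := by norm_num
  have h3 : q / (1 - q ^ 3) ≤ 0.2225 := by
    rw [div_le_iff₀ (by linarith)]; linarith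
  have h4 : q / (1 - 4 * q ^ 3) * (1 - 4 * q ^ 3) = q := div_mul_cancel₀ _ (by linarith)
  have h5 : 0 ≤ q / (1 - 4 * q ^ 3) := div_nonneg hq0.le (by linarith)
  calc gaussMoment s * theta3 s = gaussMoment s / 2 + gaussMoment s * (theta3 s - 1 / 2) := by ring
    _ ≤ gaussMoment s / 2 + gaussMoment s * (1 - 4 * q ^ 3) :=
        add_le_add le_rfl (mul_le_mul_of_nonneg_left (by linarith) h0)
    _ ≤ gaussMoment s / 2 + 2 * (q / (1 - 4 * q ^ 3)) * (1 - 4 * q ^ 3) := by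
        gcongr; linarith
    _ = _ := by rw [mul_assoc, h4]

theorem hasSum_indicator_zero (x : ℝ) : HasSum (fun k : ℤ => if k = 0 then x else 0) x :=
  hasSum_ite_eq 0 x

theorem hasSum_indicator_abs_one (x : ℝ) :
    HasSum (fun k : ℤ => (if k = 1 then x else 0) + if k = -1 then x else 0) (2 * x) := by
  rw [two_mul]
  exact (hasSum_ite_eq 1 x).add (hasSum_ite_eq (-1) x)

/-- On the square lattice the symbol of the frame operator is extremal at the two lattice
characters. -/
theorem mul_sub_tsum_nonneg {n : ℕ} {ς s C T α : ℝ} {f : ℝ → ℂ} (hς : |ς| = 1) (hs : 1 / 2 ≤ s)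
    (hf : MemLp f 2 volume)
    (hC : HasSum (fun p : ℤ × ℤ => ς ^ (p.1 + p.2) * janssenCoeff n s s p) C) :
    0 ≤ ς * ((∫ x, ‖f x‖ ^ 2) * C - ∑' p, janssenCoeff n s s p * (crossCorr f T α p).re) := by
  have hs0 : 0 < s := by linarith
  have hς1 : ς * ς = 1 := by simpa using zpow_mul_self_of_abs_eq_one hς 1
  have hςi : ς⁻¹ = ς := inv_eq_of_mul_eq_one_left hς1
  have h := (hasSum_mul_shiftDefect (T := T) (α := α) hς hs0 hs0 hf hC).mul_left ς
  set u := shiftDefect f ς T α (1, 0) with hu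
  set v := shiftDefect f ς T α (0, 1) with hv
  have hu0 : 0 ≤ u := shiftDefect_nonneg _ _ _ _ _
  have hv0 : 0 ≤ v := shiftDefect_nonneg _ _ _ _ _
  have hm := hasSum_sq_mul_gaussSample hs0
  have hθ := hasSum_gaussSample hs0
  set q := gaussSample s 1 with hq
  -- A termwise minorant: `b1` is the general bound from `shiftDefect_le`; `b2` gives back half of
  -- it on the axes, where the one-generator bound has no factor 2; `b3` restores the positive sign
  -- at the four nearest neighbours. Its total is `(u + v)(2q + m/2 - mθ₃)`, with `m` the second
  -- moment.
  have b1 := ((hasSum_prod_mul hm hθ).mul_right (-u)).add ((hasSum_prod_mul hθ hm).mul_right (-v))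
  have b2 := (hasSum_prod_mul hm (hasSum_indicator_zero (u / 2))).add
    (hasSum_prod_mul (hasSum_indicator_zero (v / 2)) hm)
  have b3 := (hasSum_prod_mul (hasSum_indicator_abs_one q) (hasSum_indicator_zero u)).add
    (hasSum_prod_mul (hasSum_indicator_zero v) (hasSum_indicator_abs_one q))
  have hb := (b1.add b2).add b3
  refine le_trans ?_ (hasSum_le (fun p => ?_) hb h)
  · nlinarith [mul_le_mul_of_nonneg_right (gaussMoment_mul_theta3_le hs) (add_nonneg hu0 hv0)]
  -- At a nearest neighbour the character equals `ς` (as `ς⁻¹ = ς`), so the outer factor `ς` makes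
  -- its contribution positive.
  have hςq : ∀ x, ς * (ς * q * x) = q * x := fun x => by linear_combination q * x * hς1
  obtain ⟨d, l⟩ := p
  have hD := shiftDefect_le hf hς T α (d, l)
  have hD0 := shiftDefect_nonneg f ς T α (d, l)
  have hw0 : gaussSample s 0 = 1 := by simp [gaussSample]
  have hwn : gaussSample s (-1) = q := by simp [hq, gaussSample]
  have hd := gaussSample_pos s d
  have hl := gaussSample_pos s l
  have hlow : -(gaussSample s d * gaussSample s l * (shiftDefect f ς T α (d, l) / 2))
      ≤ ς * (ς ^ (d + l) * janssenCoeff n s s (d, l) * (shiftDefect f ς T α (d, l) / 2)) := by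
    have habs : |ς * (ς ^ (d + l) * janssenCoeff n s s (d, l))|
        = gaussSample s d * gaussSample s l := by
      rw [abs_mul, abs_mul, hς, abs_zpow_of_abs_eq_one hς, one_mul, one_mul, abs_janssenCoeff]
      rfl
    have := neg_abs_le (ς * (ς ^ (d + l) * janssenCoeff n s s (d, l)))
    rw [habs] at this
    have := mul_le_mul_of_nonneg_right this (div_nonneg hD0 zero_le_two)
    linarith
  by_cases hl0 : l = 0
  · subst hl0
    by_cases hd0 : d = 0
    · subst hd0
      have : shiftDefect f ς T α (0, 0) = 0 := by simp [shiftDefect]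
      simp [this]
    have hL := shiftDefect_left_le hf hς T α d
    by_cases hd1 : d = 1
    · subst hd1
      simp [janssenCoeff_eq, hw0, ← hu, ← hq, hςq]
    by_cases hd2 : d = -1
    · subst hd2
      have := shiftDefect_neg (f := f) hς T α 1
      simp [janssenCoeff_eq, hw0, hwn, this, hςi, ← hu, hςq]
    simp [hd0, hd1, hd2, hw0] at hlow hL ⊢
    nlinarith [mul_le_mul_of_nonneg_left hL hd.le]
  · by_cases hd0 : d = 0
    · subst hd0
      have hL := shiftDefect_right_le hf hς T α l
      by_cases hl1 : l = 1
      · subst hl1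
        simp [janssenCoeff_eq, hw0, ← hv, ← hq, hςq]
        linarith
      by_cases hl2 : l = -1
      · subst hl2
        have := shiftDefect_zero_neg_one (f := f) hς T α
        simp [janssenCoeff_eq, hw0, hwn, this, hςi, ← hv, hςq]
        linarith
      simp [hl0, hl1, hl2, hw0] at hlow hL ⊢
      nlinarith [mul_le_mul_of_nonneg_left hL hl.le]
    · simp [hl0, hd0] at hlow hD ⊢
      nlinarith [mul_le_mul_of_nonneg_left hD (mul_pos hd hl).le]

/-! ### Almost invariant test functions -/

/-- The indicator of `(x₀ + jT, x₀ + jT + δ]` with sign `ς ^ j`. -/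
noncomputable def signedBump (ς x₀ T δ : ℝ) (j : ℕ) (x : ℝ) : ℝ :=
  ς ^ j * (Set.Ioc (x₀ + j * T) (x₀ + j * T + δ)).indicator 1 x

theorem signedBump_sq {ς : ℝ} (hς : |ς| = 1) (x₀ T δ : ℝ) (j : ℕ) (x : ℝ) :
    signedBump ς x₀ T δ j x ^ 2 = (Set.Ioc (x₀ + j * T) (x₀ + j * T + δ)).indicator 1 x := by
  rw [signedBump, mul_pow, ← pow_mul, mul_comm j, pow_mul, ← sq_abs ς, hς, one_pow, one_pow, one_mul]
  by_cases hx : x ∈ Set.Ioc (x₀ + j * T) (x₀ + j * T + δ) <;> simp [hx]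

theorem measurable_signedBump (ς x₀ T δ : ℝ) (j : ℕ) : Measurable (signedBump ς x₀ T δ j) :=
  (measurable_one.indicator measurableSet_Ioc).const_mul _

theorem integrable_signedBump_sq {ς : ℝ} (hς : |ς| = 1) (x₀ T δ : ℝ) (j : ℕ) :
    Integrable fun x => signedBump ς x₀ T δ j x ^ 2 := by
  simp_rw [signedBump_sq hς]
  rw [integrable_indicator_iff measurableSet_Ioc]
  exact integrableOn_const measure_Ioc_lt_top.ne

theorem integral_signedBump_sq {ς : ℝ} (hς : |ς| = 1) (x₀ T : ℝ) {δ : ℝ} (hδ : 0 ≤ δ) (j : ℕ) :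
    ∫ x, signedBump ς x₀ T δ j x ^ 2 = δ := by
  simp_rw [signedBump_sq hς]
  rw [integral_indicator_one measurableSet_Ioc, Real.volume_real_Ioc_of_le (by linarith)]
  ring

theorem memLp_signedBump {ς : ℝ} (hς : |ς| = 1) (x₀ T δ : ℝ) (j : ℕ) :
    MemLp (signedBump ς x₀ T δ j) 2 volume :=
  (memLp_two_iff_integrable_sq (measurable_signedBump _ _ _ _ _).aestronglyMeasurable).2
    (integrable_signedBump_sq hς x₀ T δ j)

theorem signedBump_mul_eq_zero (ς x₀ : ℝ) {T δ : ℝ} (hT : 0 < T) (hδ : δ ≤ T) {i j : ℕ} (hij : i ≠ j)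
    (x : ℝ) : signedBump ς x₀ T δ i x * signedBump ς x₀ T δ j x = 0 := by
  by_contra h
  obtain ⟨hi, hj⟩ := mul_ne_zero_iff.1 h
  have hi := Set.mem_of_indicator_ne_zero (right_ne_zero_of_mul hi)
  have hj := Set.mem_of_indicator_ne_zero (right_ne_zero_of_mul hj)
  have h1 : (i : ℝ) < j + 1 := lt_of_mul_lt_mul_right (by linarith [hi.1, hj.2]) hT.le
  have h2 : (j : ℝ) < i + 1 := lt_of_mul_lt_mul_right (by linarith [hj.1, hi.2]) hT.le
  have h1' : i < j + 1 := by exact_mod_cast h1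
  have h2' : j < i + 1 := by exact_mod_cast h2
  omega

theorem mul_signedBump_succ {ς : ℝ} (hς : |ς| = 1) (x₀ T δ : ℝ) (j : ℕ) (x : ℝ) :
    ς * signedBump ς x₀ T δ (j + 1) (x + T) = signedBump ς x₀ T δ j x := by
  have h1 : ς * ς = 1 := by simpa using zpow_mul_self_of_abs_eq_one hς 1
  have h2 : (Set.Ioc (x₀ + (j + 1 : ℕ) * T) (x₀ + (j + 1 : ℕ) * T + δ)).indicator (1 : ℝ → ℝ) (x + T)
      = (Set.Ioc (x₀ + j * T) (x₀ + j * T + δ)).indicator 1 x := by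
    simp only [Set.indicator_apply, Set.mem_Ioc]
    push_cast
    congr 1
    simp only [eq_iff_iff]
    constructor <;> rintro ⟨h1, h2⟩ <;> constructor <;> linarith
  rw [signedBump, signedBump, h2, pow_succ]
  linear_combination (ς ^ j * (Set.Ioc (x₀ + j * T) (x₀ + j * T + δ)).indicator 1 x) * h1

/-- A train of `N` short signed bumps. -/
noncomputable def bumpTrain (ς x₀ T δ : ℝ) (N : ℕ) (x : ℝ) : ℂ :=
  ((∑ j ∈ Finset.range N, signedBump ς x₀ T δ (j + 1) x : ℝ) : ℂ)

theorem memLp_bumpTrain {ς : ℝ} (hς : |ς| = 1) (x₀ T δ : ℝ) (N : ℕ) :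
    MemLp (bumpTrain ς x₀ T δ N) 2 volume := by
  have h : MemLp (fun x => ∑ j ∈ Finset.range N, signedBump ς x₀ T δ (j + 1) x) 2 volume :=
    memLp_finsetSum _ fun j _ => memLp_signedBump hς x₀ T δ (j + 1)
  exact h.ofReal

theorem norm_bumpTrain_sq (ς x₀ : ℝ) {T δ : ℝ} (hT : 0 < T) (hδ : δ ≤ T) (N : ℕ) (x : ℝ) :
    ‖bumpTrain ς x₀ T δ N x‖ ^ 2 = ∑ j ∈ Finset.range N, signedBump ς x₀ T δ (j + 1) x ^ 2 := by
  rw [bumpTrain, Complex.norm_real, Real.norm_eq_abs, sq_abs, sq, Finset.sum_mul_sum]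
  refine Finset.sum_congr rfl fun i hi => ?_
  rw [sq, Finset.sum_eq_single_of_mem i hi]
  intro j _ hji
  exact signedBump_mul_eq_zero ς x₀ hT hδ (by omega) x

theorem integral_norm_bumpTrain_sq {ς : ℝ} (hς : |ς| = 1) (x₀ : ℝ) {T δ : ℝ} (hT : 0 < T)
    (hδ0 : 0 ≤ δ) (hδ : δ ≤ T) (N : ℕ) : ∫ x, ‖bumpTrain ς x₀ T δ N x‖ ^ 2 = N * δ := by
  simp_rw [norm_bumpTrain_sq ς x₀ hT hδ]
  rw [integral_finsetSum _ fun j _ => integrable_signedBump_sq hς x₀ T δ (j + 1)]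
  simp [integral_signedBump_sq hς x₀ T hδ0]

/-- Shifting by one period telescopes: only the bumps with indices `0` and `N` remain, so the defect
stays bounded while the squared norm is `Nδ`. -/
theorem shiftDefect_bumpTrain_left_le {ς : ℝ} (hς : |ς| = 1) (x₀ T α : ℝ) {δ : ℝ} (hδ : 0 ≤ δ)
    (N : ℕ) : shiftDefect (bumpTrain ς x₀ T δ N) ς T α (1, 0) ≤ 4 * δ := by
  have hi := integrable_shiftDefect (memLp_bumpTrain hς x₀ T δ N) ((ς ^ (1 + 0 : ℤ) : ℝ) : ℂ) T α (1, 0)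
  have h1 := (integrable_signedBump_sq hς x₀ T δ N).const_mul 2
  have h2 := (integrable_signedBump_sq hς x₀ T δ 0).const_mul 2
  calc shiftDefect (bumpTrain ς x₀ T δ N) ς T α (1, 0)
      ≤ ∫ x, (2 * signedBump ς x₀ T δ N x ^ 2 + 2 * signedBump ς x₀ T δ 0 x ^ 2) := by
        refine integral_mono hi (h1.add h2) fun x => ?_
        have e : bumpTrain ς x₀ T δ N x - (ς : ℂ) * bumpTrain ς x₀ T δ N (x + T)
            = ((signedBump ς x₀ T δ N x - signedBump ς x₀ T δ 0 x : ℝ) : ℂ) := by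
          rw [bumpTrain, bumpTrain, ← Complex.ofReal_mul, ← Complex.ofReal_sub, Finset.mul_sum,
            ← Finset.sum_sub_distrib]
          simp only [mul_signedBump_succ hς]
          rw [Finset.sum_range_sub (fun j => signedBump ς x₀ T δ j x)]
        simp only [add_zero, zpow_one, Int.cast_zero, mul_zero, zero_mul, zero_div, Complex.exp_zero,
          one_mul, Int.cast_one]
        rw [e, Complex.norm_real, Real.norm_eq_abs, sq_abs]
        nlinarith [sq_nonneg (signedBump ς x₀ T δ N x + signedBump ς x₀ T δ 0 x)]
    _ = 4 * δ := by
        rw [integral_add h1 h2, integral_const_mul, integral_const_mul,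
          integral_signedBump_sq hς x₀ T hδ, integral_signedBump_sq hς x₀ T hδ]
        ring

/-- As `T` is an integer multiple of `α`, every bump starts at the same phase, where `ς` times the
modulation equals 1; across a bump of width `δ` the phase moves by at most `2πδ/α`. -/
theorem shiftDefect_bumpTrain_right_le {n : ℕ} {ς x₀ T α δ : ℝ} (hς : |ς| = 1) (hα : 0 < α)
    (hT0 : 0 < T) (hT : T = n * α)
    (hx₀ : (ς : ℂ) * Complex.exp (2 * Real.pi * Complex.I * x₀ / α) = 1) (hδ0 : 0 ≤ δ) (hδ : δ ≤ T)
    (N : ℕ) : shiftDefect (bumpTrain ς x₀ T δ N) ς T α (0, 1)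
      ≤ (2 * Real.pi * δ / α) ^ 2 * (N * δ) := by
  have hf := memLp_bumpTrain hς x₀ T δ N
  have hi := integrable_shiftDefect hf ((ς ^ (0 + 1 : ℤ) : ℝ) : ℂ) T α (0, 1)
  have hsq := (memLp_two_iff_integrable_sq_norm hf.1).1 hf
  rw [← integral_norm_bumpTrain_sq hς x₀ hT0 hδ0 hδ, ← integral_const_mul]
  refine integral_mono hi (hsq.const_mul _) fun x => ?_
  simp only [zero_add, zpow_one, Int.cast_zero, zero_mul, add_zero, Int.cast_one, mul_one]
  by_cases h0 : bumpTrain ς x₀ T δ N x = 0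
  · simp [h0]
  have h0' : ∑ j ∈ Finset.range N, signedBump ς x₀ T δ (j + 1) x ≠ 0 := by
    rintro h; exact h0 (by rw [bumpTrain, h, Complex.ofReal_zero])
  obtain ⟨j, _, hj⟩ := Finset.exists_ne_zero_of_sum_ne_zero h0'
  have hx := Set.mem_of_indicator_ne_zero (right_ne_zero_of_mul hj)
  set θ : ℝ := 2 * Real.pi * (x - (x₀ + (j + 1 : ℕ) * T)) / α with hθ
  have hz : (ς : ℂ) * Complex.exp (2 * Real.pi * Complex.I * x / α) = Complex.exp (Complex.I * θ) := by
    have e : (2 * Real.pi * Complex.I * x / α : ℂ) = 2 * Real.pi * Complex.I * x₀ / α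
        + ((j + 1 : ℕ) * n : ℕ) * (2 * Real.pi * Complex.I) + Complex.I * θ := by
      have hα' : (α : ℂ) ≠ 0 := by exact_mod_cast hα.ne'
      rw [hθ, hT]
      push_cast
      field_simp
      ring
    rw [e, Complex.exp_add, Complex.exp_add, Complex.exp_nat_mul_two_pi_mul_I, mul_one, ← mul_assoc,
      hx₀, one_mul]
  have e1 : bumpTrain ς x₀ T δ N x - (ς : ℂ) *
      (Complex.exp (2 * Real.pi * Complex.I * x / α) * bumpTrain ς x₀ T δ N x)
      = -((Complex.exp (Complex.I * θ) - 1) * bumpTrain ς x₀ T δ N x) := by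
    rw [← hz]; ring
  rw [e1, norm_neg, norm_mul, mul_pow]
  gcongr
  refine (Real.norm_exp_I_mul_ofReal_sub_one_le (x := θ)).trans ?_
  have h1 : 0 ≤ x - (x₀ + (j + 1 : ℕ) * T) := by linarith [hx.1]
  have hθ0 : 0 ≤ θ := div_nonneg (mul_nonneg (by positivity) h1) hα.le
  rw [Real.norm_of_nonneg hθ0, hθ]
  gcongr
  linarith [hx.2]

theorem exists_character_point {ς α : ℝ} (hς : |ς| = 1) (hα : 0 < α) :
    ∃ x₀ : ℝ, (ς : ℂ) * Complex.exp (2 * Real.pi * Complex.I * x₀ / α) = 1 := by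
  rcases (abs_eq zero_le_one).1 hς with rfl | rfl
  · exact ⟨0, by simp⟩
  · refine ⟨α / 2, ?_⟩
    have hα' : (α : ℂ) ≠ 0 := by exact_mod_cast hα.ne'
    have : (2 * Real.pi * Complex.I * (α / 2 : ℝ) / α : ℂ) = Real.pi * Complex.I := by
      push_cast; field_simp
    rw [this, Complex.exp_pi_mul_I]
    push_cast
    ring

/-- Square-integrable functions that are almost invariant under the lattice, up to a character. -/
theorem exists_shiftDefect_le {n : ℕ} {ς T α ε : ℝ} (hς : |ς| = 1) (hα : 0 < α)
    (hT0 : 0 < T) (hT : T = n * α) (hε : 0 < ε) :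
    ∃ f : ℝ → ℂ, MemLp f 2 volume ∧ 0 < ∫ x, ‖f x‖ ^ 2 ∧
      shiftDefect f ς T α (1, 0) ≤ ε * ∫ x, ‖f x‖ ^ 2 ∧
      shiftDefect f ς T α (0, 1) ≤ ε * ∫ x, ‖f x‖ ^ 2 := by
  obtain ⟨x₀, hx₀⟩ := exists_character_point hς hα
  -- The width makes `(2πδ/α)² ≤ ε`, and `N > 4/ε` below makes the end bumps, of defect `4δ`, at
  -- most `ε·Nδ`.
  set δ := min T (α * Real.sqrt ε / (2 * Real.pi)) with hδ
  have hδ0 : 0 < δ := lt_min hT0 (by positivity)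
  have hδT : δ ≤ T := min_le_left _ _
  obtain ⟨N, hN⟩ := exists_nat_gt (4 / ε)
  have hN0 : 0 < (N : ℝ) := lt_trans (by positivity) hN
  have hM := integral_norm_bumpTrain_sq hς x₀ hT0 hδ0.le hδT N
  refine ⟨bumpTrain ς x₀ T δ N, memLp_bumpTrain hς x₀ T δ N, ?_, ?_, ?_⟩
  · rw [hM]; positivity
  · refine (shiftDefect_bumpTrain_left_le hς x₀ T α hδ0.le N).trans ?_
    rw [hM, ← mul_assoc]
    rw [div_lt_iff₀ hε] at hN
    gcongr
    linarith
  · refine (shiftDefect_bumpTrain_right_le hς hα hT0 hT hx₀ hδ0.le hδT N).trans ?_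
    rw [hM]
    gcongr
    have h1 : 2 * Real.pi * δ / α ≤ Real.sqrt ε := by
      rw [div_le_iff₀ hα]
      have := min_le_right T (α * Real.sqrt ε / (2 * Real.pi))
      rw [← hδ, le_div_iff₀ (by positivity)] at this
      linarith
    calc _ ≤ Real.sqrt ε ^ 2 := by gcongr
      _ = ε := Real.sq_sqrt hε.le

/-! ### Optimal frame bounds and conclusion -/

/-- Janssen's representation of the frame sum of the Gaussian for integer redundancy. -/
theorem gaborSum_gaussian {n : ℕ} {α β : ℝ} (hα : 0 < α) (hβ : 0 < β) (hαβ : (α * β)⁻¹ = n)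
    {f : ℝ → ℂ} (hf : MemLp f 2 volume) :
    gaborSum gaussianWindow (separableLattice α β) f = ENNReal.ofReal (n *
      ∑' p, janssenCoeff n (1 / (2 * β ^ 2)) (1 / (2 * α ^ 2)) p * (crossCorr f (1 / β) α p).re) := by
  have hae := hf.1.ae_eq_mk
  have hg : ∀ h : ℝ → ℂ, innerL2 f h = innerL2 (hf.1.mk f) h := fun h =>
    integral_congr_ae (hae.mono fun x hx => by simp only [hx])
  have hJ : ∀ p, crossCorr f (1 / β) α p = crossCorr (hf.1.mk f) (1 / β) α p := by
    intro p
    have hae2 := (measurePreserving_add_right volume (p.1 * (1 / β))).quasiMeasurePreserving.ae_eq_comp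
      hae
    refine integral_congr_ae ?_
    filter_upwards [hae, hae2] with x h1 h2
    simp only [Function.comp_apply] at h2
    rw [h1, h2]
  simp only [gaborSum, hg, hJ]
  exact gaborSum_gaussian_of_measurable hα hβ hαβ hf.1.stronglyMeasurable_mk.measurable
    (hf.ae_eq hae)

theorem eLpNorm_two_sq {f : ℝ → ℂ} (hf : MemLp f 2 volume) :
    eLpNorm f 2 volume ^ 2 = ENNReal.ofReal (∫ x, ‖f x‖ ^ 2) := by
  have h := eLpNorm_nnreal_pow_eq_lintegral (f := f) (μ := volume) (p := 2) two_ne_zero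
  simp only [NNReal.coe_ofNat, ENNReal.rpow_ofNat, ENNReal.coe_ofNat] at h
  rw [h, ofReal_integral_eq_lintegral_ofReal ((memLp_two_iff_integrable_sq_norm hf.1).1 hf)
    (Filter.Eventually.of_forall fun x => sq_nonneg _)]
  simp only [ENNReal.ofReal_pow (norm_nonneg _), ofReal_norm]

section bounds

variable {n : ℕ} {α β ς C : ℝ}

theorem exists_mul_sub_tsum_le (hα : 0 < α) (hβ : 0 < β) (hαβ : (α * β)⁻¹ = n) (hς : |ς| = 1)
    (hC : HasSum (fun p : ℤ × ℤ => ς ^ (p.1 + p.2) *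
      janssenCoeff n (1 / (2 * β ^ 2)) (1 / (2 * α ^ 2)) p) C) {ε : ℝ} (hε : 0 < ε) :
    ∃ f : ℝ → ℂ, MemLp f 2 volume ∧ 0 < ∫ x, ‖f x‖ ^ 2 ∧
      |(∫ x, ‖f x‖ ^ 2) * C - ∑' p, janssenCoeff n (1 / (2 * β ^ 2)) (1 / (2 * α ^ 2)) p *
        (crossCorr f (1 / β) α p).re| ≤ ε * ∫ x, ‖f x‖ ^ 2 := by
  have hs : 0 < 1 / (2 * β ^ 2) := by positivity
  have ht : 0 < 1 / (2 * α ^ 2) := by positivity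
  set s := 1 / (2 * β ^ 2)
  set t := 1 / (2 * α ^ 2)
  set K := gaussMoment s * theta3 t + theta3 s * gaussMoment t with hK
  have hm : ∀ {r : ℝ}, 0 < r → 0 ≤ gaussMoment r := fun hr =>
    (hasSum_sq_mul_gaussSample hr).nonneg fun k => mul_nonneg (sq_nonneg _) (gaussSample_pos _ _).le
  have h1 : 0 ≤ gaussMoment s * theta3 t := mul_nonneg (hm hs) (theta3_pos ht).le
  have h2 : 0 ≤ theta3 s * gaussMoment t := mul_nonneg (theta3_pos hs).le (hm ht)
  obtain ⟨f, hf, hM, hu, hv⟩ := exists_shiftDefect_le (n := n) (T := 1 / β) hς hα (by positivity)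
    (by rw [← hαβ]; field_simp) (show 0 < ε / (K + 1) by positivity)
  refine ⟨f, hf, hM, (abs_mul_sub_tsum_le hς hs ht hf hC).trans ?_⟩
  calc _ ≤ gaussMoment s * theta3 t * (ε / (K + 1) * ∫ x, ‖f x‖ ^ 2)
        + theta3 s * gaussMoment t * (ε / (K + 1) * ∫ x, ‖f x‖ ^ 2) := by gcongr
    _ = (K / (K + 1)) * (ε * ∫ x, ‖f x‖ ^ 2) := by rw [hK]; ring
    _ ≤ 1 * (ε * ∫ x, ‖f x‖ ^ 2) := by
        gcongr
        rw [div_le_one (by positivity)]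
        linarith
    _ = _ := one_mul _

theorem tendsto_ofReal_mul_add (n : ℕ) (C a : ℝ) :
    Filter.Tendsto (fun ε : ℝ => ENNReal.ofReal (n * (C + a * ε))) (nhdsWithin 0 (Set.Ioi 0))
      (nhds (ENNReal.ofReal (n * C))) := by
  have h : Continuous fun ε : ℝ => ENNReal.ofReal (n * (C + a * ε)) :=
    ENNReal.continuous_ofReal.comp (by fun_prop)
  have := (h.tendsto 0).mono_left (nhdsWithin_le_nhds (s := Set.Ioi 0))
  simpa using this

/-- Test functions for the character `ς` force `A ≤ n(C + ε)` for every admissible `A`; then `ε →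
0`. -/
theorem optimalLowerFrameBound_le (hα : 0 < α) (hβ : 0 < β) (hαβ : (α * β)⁻¹ = n) (hς : |ς| = 1)
    (hC : HasSum (fun p : ℤ × ℤ => ς ^ (p.1 + p.2) *
      janssenCoeff n (1 / (2 * β ^ 2)) (1 / (2 * α ^ 2)) p) C) :
    optimalLowerFrameBound gaussianWindow (separableLattice α β) ≤ ENNReal.ofReal (n * C) := by
  refine sSup_le fun A hA => ge_of_tendsto (tendsto_ofReal_mul_add n C 1) ?_
  filter_upwards [self_mem_nhdsWithin] with ε hε
  obtain ⟨f, hf, hM, hle⟩ := exists_mul_sub_tsum_le hα hβ hαβ hς hC hε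
  have h := hA f hf
  rw [gaborSum_gaussian hα hβ hαβ hf, eLpNorm_two_sq hf] at h
  refine (ENNReal.mul_le_mul_iff_left (by simpa using hM) ENNReal.ofReal_ne_top).1 (h.trans ?_)
  rw [← ENNReal.ofReal_mul' hM.le, mul_assoc]
  gcongr
  linarith [(abs_le.1 hle).1]

theorem le_optimalUpperFrameBound (hα : 0 < α) (hβ : 0 < β) (hαβ : (α * β)⁻¹ = n) (hς : |ς| = 1)
    (hC : HasSum (fun p : ℤ × ℤ => ς ^ (p.1 + p.2) *
      janssenCoeff n (1 / (2 * β ^ 2)) (1 / (2 * α ^ 2)) p) C) :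
    ENNReal.ofReal (n * C) ≤ optimalUpperFrameBound gaussianWindow (separableLattice α β) := by
  refine le_sInf fun B hB => le_of_tendsto (tendsto_ofReal_mul_add n C (-1)) ?_
  filter_upwards [self_mem_nhdsWithin] with ε hε
  obtain ⟨f, hf, hM, hle⟩ := exists_mul_sub_tsum_le hα hβ hαβ hς hC hε
  have h := hB f hf
  rw [gaborSum_gaussian hα hβ hαβ hf, eLpNorm_two_sq hf] at h
  refine (ENNReal.mul_le_mul_iff_left (by simpa using hM) ENNReal.ofReal_ne_top).1 (le_trans ?_ h)
  rw [← ENNReal.ofReal_mul' hM.le, mul_assoc]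
  gcongr
  linarith [(abs_le.1 hle).2]

end bounds

section square

variable {n : ℕ} {γ C : ℝ}

theorem one_div_two_mul_sq_of_inv_eq (hγn : (γ * γ)⁻¹ = (n : ℝ)) : 1 / (2 * γ ^ 2) = (n : ℝ) / 2 := by
  rw [← hγn, sq, one_div, mul_inv]; ring

/-- The case `ς = -1` of `mul_sub_tsum_nonneg`, at `s = t = n/2 ≥ 1/2`. -/
theorem le_optimalLowerFrameBound_square (hn : 1 ≤ n) (hγ : 0 < γ) (hγn : (γ * γ)⁻¹ = (n : ℝ))
    (hC : HasSum (fun p : ℤ × ℤ => (-1) ^ (p.1 + p.2) * janssenCoeff n (n / 2) (n / 2) p) C) :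
    ENNReal.ofReal (n * C) ≤ optimalLowerFrameBound gaussianWindow (separableLattice γ γ) := by
  have hn' : (1 : ℝ) ≤ n := by exact_mod_cast hn
  refine le_sSup fun f hf => ?_
  rw [gaborSum_gaussian hγ hγ hγn hf, eLpNorm_two_sq hf, one_div_two_mul_sq_of_inv_eq hγn,
    ← ENNReal.ofReal_mul' (integral_nonneg fun _ => sq_nonneg _), mul_assoc]
  gcongr
  have := mul_sub_tsum_nonneg (T := 1 / γ) (α := γ) (by norm_num) (by linarith) hf hC
  linarith

theorem optimalUpperFrameBound_square_le (hn : 1 ≤ n) (hγ : 0 < γ) (hγn : (γ * γ)⁻¹ = (n : ℝ))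
    (hC : HasSum (fun p : ℤ × ℤ => 1 ^ (p.1 + p.2) * janssenCoeff n (n / 2) (n / 2) p) C) :
    optimalUpperFrameBound gaussianWindow (separableLattice γ γ) ≤ ENNReal.ofReal (n * C) := by
  have hn' : (1 : ℝ) ≤ n := by exact_mod_cast hn
  refine sInf_le fun f hf => ?_
  rw [gaborSum_gaussian hγ hγ hγn hf, eLpNorm_two_sq hf, one_div_two_mul_sq_of_inv_eq hγn,
    ← ENNReal.ofReal_mul' (integral_nonneg fun _ => sq_nonneg _), mul_assoc]
  gcongr
  have := mul_sub_tsum_nonneg (T := 1 / γ) (α := γ) (by norm_num) (by linarith) hf hC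
  linarith

end square

theorem hasSum_one_zpow_mul_gaussSample {s : ℝ} (hs : 0 < s) :
    HasSum (fun k : ℤ => (1 : ℝ) ^ k * gaussSample s k) (theta3 s) := by
  simpa using hasSum_gaussSample hs

theorem hasSum_neg_one_zpow_mul_gaussSample {s : ℝ} (hs : 0 < s) :
    HasSum (fun k : ℤ => (-1 : ℝ) ^ k * gaussSample s k) (theta4 s) := hasSum_theta4 hs

/-- For integer redundancy, the square lattice maximizes the symbol at the character `-1` and
minimizes it at the trivial character. -/
theorem exists_hasSum_janssenCoeff {n : ℕ} (hn : 1 ≤ n) {s t : ℝ} (hs : 0 < s) (ht : 0 < t)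
    (h : s * t = ((n : ℝ) / 2) ^ 2) : ∃ a b a₀ b₀ : ℝ,
      HasSum (fun p : ℤ × ℤ => (-1) ^ (p.1 + p.2) * janssenCoeff n s t p) a ∧
      HasSum (fun p : ℤ × ℤ => 1 ^ (p.1 + p.2) * janssenCoeff n s t p) b ∧
      HasSum (fun p : ℤ × ℤ => (-1) ^ (p.1 + p.2) * janssenCoeff n (n / 2) (n / 2) p) a₀ ∧
      HasSum (fun p : ℤ × ℤ => 1 ^ (p.1 + p.2) * janssenCoeff n (n / 2) (n / 2) p) b₀ ∧
      a ≤ a₀ ∧ b₀ ≤ b := by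
  have hr : 0 < (n : ℝ) / 2 := by
    have : (1 : ℝ) ≤ n := by exact_mod_cast hn
    positivity
  have h1 : |(1 : ℝ)| = 1 := by norm_num
  have h2 : |(-1 : ℝ)| = 1 := by norm_num
  have hθ3 := fun {s : ℝ} (hs : 0 < s) => hasSum_one_zpow_mul_gaussSample hs
  have hθ4 := fun {s : ℝ} (hs : 0 < s) => hasSum_neg_one_zpow_mul_gaussSample hs
  have hle3 := theta3_sq_le hr hs ht h
  have hle4 := theta4_mul_le_sq hr hs ht h
  have hle2 := theta2_mul_le_sq (show 0 < 4 * ((n : ℝ) / 2) by linarith)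
    (show 0 < 4 * s by linarith) (show 0 < 4 * t by linarith) (by linear_combination 16 * h)
  rcases Nat.even_or_odd n with he | ho
  · refine ⟨_, _, _, _, hasSum_zpow_mul_janssenCoeff_of_even he h2 (hθ4 hs) (hθ4 ht),
      hasSum_zpow_mul_janssenCoeff_of_even he h1 (hθ3 hs) (hθ3 ht),
      hasSum_zpow_mul_janssenCoeff_of_even he h2 (hθ4 hr) (hθ4 hr),
      hasSum_zpow_mul_janssenCoeff_of_even he h1 (hθ3 hr) (hθ3 hr), ?_, ?_⟩ <;> nlinarith
  · refine ⟨_, _, _, _, hasSum_zpow_mul_janssenCoeff_of_odd ho h2 hs ht (hθ4 hs) (hθ4 ht),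
      hasSum_zpow_mul_janssenCoeff_of_odd ho h1 hs ht (hθ3 hs) (hθ3 ht),
      hasSum_zpow_mul_janssenCoeff_of_odd ho h2 hr hr (hθ4 hr) (hθ4 hr),
      hasSum_zpow_mul_janssenCoeff_of_odd ho h1 hr hr (hθ3 hr) (hθ3 hr), ?_, ?_⟩
    -- At the character `-1` both products increase towards the square lattice and are subtracted,
    -- hence the separate argument. At the trivial character `θ₃θ₃` decreases while `θ₂θ₂`
    -- increases, so the two inequalities simply add.
    · exact oddSymbolMin_le ho hs ht h
    · nlinarith

theorem theorem1 (n : ℕ) (α β γ : ℝ) (hα : 0 < α) (hβ : 0 < β) (hγ : 0 < γ)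
    (hαβ : (α * β)⁻¹ = (n : ℝ)) (hγn : (γ * γ)⁻¹ = (n : ℝ)) :
    optimalLowerFrameBound gaussianWindow (separableLattice α β)
        ≤ optimalLowerFrameBound gaussianWindow (separableLattice γ γ) ∧
      optimalUpperFrameBound gaussianWindow (separableLattice γ γ)
        ≤ optimalUpperFrameBound gaussianWindow (separableLattice α β) := by
  have hn : 1 ≤ n := by
    have : (0 : ℝ) < n := hαβ ▸ by positivity
    exact_mod_cast this
  have hst : 1 / (2 * β ^ 2) * (1 / (2 * α ^ 2)) = ((n : ℝ) / 2) ^ 2 := by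
    rw [← hαβ]; field_simp
  obtain ⟨a, b, a₀, b₀, ha, hb, ha₀, hb₀, hle, hle'⟩ := exists_hasSum_janssenCoeff hn
    (show 0 < 1 / (2 * β ^ 2) by positivity) (show 0 < 1 / (2 * α ^ 2) by positivity) hst
  constructor
  -- The chain is `A(α,β) ≤ n a ≤ n a₀ ≤ A(γ,γ)`: the symbol value bounds `A` from above on the
  -- given lattice and from below on the square one.
  · refine (optimalLowerFrameBound_le hα hβ hαβ (by norm_num) ha).trans (le_trans ?_
      (le_optimalLowerFrameBound_square hn hγ hγn ha₀))
    gcongr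
  · refine le_trans ((optimalUpperFrameBound_square_le hn hγ hγn hb₀).trans ?_)
      (le_optimalUpperFrameBound hα hβ hαβ (by norm_num) hb)
    gcongr
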